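/- **Setting.** Let $\mathscr M\subset M_n(\mathbb R)\times M_{n,m}(\mathbb R)\times M_{p,n}(\mathbb R)$ be bounded and nonempty. For an interval $I$ let $L_\infty(I,\mathscr M)$ be the set of measurable $\mathscr M$-valued signals on $I$ (up to a.e. equality). Let $\mathcal T\subset L_\infty([0,\infty),\mathscr M)$ and $\mathcal G=\bigcup_{t\ge0}\mathcal G_t$ with $\mathcal G_t\subset L_\infty([0,t],\mathscr M)$, such that $\mathcal T$ contains every infinite concatenation $\sigma_1*\sigma_2*\cdots$ with $\sigma_k\in\mathcal G_{t_k}$, $\sum_k t_k=\infty$. Consider the switched system $\dot x=A(t)x+B(t)u$, $y=C(t)x$, $(A,B,C)\in\mathcal T$ (solutions in the sense of Carathéodory), and $$\gamma_2(\mathcal T)=\sup\Big\{\tfrac{\|y_{u,\sigma}\|_2}{\|u\|_2}\ :\ u\in L_2([0,\infty),\mathbb R^m)\setminus\{0\},\ \sigma\in\mathcal T\Big\}\in[0,\infty],$$ where $y_{u,\sigma}$ is the output of the trajectory with $x(0)=0$. Write $\mathcal F^{\rm arb}_t(\mathscr M)=L_\infty([0,t],\mathscr M)$, $\mathcal F^{\rm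 pc}_t(\mathscr M)$ for the piecewise constant $\mathscr M$-valued signals on $[0,t]$ with finitely many pieces, $\Phi_A(t,s)$ for the fundamental matrix of $\dot x=Ax$ from time $s$ to time $t$, and, for a law $\sigma=(A,B,C)$, $$W^c_\sigma(t)=\int_0^t\Phi_A(0,s)B(s)B(s)^T\Phi_A(0,s)^Tds,\qquad W^o_\sigma(t)=\int_0^t\Phi_A(s,0)^TC(s)^TC(s)\Phi_A(s,0)\,ds .$$ The subscript $A$ on a set or class denotes its image under $(A,B,C)\mapsto A$. *Assumption T1* for $(\mathcal T,\mathcal G)$: $A(t+\cdot)\in\mathcal T_A$ for all $A\in\mathcal T_A$, $t\ge0$; and $A_1*A_2\in(\mathcal G_A)_{s+t}$ for all $s,t\ge0$, $A_1\in(\mathcal G_A)_s$, $A_2\in(\mathcal G_A)_t$. *Assumption T2* for $(\mathcal T,\mathcal G)$ (relative to $\mathscr M$): (i) for all $t,\varepsilon>0$ and $A\in\mathcal F^{\rm pc}_t(\mathscr M_A)$ there is a path $(0,1]\ni\lambda\mapsto(t_\lambda,A_\lambda)$ with $t_\lambda>0$, $A_\lambda\in\mathcal F^{\rm arb}_{t_\lambda}(\mathscr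 M_A)$, such that $\lambda\mapsto\Phi_{A_\lambda}(t_\lambda,0)$ is analytic, $\|\Phi_{A_1}(t_1,0)-\Phi_A(t,0)\|\le\varepsilon$, and $\{\lambda\in(0,1]: A_\lambda\in(\mathcal G_A)_{t_\lambda}\}$ has nonempty interior; (ii) for all $t^*,\varepsilon>0$ and $\sigma\in\mathcal F^{\rm pc}_{t^*}(\mathscr M)$ there is a path $[0,1]\ni\lambda\mapsto(t_\lambda,\sigma_\lambda)$ with $t_\lambda>0$, $\sigma_\lambda\in\mathcal F^{\rm arb}_{t_\lambda}(\mathscr M)$, such that $\lambda\mapsto(W^c_{\sigma_\lambda}(t_\lambda),W^o_{\sigma_\lambda}(t_\lambda))$ is analytic, $\|W^c_{\sigma_1}(t_1)-W^c_\sigma(t^*)\|\le\varepsilon$, $\|W^o_{\sigma_1}(t_1)-W^o_\sigma(t^*)\|\le\varepsilon$, and $\{\lambda\in[0,1]:\sigma_\lambda\in\mathcal G_{t_\lambda}\}$ has nonempty interior. *Controllability and observability.* A point $z$ is $\mathcal G$-reachable if for some $t\ge0$, $\sigma\in\mathcal G_t$ and $u\in L_2$ the trajectory starting at $0$ is at $z$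 at time $t$. A point $z$ is $\mathcal G$-observable if for some $t\ge0$ and $\sigma\in\mathcal G_t$ the output on $[0,t]$ of the trajectory starting at $z$ with zero input is not a.e. zero. The system is $\mathcal G$-controllable if all points are $\mathcal G$-reachable, and $\mathcal G$-observable if all nonzero points are $\mathcal G$-observable. *Minimal realization.* For an invertible $k\times k$ matrix $P$ and $r\le k$ put $\Pi_{P,r}(A,B,C)=(UP^{-1}APU^T,\,UP^{-1}B,\,CPU^T)$ with $U=(\mathrm{Id}_r\ 0)\in M_{r,k}(\mathbb R)$. Let $P$ be an invertible $n\times n$ matrix whose first $r$ columns form a basis of the set of $\mathcal F^{\rm arb}(\mathscr M)$-reachable points. Let $Q$ be an invertible $r\times r$ matrix whose last $r-n'$ columns form a basis of the set of points that are not $\mathcal F^{\rm arb}(\Pi_{P,r}(\mathscr M))$-observable. Then $\Pi=\Pi_{Q,n'}\circ\Pi_{P,r}$ is called the map onto a minimal realization, of dimension $n'$, of the system with arbitrary switching in $\mathscr M$. **Proposition.** Assume that $(\mathcal T,\mathcal G)$ satisfies T2. Then such a minimal realization exists. Moreover, for every such $\Pi$ (and its $n'$), $\Pi$ is a surjective linear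 map onto $M_{n'}(\mathbb R)\times M_{n',m}(\mathbb R)\times M_{p,n'}(\mathbb R)$, and, with $\mathscr M^{\min}=\Pi(\mathscr M)$, $\mathcal T^{\min}=\{\Pi\circ\sigma:\sigma\in\mathcal T\}$ and $\mathcal G^{\min}_t=\{\Pi\circ\sigma:\sigma\in\mathcal G_t\}$: 1. $\mathscr M^{\min}$ is bounded and nonempty, the signals in $\mathcal T^{\min}$ and $\mathcal G^{\min}$ take values in $\mathscr M^{\min}$, and $\mathcal T^{\min}$ contains every infinite concatenation of signals of $\mathcal G^{\min}$ as above; 2. the system associated with $\mathcal T^{\min}$ is $\mathcal G^{\min}$-controllable and $\mathcal G^{\min}$-observable; 3. $(\mathcal T^{\min},\mathcal G^{\min})$ satisfies T2 (relative to $\mathscr M^{\min}$); 4. $\gamma_2(\mathcal T)=\gamma_2(\mathcal T^{\min})$; 5. if $(\mathcal T,\mathcal G)$ satisfies T1, then so does $(\mathcal T^{\min},\mathcal G^{\min})$. -/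

import Mathlib

open Set Filter Topology MeasureTheory
open scoped Matrix ENNReal Matrix.Norms.L2Operator

noncomputable section

namespace SwitchedGain

/-- Triples `(A, B, C)` of an `n × n`, an `n × m` and a `p × n` real matrix. -/
abbrev Triple (n m p : ℕ) : Type :=
  Matrix (Fin n) (Fin n) ℝ × Matrix (Fin n) (Fin m) ℝ × Matrix (Fin p) (Fin n) ℝ

/-! ### Signals and classes of signals

A signal on a time interval `I` with values in `E` is a measurable function up to equality
almost everywhere on `I`. -/

/-- Signals on `I`, up to almost everywhere equality. -/
abbrev Signal (I : Set ℝ) (E : Type*) [TopologicalSpace E] : Type _ :=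
  ℝ →ₘ[volume.restrict I] E

/-- A set of signals on `[0, ∞)`. -/
abbrev SignalClass (E : Type*) [TopologicalSpace E] : Type _ := Set (Signal (Ici 0) E)

/-- A family `(F t)` of sets of signals, `F t` consisting of signals on `[0, t]`
(only `t ≥ 0` matters). -/
abbrev SignalFamily (E : Type*) [TopologicalSpace E] : Type _ :=
  ∀ t : ℝ, Set (Signal (Icc 0 t) E)

/-- `L_∞(I, M)` for a bounded set `M`: the signals on `I` with values in `M`. -/
def valuedIn {E : Type*} [TopologicalSpace E] (I : Set ℝ) (M : Set E) : Set (Signal I E) :=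
  {f | ∀ᵐ s ∂(volume.restrict I), f s ∈ M}

/-- Arbitrarily switching signals on finite intervals. -/
def arbFamily {E : Type*} [TopologicalSpace E] (M : Set E) : SignalFamily E :=
  fun t => valuedIn (Icc 0 t) M

/-- Piecewise constant signals on finite intervals. -/
def pcFamily {E : Type*} [TopologicalSpace E] (M : Set E) : SignalFamily E :=
  fun t => {f | ∃ (N : ℕ) (τ : ℕ → ℝ) (v : ℕ → E), Monotone τ ∧ τ 0 = 0 ∧ τ N = t ∧
    ∀ i < N, v i ∈ M ∧ ∀ᵐ s ∂(volume.restrict (Ioc (τ i) (τ (i + 1)))), f s = v i}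

/-- `h` is the concatenation `f * g` of `f` on `[0, s]` and `g` on `[0, t]`. -/
def IsConcat {E : Type*} [TopologicalSpace E] {s t : ℝ}
    (f : Signal (Icc 0 s) E) (g : Signal (Icc 0 t) E) (h : Signal (Icc 0 (s + t)) E) : Prop :=
  (∀ᵐ r ∂(volume.restrict (Icc 0 s)), h r = f r) ∧
    ∀ᵐ r ∂(volume.restrict (Icc 0 t)), h (s + r) = g r

/-- `F_∞`: the signals on `[0, ∞)` that are infinite concatenations `f 0 * f 1 * ⋯` with
`f k ∈ F (τ k)`, `τ k ≥ 0` and `∑ τ k = ∞`. -/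
def concatClass {E : Type*} [TopologicalSpace E] (F : SignalFamily E) : SignalClass E :=
  {h | ∃ (τ : ℕ → ℝ) (f : ∀ k, Signal (Icc 0 (τ k)) E),
    (∀ k, 0 ≤ τ k) ∧ (∀ k, f k ∈ F (τ k)) ∧
    Tendsto (fun N => ∑ i ∈ Finset.range N, τ i) atTop atTop ∧
    ∀ k, ∀ᵐ r ∂(volume.restrict (Icc 0 (τ k))), h (∑ i ∈ Finset.range k, τ i + r) = f k r}

/-- The image of a class of signals under a pointwise linear map. -/
def mapClass {E F : Type*} [TopologicalSpace E] [AddCommMonoid E] [Module ℝ E]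
    [TopologicalSpace F] [AddCommMonoid F] [Module ℝ F] (L : E →L[ℝ] F)
    (S : SignalClass E) : SignalClass F :=
  (fun f => AEEqFun.comp L L.continuous f) '' S

/-- The image of a family of signals under a pointwise linear map. -/
def mapFamily {E F : Type*} [TopologicalSpace E] [AddCommMonoid E] [Module ℝ E]
    [TopologicalSpace F] [AddCommMonoid F] [Module ℝ F] (L : E →L[ℝ] F)
    (G : SignalFamily E) : SignalFamily F :=
  fun t => (fun f => AEEqFun.comp L L.continuous f) '' G t

/-! ### Flows, trajectories, Gramians, gain -/

/-- `X` solves `X' = A X`, `X s = 1` on the interval between `s` and `t` (Carathéodory solution,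
in integral form). -/
def IsFundamental {n : ℕ} (A : ℝ → Matrix (Fin n) (Fin n) ℝ) (s t : ℝ)
    (X : ℝ → Matrix (Fin n) (Fin n) ℝ) : Prop :=
  ContinuousOn X (uIcc s t) ∧ ∀ r ∈ uIcc s t,
    IntervalIntegrable (fun q => A q * X q) volume s r ∧ X r = 1 + ∫ q in s..r, A q * X q

open Classical in
/-- The fundamental matrix `Φ_A(t, s)` of `x' = A x` from time `s` to time `t`
(also for `t < s`). -/
def flow {n : ℕ} (A : ℝ → Matrix (Fin n) (Fin n) ℝ) (t s : ℝ) : Matrix (Fin n) (Fin n) ℝ :=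
  if h : ∃ X, IsFundamental A s t X then h.choose t else 0

/-- Controllability Gramian in time `t`. -/
def ctrlGramian {n m p : ℕ} (σ : ℝ → Triple n m p) (t : ℝ) : Matrix (Fin n) (Fin n) ℝ :=
  ∫ s in (0 : ℝ)..t, flow (fun r => (σ r).1) 0 s * (σ s).2.1 * ((σ s).2.1)ᵀ *
    (flow (fun r => (σ r).1) 0 s)ᵀ

/-- Observability Gramian in time `t`. -/
def obsGramian {n m p : ℕ} (σ : ℝ → Triple n m p) (t : ℝ) : Matrix (Fin n) (Fin n) ℝ :=
  ∫ s in (0 : ℝ)..t, (flow (fun r => (σ r).1) s 0)ᵀ * ((σ s).2.2)ᵀ * (σ s).2.2 *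
    flow (fun r => (σ r).1) s 0

/-- `x` is the trajectory on `I` (an interval starting at time `0`) of `x' = A x + B u`
with `x 0 = x₀` (Carathéodory solution, in integral form). -/
def IsTrajectory {n m p : ℕ} (σ : ℝ → Triple n m p) (u : ℝ → EuclideanSpace ℝ (Fin m))
    (x₀ : Fin n → ℝ) (I : Set ℝ) (x : ℝ → Fin n → ℝ) : Prop :=
  ContinuousOn x I ∧ ∀ t ∈ I,
    IntervalIntegrable (fun s => (σ s).1 *ᵥ x s + (σ s).2.1 *ᵥ (u s).ofLp) volume 0 t ∧
    x t = x₀ + ∫ s in (0 : ℝ)..t, ((σ s).1 *ᵥ x s + (σ s).2.1 *ᵥ (u s).ofLp)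

/-- The `L_2`-gain of a class of switching laws: the supremum in `[0, ∞]` of
`‖y_{u,σ}‖₂ / ‖u‖₂` over nonzero inputs `u ∈ L_2([0, ∞), ℝ^m)` and laws `σ`, where `y_{u,σ}` is
the output of the trajectory starting at `0`. -/
def gain {n m p : ℕ} (T : SignalClass (Triple n m p)) : ℝ≥0∞ :=
  sSup {g | ∃ σ ∈ T, ∃ (u : ℝ → EuclideanSpace ℝ (Fin m)) (x : ℝ → Fin n → ℝ),
    MemLp u 2 (volume.restrict (Ici 0)) ∧ ¬ (u =ᵐ[volume.restrict (Ici 0)] 0) ∧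
    IsTrajectory σ u 0 (Ici 0) x ∧
    g = eLpNorm (fun t => (WithLp.toLp 2 ((σ t).2.2 *ᵥ x t) : EuclideanSpace ℝ (Fin p))) 2
          (volume.restrict (Ici 0)) / eLpNorm u 2 (volume.restrict (Ici 0))}

/-! ### Assumptions on pairs of classes -/

/-- Shift-invariance. -/
def A0 {E : Type*} [TopologicalSpace E] (S : SignalClass E) : Prop :=
  ∀ f ∈ S, ∀ t : ℝ, 0 ≤ t →
    ∃ g ∈ S, ∀ᵐ r ∂(volume.restrict (Ici 0)), g r = f (t + r)

/-- Concatenability. -/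
def A1 {E : Type*} [TopologicalSpace E] (F : SignalFamily E) : Prop :=
  ∀ s t : ℝ, 0 ≤ s → 0 ≤ t → ∀ f ∈ F s, ∀ g ∈ F t, ∃ h ∈ F (s + t), IsConcat f g h

/-- Analytic propagation. -/
def A4 {n : ℕ} (M : Set (Matrix (Fin n) (Fin n) ℝ))
    (F : SignalFamily (Matrix (Fin n) (Fin n) ℝ)) : Prop :=
  ∀ t ε : ℝ, 0 < t → 0 < ε → ∀ A ∈ pcFamily M t,
    ∃ (τ : ℝ → ℝ) (a : ∀ l : ℝ, Signal (Icc 0 (τ l)) (Matrix (Fin n) (Fin n) ℝ)),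
      (∀ l ∈ Ioc (0 : ℝ) 1, 0 < τ l ∧ a l ∈ arbFamily M (τ l)) ∧
      AnalyticOn ℝ (fun l => flow (a l) (τ l) 0) (Ioc 0 1) ∧
      ‖flow (a 1) (τ 1) 0 - flow A t 0‖ ≤ ε ∧
      (interior {l : ℝ | l ∈ Ioc (0 : ℝ) 1 ∧ a l ∈ F (τ l)}).Nonempty

/-- The projection `(A, B, C) ↦ A`. -/
abbrev projA (n m p : ℕ) : Triple n m p →L[ℝ] Matrix (Fin n) (Fin n) ℝ :=
  ContinuousLinearMap.fst ℝ _ _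

/-- Assumption T1 on `(T, G)`: the `A`-parts satisfy shift-invariance and concatenability. -/
def T1 {n m p : ℕ} (T : SignalClass (Triple n m p)) (G : SignalFamily (Triple n m p)) : Prop :=
  A0 (mapClass (projA n m p) T) ∧ A1 (mapFamily (projA n m p) G)

/-- Assumption T2 (the class on `[0, ∞)` does not enter): analytic propagation for the
`A`-parts, and analytic propagation of the Gramians. -/
def T2 {n m p : ℕ} (M : Set (Triple n m p)) (G : SignalFamily (Triple n m p)) : Prop :=
  A4 (projA n m p '' M) (mapFamily (projA n m p) G) ∧
  ∀ t ε : ℝ, 0 < t → 0 < ε → ∀ σ ∈ pcFamily M t,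
    ∃ (τ : ℝ → ℝ) (a : ∀ l : ℝ, Signal (Icc 0 (τ l)) (Triple n m p)),
      (∀ l ∈ Icc (0 : ℝ) 1, 0 < τ l ∧ a l ∈ arbFamily M (τ l)) ∧
      AnalyticOn ℝ (fun l => (ctrlGramian (a l) (τ l), obsGramian (a l) (τ l))) (Icc 0 1) ∧
      ‖ctrlGramian (a 1) (τ 1) - ctrlGramian σ t‖ ≤ ε ∧
      ‖obsGramian (a 1) (τ 1) - obsGramian σ t‖ ≤ ε ∧
      (interior {l : ℝ | l ∈ Icc (0 : ℝ) 1 ∧ a l ∈ G (τ l)}).Nonempty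

/-- The standing assumptions: `M` is bounded and nonempty, the laws in `T` and in `G` take values
in `M`, and `T` contains the infinite concatenations of laws in `G`. -/
structure IsSwitchedPair {n m p : ℕ} (M : Set (Triple n m p)) (T : SignalClass (Triple n m p))
    (G : SignalFamily (Triple n m p)) : Prop where
  bounded : Bornology.IsBounded M
  nonempty : M.Nonempty
  valued_class : T ⊆ valuedIn (Ici 0) M
  valued_family : ∀ t : ℝ, 0 ≤ t → G t ⊆ arbFamily M t
  concat_subset : concatClass G ⊆ T

/-! ### Reachability and observability -/

/-- The `G`-reachable points. -/
def reachableSet {n m p : ℕ} (G : SignalFamily (Triple n m p)) : Set (Fin n → ℝ) :=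
  {z | ∃ t : ℝ, 0 ≤ t ∧ ∃ σ ∈ G t, ∃ (u : ℝ → EuclideanSpace ℝ (Fin m)) (x : ℝ → Fin n → ℝ),
    MemLp u 2 (volume.restrict (Ici 0)) ∧ IsTrajectory σ u 0 (Icc 0 t) x ∧ x t = z}

/-- The `G`-observable points: for some law in `G` the free output started at that point
is not zero (as an element of `L_2(0, t)`). -/
def observableSet {n m p : ℕ} (G : SignalFamily (Triple n m p)) : Set (Fin n → ℝ) :=
  {z | ∃ t : ℝ, 0 ≤ t ∧ ∃ σ ∈ G t, ∃ x : ℝ → Fin n → ℝ,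
    IsTrajectory σ (fun _ => 0) z (Icc 0 t) x ∧
    ¬ ∀ᵐ s ∂(volume.restrict (Icc 0 t)), (σ s).2.2 *ᵥ x s = 0}

/-- Every point is `G`-reachable. -/
def IsControllable {n m p : ℕ} (G : SignalFamily (Triple n m p)) : Prop :=
  reachableSet G = univ

/-- Every nonzero point is `G`-observable (the origin never is). -/
def IsObservable {n m p : ℕ} (G : SignalFamily (Triple n m p)) : Prop :=
  ∀ z : Fin n → ℝ, z ≠ 0 → z ∈ observableSet G

/-! ### Minimal realizations -/

/-- The `r × n` matrix `(Id_r 0)`. -/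
def truncation (r n : ℕ) : Matrix (Fin r) (Fin n) ℝ :=
  Matrix.of fun i j => if (i : ℕ) = (j : ℕ) then 1 else 0

/-- The map `(A, B, C) ↦ (U P⁻¹ A P Uᵀ, U P⁻¹ B, C P Uᵀ)` with `U = (Id_r 0)`: change coordinates
by `P` and keep the first `r` coordinates. -/
def reduction {n : ℕ} (m p r : ℕ) (P : Matrix (Fin n) (Fin n) ℝ) :
    Triple n m p →L[ℝ] Triple r m p where
  toFun σ := (truncation r n * P⁻¹ * σ.1 * P * (truncation r n)ᵀ,
    truncation r n * P⁻¹ * σ.2.1, σ.2.2 * P * (truncation r n)ᵀ)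
  map_add' σ ρ := by simp [Matrix.mul_add, Matrix.add_mul]
  map_smul' c σ := by simp
  cont := by fun_prop

/-- `P` is invertible and its first `r` columns form a basis of the set of points that are
reachable with arbitrary switching in `M`; the other columns span a supplementary space. -/
def IsReachableBasis {n m p : ℕ} (M : Set (Triple n m p)) (r : ℕ)
    (P : Matrix (Fin n) (Fin n) ℝ) : Prop :=
  r ≤ n ∧ IsUnit P ∧
    reachableSet (arbFamily M) = {z | ∀ i : Fin n, r ≤ (i : ℕ) → (P⁻¹ *ᵥ z) i = 0}

/-- `Q` is invertible and its columns after the first `s` form a basis of the set of points that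
are not observable with arbitrary switching in `M`; the first `s` columns span a supplementary
space, the observable part. -/
def IsObservableBasis {n m p : ℕ} (M : Set (Triple n m p)) (s : ℕ)
    (Q : Matrix (Fin n) (Fin n) ℝ) : Prop :=
  s ≤ n ∧ IsUnit Q ∧
    (observableSet (arbFamily M))ᶜ = {z | ∀ i : Fin n, (i : ℕ) < s → (Q⁻¹ *ᵥ z) i = 0}

/-- `L` is the map onto a minimal realization of dimension `n'` of the system with arbitrary
switching in `M`: the reduction to the reachable part of `M`, followed by the reduction
to the observable part of the result. -/
def IsMinimalRealization {n m p : ℕ} (M : Set (Triple n m p)) (n' : ℕ)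
    (L : Triple n m p →L[ℝ] Triple n' m p) : Prop :=
  ∃ (r : ℕ) (P : Matrix (Fin n) (Fin n) ℝ) (Q : Matrix (Fin r) (Fin r) ℝ),
    IsReachableBasis M r P ∧ IsObservableBasis (reduction m p r P '' M) n' Q ∧
    L = (reduction m p n' Q).comp (reduction m p r P)

end SwitchedGain

end

/-! The heart of the matter is that, for arbitrary switching in a bounded nonempty set, a single
piecewise constant law detects everything observable, and dually a single one reaches everything
reachable. The kernel of the observability Gramian of a law consists of the states whose free output
vanishes. Preceding a law by a constant piece `(a, c)` of length `h` turns its Gramian `W` into `Γ +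
e^{ha}ᵀ W e^{ha}`, where `Γ` is the Gramian of the piece. If `ker W` has minimal dimension,
positivity forces the new kernel to be `e^{-ha} ker W`, and forces `c` to vanish on `ker W`. The sum
of all minimal kernels is therefore invariant under every `a` and annihilated by every `c`, so each
of them lies in the largest such subspace (`exists_ker_le_unobsSubspace`). Controllability is the
same statement for the pairs `(-Aᵀ, Bᵀ)`, because the adjoint flow is the transposed inverse flow.
Consequently the reachable points and the unobservable points form the subspaces predicted by linear
algebra (`reachableSet_arbFamily`, `compl_observableSet_arbFamily`), and adapted bases exist.

Each of the two reductions has the form `(A, B, C) ↦ (J A K, J B, C K)` with `J K = 1`, where `K`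
embeds an invariant subspace containing all inputs or `J` is the quotient by an invariant subspace
invisible to all outputs (`IsReduction`). By uniqueness of solutions, trajectories, flows and
Gramians of the two systems correspond under `J` and `K`. Outputs from the zero state agree, so the
gain is unchanged (`IsReduction.gain_eq`). Flows and Gramians change by fixed linear maps, so
analytic paths and approximations are carried along (`IsReduction.T2_map`). Applying both reductions
leaves no uncontrollable form and no unobservable state.

Finally, T2 transfers controllability and observability from arbitrary switching to the given
family: the Gramian determinant is analytic along the path and nonzero at its end `λ = 1`, hence it
cannot vanish on the open set of parameters whose laws belong to the family (`isControllable_of_T2`,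
`isObservable_of_T2`). -/

noncomputable section

namespace SwitchedGain

/-! ### Linear Carathéodory equations -/

section LinearODE

variable {E : Type*} [NormedAddCommGroup E] [NormedSpace ℝ E]

/-- `x` is a Carathéodory solution of `x' = A x + f`, `x s = x₀` on `I`. -/
def IsSolution (A : ℝ → E →L[ℝ] E) (f : ℝ → E) (s : ℝ) (x₀ : E) (I : Set ℝ) (x : ℝ → E) : Prop :=
  ContinuousOn x I ∧ ∀ r ∈ I, x r = x₀ + ∫ q in s..r, (A q (x q) + f q)

theorem _root_.MeasureTheory.MemLp.exists_ae_norm_le {α F : Type*} [MeasurableSpace α]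
    [NormedAddCommGroup F] {μ : Measure α} {f : α → F} (hf : MemLp f ∞ μ) :
    ∃ K : ℝ, 0 ≤ K ∧ ∀ᵐ x ∂μ, ‖f x‖ ≤ K := by
  have h := hf.2
  rw [eLpNorm_exponent_top] at h
  refine ⟨(eLpNormEssSup f μ).toReal, ENNReal.toReal_nonneg, ?_⟩
  filter_upwards [ae_le_eLpNormEssSup (f := f) (μ := μ)] with x hx
  have := ENNReal.toReal_mono h.ne hx
  simpa using this

theorem _root_.ContinuousOn.memLp_top_Icc {F : Type*} [NormedAddCommGroup F] {x : ℝ → F} {a b : ℝ}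
    (hx : ContinuousOn x (Icc a b)) : MemLp x ∞ (volume.restrict (Icc a b)) := by
  obtain ⟨C, hC⟩ := isCompact_Icc.exists_bound_of_continuousOn hx
  exact memLp_top_of_bound (hx.aestronglyMeasurable_of_isCompact isCompact_Icc measurableSet_Icc) C
    (by filter_upwards [ae_restrict_mem measurableSet_Icc] with q hq using hC q hq)

variable {A : ℝ → E →L[ℝ] E} {f : ℝ → E} {a b s : ℝ} {x₀ : E}

theorem memLp_clm_apply (hA : MemLp A ∞ (volume.restrict (Icc a b))) {x : ℝ → E}
    (hx : ContinuousOn x (Icc a b)) :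
    MemLp (fun q => A q (x q)) ∞ (volume.restrict (Icc a b)) :=
  ContinuousLinearMap.memLp_of_bilin ∞ (ContinuousLinearMap.id ℝ (E →L[ℝ] E)) hA hx.memLp_top_Icc

theorem intervalIntegrable_of_integrableOn_Icc {F : Type*} [NormedAddCommGroup F] {g : ℝ → F}
    {a b s r : ℝ} (hg : IntegrableOn g (Icc a b)) (hs : s ∈ Icc a b) (hr : r ∈ Icc a b) :
    IntervalIntegrable g volume s r :=
  (hg.mono_set (uIcc_subset_Icc hs hr)).intervalIntegrable

theorem integrableOn_clm_apply (hA : MemLp A ∞ (volume.restrict (Icc a b))) {x : ℝ → E}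
    (hx : ContinuousOn x (Icc a b)) : IntegrableOn (fun q => A q (x q)) (Icc a b) :=
  (memLp_clm_apply hA hx).integrable le_top

theorem ae_uIoc_of_ae_Icc {p : ℝ → Prop} {a b s r : ℝ} (hs : s ∈ Icc a b) (hr : r ∈ Icc a b)
    (h : ∀ᵐ q ∂(volume.restrict (Icc a b)), p q) : ∀ᵐ q ∂(volume.restrict (uIoc s r)), p q :=
  ae_restrict_of_ae_restrict_of_subset (uIoc_subset_uIcc.trans (uIcc_subset_Icc hs hr)) h

/-- Iterated integration against a bounded operator gains factorials. -/
theorem norm_iterated_integral_le {K D : ℝ} (hK : 0 ≤ K)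
    (hA : ∀ᵐ q ∂(volume.restrict (Icc a b)), ‖A q‖ ≤ K) (hs : s ∈ Icc a b)
    {d : ℕ → ℝ → E} (h0 : ∀ r ∈ Icc a b, ‖d 0 r‖ ≤ D)
    (hd : ∀ n, ∀ r ∈ Icc a b, d (n + 1) r = ∫ q in s..r, A q (d n q)) (n : ℕ) :
    ∀ r ∈ Icc a b, ‖d n r‖ ≤ (K * |r - s|) ^ n / n.factorial * D := by
  have hD : 0 ≤ D := (norm_nonneg _).trans (h0 s hs)
  induction n with
  | zero => simpa using h0
  | succ n ih =>
    intro r hr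
    rw [hd n r hr]
    refine (intervalIntegral.norm_integral_le_abs_of_norm_le
      (g := fun q => K * (K ^ n * |q - s| ^ n / n.factorial * D)) ?_
      (Continuous.intervalIntegrable (by fun_prop) _ _)).trans ?_
    · have hsub := uIoc_subset_uIcc.trans (uIcc_subset_Icc hs hr)
      filter_upwards [ae_uIoc_of_ae_Icc hs hr hA, ae_restrict_mem measurableSet_uIoc] with q hq hq'
      rw [← mul_pow]
      exact ((A q).le_opNorm _).trans (mul_le_mul hq (ih q (hsub hq')) (norm_nonneg _) hK)
    · rw [intervalIntegral.integral_const_mul, intervalIntegral.integral_mul_const,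
        intervalIntegral.integral_div, intervalIntegral.integral_const_mul]
      simp only [abs_mul, abs_div]
      rw [intervalIntegral.abs_intervalIntegral_eq, integral_pow_abs_sub_uIoc]
      simp only [abs_div, abs_pow, abs_abs, abs_of_nonneg hK, abs_of_nonneg hD, Nat.abs_cast,
        Nat.factorial_succ]
      rw [abs_of_nonneg (by positivity : (0 : ℝ) ≤ n + 1)]
      push_cast
      apply le_of_eq
      field_simp
      ring

/-- The difference of two solutions is reproduced by the homogeneous integral operator. Used as a
constant sequence in `norm_iterated_integral_le`, it is bounded by `(K |r - s|)ⁿ / n! * D` for every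
`n`, hence vanishes. -/
theorem IsSolution.eqOn (hs : s ∈ Icc a b) (hA : MemLp A ∞ (volume.restrict (Icc a b)))
    (hf : IntegrableOn f (Icc a b)) {x y : ℝ → E} (hx : IsSolution A f s x₀ (Icc a b) x)
    (hy : IsSolution A f s x₀ (Icc a b) y) : EqOn x y (Icc a b) := by
  obtain ⟨K, hK, hKA⟩ := hA.exists_ae_norm_le
  obtain ⟨D, hD⟩ := isCompact_Icc.exists_bound_of_continuousOn (hx.1.sub hy.1)
  intro r hr
  have key := fun n => norm_iterated_integral_le (A := A) (d := fun _ q => x q - y q) hK hKA hs hD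
    (fun _ r hr => by
      rw [hx.2 r hr, hy.2 r hr, add_sub_add_left_eq_sub, ← intervalIntegral.integral_sub]
      · simp
      · exact intervalIntegrable_of_integrableOn_Icc ((integrableOn_clm_apply hA hx.1).add hf) hs hr
      · exact intervalIntegrable_of_integrableOn_Icc ((integrableOn_clm_apply hA hy.1).add hf) hs hr)
    n r hr
  have lim := (FloorSemiring.tendsto_pow_div_factorial_atTop (K * |r - s|)).mul_const D
  rw [zero_mul] at lim
  have := ge_of_tendsto' lim key
  exact sub_eq_zero.1 (norm_le_zero_iff.1 this)

/-- Picard iteration on continuous functions over the whole interval. The factorial bound makes some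
iterate of the integral operator a contraction, and the fixed point of that iterate is fixed by the
operator itself. -/
theorem exists_isSolution [CompleteSpace E] (hs : s ∈ Icc a b)
    (hA : MemLp A ∞ (volume.restrict (Icc a b))) (hf : IntegrableOn f (Icc a b)) (x₀ : E) :
    ∃ x, IsSolution A f s x₀ (Icc a b) x := by
  have hab : a ≤ b := hs.1.trans hs.2
  obtain ⟨K, hK, hKA⟩ := hA.exists_ae_norm_le
  let ext : C(Icc a b, E) → ℝ → E := fun x => IccExtend hab x
  have hext : ∀ x, Continuous (ext x) := fun x => x.continuous.Icc_extend'
  have hint : ∀ x, IntegrableOn (fun q => A q (ext x q) + f q) (Icc a b) := fun x =>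
    (integrableOn_clm_apply hA (hext x).continuousOn).add hf
  have hcont : ∀ x, ContinuousOn (fun r => x₀ + ∫ q in s..r, (A q (ext x q) + f q)) (Icc a b) := by
    intro x
    have h := intervalIntegral.continuousOn_primitive_interval' (a := s)
      (intervalIntegrable_of_integrableOn_Icc (hint x) (left_mem_Icc.2 hab) (right_mem_Icc.2 hab))
      (by rwa [uIcc_of_le hab])
    rw [uIcc_of_le hab] at h
    exact continuousOn_const.add h
  let F : C(Icc a b, E) → C(Icc a b, E) := fun x =>
    ⟨fun r => x₀ + ∫ q in s..r, (A q (ext x q) + f q), (hcont x).domRestrict⟩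
  have hF : ∀ x y n, ∀ r ∈ Icc a b, ‖ext (F^[n] x) r - ext (F^[n] y) r‖ ≤
      (K * |r - s|) ^ n / n.factorial * dist x y := by
    intro x y
    refine norm_iterated_integral_le (A := A)
      (d := fun n r => ext (F^[n] x) r - ext (F^[n] y) r) hK hKA hs ?_ ?_
    · intro r hr
      simp only [ext, Function.iterate_zero, id_eq, IccExtend_of_mem _ _ hr]
      rw [← dist_eq_norm]
      exact ContinuousMap.dist_apply_le_dist _
    · intro n r hr
      have e : ∀ z : C(Icc a b, E), ext (F^[n + 1] z) r =
          x₀ + ∫ q in s..r, (A q (ext (F^[n] z) q) + f q) := by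
        intro z
        simp only [Function.iterate_succ_apply', ext, IccExtend_of_mem _ _ hr]
        rfl
      simp only [e, add_sub_add_left_eq_sub]
      rw [← intervalIntegral.integral_sub]
      · simp
      · exact intervalIntegrable_of_integrableOn_Icc (hint _) hs hr
      · exact intervalIntegrable_of_integrableOn_Icc (hint _) hs hr
  obtain ⟨n, hn⟩ := ((FloorSemiring.tendsto_pow_div_factorial_atTop
    (K * (b - a))).eventually (gt_mem_nhds zero_lt_one)).exists
  have hnn : 0 ≤ (K * (b - a)) ^ n / n.factorial := by
    have := sub_nonneg.2 hab
    positivity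
  have hc : ContractingWith ⟨_, hnn⟩ F^[n] := by
    refine ⟨hn, LipschitzWith.of_dist_le_mul fun x y => ?_⟩
    change _ ≤ (K * (b - a)) ^ n / n.factorial * dist x y
    rw [ContinuousMap.dist_le (mul_nonneg hnn dist_nonneg)]
    intro r
    have h := hF x y n r r.2
    simp only [ext, IccExtend_of_mem _ _ r.2] at h
    rw [dist_eq_norm]
    refine h.trans ?_
    have : |(r : ℝ) - s| ≤ b - a := abs_sub_le_iff.2
      ⟨by linarith [r.2.2, hs.1], by linarith [r.2.1, hs.2]⟩
    gcongr
  have hfix := hc.isFixedPt_fixedPoint_iterate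
  set x := ContractingWith.fixedPoint F^[n] hc
  refine ⟨ext x, (hext x).continuousOn, fun r hr => ?_⟩
  conv_lhs => rw [← hfix]
  simp only [ext, IccExtend_of_mem _ _ hr]
  rfl

theorem IsSolution.intervalIntegrable (hA : MemLp A ∞ (volume.restrict (Icc a b)))
    (hf : IntegrableOn f (Icc a b)) {x : ℝ → E} (hx : IsSolution A f s x₀ (Icc a b) x) {q r : ℝ}
    (hq : q ∈ Icc a b) (hr : r ∈ Icc a b) :
    IntervalIntegrable (fun q => A q (x q) + f q) volume q r :=
  intervalIntegrable_of_integrableOn_Icc ((integrableOn_clm_apply hA hx.1).add hf) hq hr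

/-- Solutions may be restarted at any time. -/
theorem IsSolution.rebase (hs : s ∈ Icc a b) (hA : MemLp A ∞ (volume.restrict (Icc a b)))
    (hf : IntegrableOn f (Icc a b)) {x : ℝ → E} (hx : IsSolution A f s x₀ (Icc a b) x) {q : ℝ}
    (hq : q ∈ Icc a b) : IsSolution A f q (x q) (Icc a b) x := by
  refine ⟨hx.1, fun r hr => ?_⟩
  rw [hx.2 q hq, hx.2 r hr, add_assoc, intervalIntegral.integral_add_adjacent_intervals
    (hx.intervalIntegrable hA hf hs hq) (hx.intervalIntegrable hA hf hq hr)]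

theorem IsSolution.mono {I I' : Set ℝ} {x : ℝ → E} (hx : IsSolution A f s x₀ I x) (h : I' ⊆ I) :
    IsSolution A f s x₀ I' x :=
  ⟨hx.1.mono h, fun r hr => hx.2 r (h hr)⟩

/-- The image of a solution under a map intertwining the two equations. -/
theorem IsSolution.map [CompleteSpace E] {E' : Type*} [NormedAddCommGroup E'] [NormedSpace ℝ E']
    [CompleteSpace E'] (hs : s ∈ Icc a b)
    (hA : MemLp A ∞ (volume.restrict (Icc a b))) (hf : IntegrableOn f (Icc a b))
    {x : ℝ → E} (hx : IsSolution A f s x₀ (Icc a b) x) (F : E →L[ℝ] E')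
    {A' : ℝ → E' →L[ℝ] E'} {f' : ℝ → E'}
    (h : ∀ᵐ q ∂(volume.restrict (Icc a b)), F (A q (x q) + f q) = A' q (F (x q)) + f' q) :
    IsSolution A' f' s (F x₀) (Icc a b) (fun r => F (x r)) := by
  refine ⟨F.continuous.comp_continuousOn hx.1, fun r hr => ?_⟩
  beta_reduce
  rw [hx.2 r hr, map_add, ← F.intervalIntegral_comp_comm (hx.intervalIntegrable hA hf hs hr),
    intervalIntegral.integral_congr_ae_restrict (ae_uIoc_of_ae_Icc hs hr h)]

/-- Invariant subspaces of the equation. -/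
theorem IsSolution.mem_submodule [FiniteDimensional ℝ E] (hs : s ∈ Icc a b)
    (hA : MemLp A ∞ (volume.restrict (Icc a b))) (hf : IntegrableOn f (Icc a b))
    {x : ℝ → E} (hx : IsSolution A f s x₀ (Icc a b) x) {S : Submodule ℝ E} (h0 : x₀ ∈ S)
    (hAS : ∀ᵐ q ∂(volume.restrict (Icc a b)), ∀ z ∈ S, A q z ∈ S)
    (hfS : ∀ᵐ q ∂(volume.restrict (Icc a b)), f q ∈ S) : ∀ r ∈ Icc a b, x r ∈ S := by
  have := FiniteDimensional.complete ℝ E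
  obtain ⟨S', hS'⟩ := S.exists_isCompl
  let p : E →L[ℝ] E := LinearMap.toContinuousLinearMap (S'.subtype ∘ₗ S'.projectionOnto S hS'.symm)
  have hp : ∀ z, p z = 0 ↔ z ∈ S := by
    intro z
    simp [p]
  have hpp : ∀ z, z - p z ∈ S := by
    intro z
    rw [← hp, map_sub, sub_eq_zero]
    exact (Submodule.projection_apply_left hS'.symm (S'.projectionOnto S hS'.symm z)).symm
  -- Here `p` is a projection with kernel `S`. Since `A q` preserves `S`, `p (A q z)` depends only
  -- on `p z`, so `p ∘ x` solves a homogeneous equation with zero initial value.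
  have h1 : IsSolution (fun q => p ∘L A q) (fun _ => 0) s (p x₀) (Icc a b) (fun r => p (x r)) := by
    refine hx.map hs hA hf p ?_
    filter_upwards [hAS, hfS] with q hq hfq
    have h2 := (hp _).2 (hq _ (hpp (x q)))
    simp only [map_sub] at h2
    rw [map_add, (hp _).2 hfq, sub_eq_zero.1 h2]
    simp
  have h3 : IsSolution (fun q => p ∘L A q) (fun _ => 0) s (p x₀) (Icc a b) (fun _ => 0) := by
    refine ⟨continuousOn_const, fun r _ => ?_⟩
    simp [(hp _).2 h0]
  have hpA : MemLp (fun q => p ∘L A q) ∞ (volume.restrict (Icc a b)) :=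
    (ContinuousLinearMap.compL ℝ E E E p).comp_memLp' hA
  intro r hr
  exact (hp _).1 (h1.eqOn hs hpA integrableOn_zero h3 hr)

end LinearODE

/-! ### Products of absolutely continuous functions -/

/-- Integration by parts for absolutely continuous functions: both factors are primitives of
integrable functions, whose derivatives are the integrands almost everywhere. -/
theorem mul_eq_add_integral_of_primitive {a b s : ℝ} (hs : s ∈ Icc a b) {p q f g : ℝ → ℝ}
    {p₀ q₀ : ℝ} (hf : IntegrableOn f (Icc a b)) (hg : IntegrableOn g (Icc a b))
    (hp : ∀ r ∈ Icc a b, p r = p₀ + ∫ t in s..r, f t)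
    (hq : ∀ r ∈ Icc a b, q r = q₀ + ∫ t in s..r, g t) {r : ℝ} (hr : r ∈ Icc a b) :
    p r * q r = p₀ * q₀ + ∫ t in s..r, (f t * q t + p t * g t) := by
  have ac : ∀ {h : ℝ → ℝ} (c : ℝ), IntegrableOn h (Icc a b) →
      AbsolutelyContinuousOnInterval (fun r => c + ∫ t in s..r, h t) s r := fun {h} c hh =>
    (LipschitzWith.const c).lipschitzOnWith.absolutelyContinuousOnInterval.fun_add
      ((intervalIntegrable_of_integrableOn_Icc hh hs
        hr).absolutelyContinuousOnInterval_intervalIntegral left_mem_uIcc)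
  have key := AbsolutelyContinuousOnInterval.integral_deriv_mul_eq_sub (ac p₀ hf) (ac q₀ hg)
  simp only [intervalIntegral.integral_same, add_zero] at key
  rw [hp r hr, hq r hr, ← sub_eq_iff_eq_add', ← key]
  apply intervalIntegral.integral_congr_ae
  filter_upwards [(intervalIntegrable_of_integrableOn_Icc hf hs hr).ae_hasDerivAt_integral,
    (intervalIntegrable_of_integrableOn_Icc hg hs hr).ae_hasDerivAt_integral] with t h1 h2 ht
  have ht' := uIoc_subset_uIcc ht
  have ht'' := uIcc_subset_Icc hs hr ht'
  rw [((h1 ht' s left_mem_uIcc).const_add p₀).deriv, ((h2 ht' s left_mem_uIcc).const_add q₀).deriv,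
    hp t ht'', hq t ht'']

theorem dotProduct_eq_add_integral_of_primitive {n : ℕ} {a b s : ℝ} (hs : s ∈ Icc a b)
    {p q f g : ℝ → Fin n → ℝ} {p₀ q₀ : Fin n → ℝ} (hpc : ContinuousOn p (Icc a b))
    (hqc : ContinuousOn q (Icc a b))
    (hf : IntegrableOn f (Icc a b)) (hg : IntegrableOn g (Icc a b))
    (hp : ∀ r ∈ Icc a b, p r = p₀ + ∫ t in s..r, f t)
    (hq : ∀ r ∈ Icc a b, q r = q₀ + ∫ t in s..r, g t) {r : ℝ} (hr : r ∈ Icc a b) :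
    p r ⬝ᵥ q r = p₀ ⬝ᵥ q₀ + ∫ t in s..r, (f t ⬝ᵥ q t + p t ⬝ᵥ g t) := by
  have coord : ∀ {h : ℝ → Fin n → ℝ} (i : Fin n), IntegrableOn h (Icc a b) →
      IntegrableOn (fun t => h t i) (Icc a b) := fun {h} i hh =>
    (ContinuousLinearMap.proj (R := ℝ) (φ := fun _ : Fin n => ℝ) i).integrable_comp hh
  have cint : ∀ {h x : ℝ → Fin n → ℝ} {c : Fin n → ℝ} (i : Fin n), IntegrableOn h (Icc a b) →
      (∀ r ∈ Icc a b, x r = c + ∫ t in s..r, h t) →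
      ∀ r ∈ Icc a b, x r i = c i + ∫ t in s..r, h t i := by
    intro h x c i hh hx r hr
    rw [hx r hr, Pi.add_apply]
    congr 1
    exact ((ContinuousLinearMap.proj (R := ℝ) (φ := fun _ : Fin n => ℝ) i).intervalIntegral_comp_comm
      (intervalIntegrable_of_integrableOn_Icc hh hs hr)).symm
  have hint : ∀ i, IntervalIntegrable (fun t => f t i * q t i + p t i * g t i) volume s r := by
    intro i
    apply intervalIntegrable_of_integrableOn_Icc _ hs hr
    refine IntegrableOn.add ?_ ?_
    · exact (coord i hf).mul_continuousOn ((continuous_apply i).comp_continuousOn hqc) isCompact_Icc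
    · exact (coord i hg).continuousOn_mul ((continuous_apply i).comp_continuousOn hpc) isCompact_Icc
  simp only [dotProduct]
  rw [Finset.sum_congr rfl fun i _ => mul_eq_add_integral_of_primitive hs (coord i hf) (coord i hg)
    (cint i hf hp) (cint i hg hq) hr, Finset.sum_add_distrib,
    ← intervalIntegral.integral_finsetSum fun i _ => hint i]
  simp only [Finset.sum_add_distrib]

/-! ### Flows -/

/-- A bilinear map between finite-dimensional normed spaces as a continuous bilinear map. -/
def bilinCLM {E F G : Type*} [NormedAddCommGroup E] [NormedSpace ℝ E] [FiniteDimensional ℝ E]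
    [NormedAddCommGroup F] [NormedSpace ℝ F] [FiniteDimensional ℝ F]
    [NormedAddCommGroup G] [NormedSpace ℝ G] (f : E →ₗ[ℝ] F →ₗ[ℝ] G) : E →L[ℝ] F →L[ℝ] G :=
  f.toContinuousBilinearMap

theorem memLp_bilinCLM {E F G : Type*} [NormedAddCommGroup E] [NormedSpace ℝ E]
    [FiniteDimensional ℝ E] [NormedAddCommGroup F] [NormedSpace ℝ F] [FiniteDimensional ℝ F]
    [NormedAddCommGroup G] [NormedSpace ℝ G] (f : E →ₗ[ℝ] F →ₗ[ℝ] G) {μ : Measure ℝ} {A : ℝ → E}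
    (hA : MemLp A ∞ μ) : MemLp (fun q => bilinCLM f (A q)) ∞ μ :=
  (bilinCLM f).comp_memLp' hA

/-- Matrix multiplication as a bilinear map. -/
def mulLM (k l j : ℕ) : Matrix (Fin k) (Fin l) ℝ →ₗ[ℝ] Matrix (Fin l) (Fin j) ℝ →ₗ[ℝ]
    Matrix (Fin k) (Fin j) ℝ :=
  LinearMap.mk₂ ℝ (fun X Y => X * Y) Matrix.add_mul Matrix.smul_mul Matrix.mul_add
    (fun c X Y => Matrix.mul_smul X c Y)

/-- The action of matrices on vectors as a bilinear map. -/
def mulVecLM (k l : ℕ) : Matrix (Fin k) (Fin l) ℝ →ₗ[ℝ] (Fin l → ℝ) →ₗ[ℝ] (Fin k → ℝ) :=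
  LinearMap.mk₂ ℝ (fun X v => X *ᵥ v) Matrix.add_mulVec
    (fun c X v => Matrix.smul_mulVec c X v) Matrix.mulVec_add
    (fun c X v => Matrix.mulVec_smul X c v)

/-- Matrix multiplication as a continuous bilinear map. -/
def mulCLM (k l j : ℕ) := bilinCLM (mulLM k l j)

@[simp] theorem mulCLM_apply {k l j : ℕ} (X : Matrix (Fin k) (Fin l) ℝ)
    (Y : Matrix (Fin l) (Fin j) ℝ) : mulCLM k l j X Y = X * Y := rfl

/-- The action of matrices on vectors as a continuous bilinear map. -/
def mulVecCLM (k l : ℕ) := bilinCLM (mulVecLM k l)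

@[simp] theorem mulVecCLM_apply {k l : ℕ} (X : Matrix (Fin k) (Fin l) ℝ) (v : Fin l → ℝ) :
    mulVecCLM k l X v = X *ᵥ v := rfl

/-- Transposition as a continuous linear map. -/
def transposeCLM (k l : ℕ) : Matrix (Fin k) (Fin l) ℝ →L[ℝ] Matrix (Fin l) (Fin k) ℝ :=
  LinearMap.toContinuousLinearMap (Matrix.transposeLinearEquiv (Fin k) (Fin l) ℝ ℝ).toLinearMap

@[simp] theorem transposeCLM_apply {k l : ℕ} (X : Matrix (Fin k) (Fin l) ℝ) :
    transposeCLM k l X = Xᵀ := rfl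

instance {k l : ℕ} : CompleteSpace (Matrix (Fin k) (Fin l) ℝ) := FiniteDimensional.complete ℝ _

variable {n : ℕ} {a b : ℝ} {A : ℝ → Matrix (Fin n) (Fin n) ℝ}

theorem memLp_mulCLM (l : ℕ) (hA : MemLp A ∞ (volume.restrict (Icc a b))) :
    MemLp (fun q => mulCLM n n l (A q)) ∞ (volume.restrict (Icc a b)) :=
  memLp_bilinCLM _ hA

theorem memLp_mulVecCLM (hA : MemLp A ∞ (volume.restrict (Icc a b))) :
    MemLp (fun q => mulVecCLM n n (A q)) ∞ (volume.restrict (Icc a b)) :=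
  memLp_bilinCLM _ hA

theorem memLp_neg_transpose (hA : MemLp A ∞ (volume.restrict (Icc a b))) :
    MemLp (fun q => -(A q)ᵀ) ∞ (volume.restrict (Icc a b)) :=
  ((transposeCLM n n).comp_memLp' hA).neg

theorem isFundamental_iff {s t : ℝ} (hs : s ∈ Icc a b) (ht : t ∈ Icc a b)
    (hA : MemLp A ∞ (volume.restrict (Icc a b))) {X : ℝ → Matrix (Fin n) (Fin n) ℝ} :
    IsFundamental A s t X ↔
      IsSolution (fun q => mulCLM n n n (A q)) (fun _ => 0) s 1 (uIcc s t) X := by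
  constructor
  · rintro ⟨h1, h2⟩
    exact ⟨h1, fun r hr => by simpa using (h2 r hr).2⟩
  · rintro ⟨h1, h2⟩
    refine ⟨h1, fun r hr => ⟨?_, by simpa using h2 r hr⟩⟩
    have hA' := memLp_mulCLM n (hA.mono_measure (Measure.restrict_mono (uIcc_subset_Icc hs ht) le_rfl))
    exact intervalIntegrable_of_integrableOn_Icc (integrableOn_clm_apply hA' h1) left_mem_uIcc hr

/-- The flow solves the differential equation. -/
theorem isSolution_flow {s : ℝ} (hs : s ∈ Icc a b) (hA : MemLp A ∞ (volume.restrict (Icc a b))) :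
    IsSolution (fun q => mulCLM n n n (A q)) (fun _ => 0) s 1 (Icc a b) (fun r => flow A r s) := by
  obtain ⟨X, hX⟩ := exists_isSolution (f := fun _ => 0) hs (memLp_mulCLM n hA) integrableOn_zero 1
  -- The flow chooses a solution separately for each end time `t`; uniqueness on the interval
  -- between `s` and `t` identifies every choice with the one solution `X`.
  have h : EqOn (fun r => flow A r s) X (Icc a b) := by
    intro t ht
    have hsub := uIcc_subset_Icc hs ht
    have hX' := hX.mono hsub
    have hex : ∃ X, IsFundamental A s t X := ⟨X, (isFundamental_iff hs ht hA).2 hX'⟩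
    have hc := (isFundamental_iff hs ht hA).1 hex.choose_spec
    have : flow A t s = hex.choose t := dif_pos hex
    change flow A t s = X t
    rw [this]
    exact hc.eqOn left_mem_uIcc
      (memLp_mulCLM n (hA.mono_measure (Measure.restrict_mono hsub le_rfl))) integrableOn_zero hX'
      right_mem_uIcc
  refine ⟨hX.1.congr h, fun r hr => ?_⟩
  rw [h hr, hX.2 r hr]
  congr 1
  apply intervalIntegral.integral_congr
  intro q hq
  beta_reduce
  rw [← h (uIcc_subset_Icc hs hr hq)]

theorem flow_eq_of_isSolution {s : ℝ} (hs : s ∈ Icc a b)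
    (hA : MemLp A ∞ (volume.restrict (Icc a b))) {X : ℝ → Matrix (Fin n) (Fin n) ℝ}
    (hX : IsSolution (fun q => mulCLM n n n (A q)) (fun _ => 0) s 1 (Icc a b) X) {r : ℝ}
    (hr : r ∈ Icc a b) : flow A r s = X r :=
  (isSolution_flow hs hA).eqOn hs (memLp_mulCLM n hA) integrableOn_zero hX hr

theorem flow_self {s : ℝ} (hs : s ∈ Icc a b) (hA : MemLp A ∞ (volume.restrict (Icc a b))) :
    flow A s s = 1 := by
  simpa using (isSolution_flow hs hA).2 s hs

open Classical in
theorem flow_congr {A' : ℝ → Matrix (Fin n) (Fin n) ℝ} {s t : ℝ}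
    (h : ∀ᵐ q ∂(volume.restrict (uIcc s t)), A q = A' q) : flow A t s = flow A' t s := by
  -- Equality of the two predicates makes the chosen solutions equal, and also covers the default
  -- value `0`, so no bound on `A` is required.
  have : IsFundamental A s t = IsFundamental A' s t := by
    ext X
    have key : ∀ r ∈ uIcc s t, (fun q => A q * X q) =ᵐ[volume.restrict (uIoc s r)]
        fun q => A' q * X q := by
      intro r hr
      filter_upwards [ae_uIoc_of_ae_Icc left_mem_uIcc hr h] with q hq
      rw [hq]
    refine and_congr Iff.rfl (forall₂_congr fun r hr => ?_)
    rw [intervalIntegrable_congr_ae (key r hr),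
      intervalIntegral.integral_congr_ae_restrict (key r hr)]
  have key : ∀ P Q : (ℝ → Matrix (Fin n) (Fin n) ℝ) → Prop, P = Q →
      (if h : ∃ X, P X then h.choose t else 0) = if h : ∃ X, Q X then h.choose t else 0 := by
    rintro P _ rfl
    rfl
  exact key _ _ this

/-- A linear map intertwining two coefficient functions intertwines their flows. -/
theorem mul_flow_eq_flow_mul {n' : ℕ} {A' : ℝ → Matrix (Fin n') (Fin n') ℝ}
    (hA : MemLp A ∞ (volume.restrict (Icc a b))) (hA' : MemLp A' ∞ (volume.restrict (Icc a b)))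
    {F : Matrix (Fin n') (Fin n) ℝ} (h : ∀ᵐ q ∂(volume.restrict (Icc a b)), F * A q = A' q * F)
    {r s : ℝ} (hs : s ∈ Icc a b) (hr : r ∈ Icc a b) : F * flow A r s = flow A' r s * F := by
  -- Both sides solve `X' = A' X` with the value `F` at time `s`.
  have h1 := (isSolution_flow hs hA).map hs (memLp_mulCLM n hA) integrableOn_zero (mulCLM n' n n F)
    (A' := fun q => mulCLM n' n' n (A' q)) (f' := fun _ => 0) (by
      filter_upwards [h] with q hq
      simp [← Matrix.mul_assoc, hq])
  have h2 := (isSolution_flow hs hA').map hs (memLp_mulCLM n' hA') integrableOn_zero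
    ((mulCLM n' n' n).flip F) (A' := fun q => mulCLM n' n' n (A' q)) (f' := fun _ => 0) (by
      filter_upwards with q
      simp [Matrix.mul_assoc])
  simp only [mulCLM_apply, ContinuousLinearMap.flip_apply, Matrix.mul_one, Matrix.one_mul] at h1 h2
  exact h1.eqOn hs (memLp_mulCLM n hA') integrableOn_zero h2 hr

/-- As functions of `r`, both sides solve the same equation and take the value `flow A s q` at `r =
s`. -/
theorem flow_mul_flow (hA : MemLp A ∞ (volume.restrict (Icc a b))) {q r s : ℝ} (hq : q ∈ Icc a b)
    (hr : r ∈ Icc a b) (hs : s ∈ Icc a b) : flow A r s * flow A s q = flow A r q := by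
  have h1 := (isSolution_flow hq hA).rebase hq (memLp_mulCLM n hA) integrableOn_zero hs
  have h2 := (isSolution_flow hs hA).map hs (memLp_mulCLM n hA) integrableOn_zero
    ((mulCLM n n n).flip (flow A s q)) (A' := fun q => mulCLM n n n (A q)) (f' := fun _ => 0) (by
      filter_upwards with q
      simp [Matrix.mul_assoc])
  simp only [mulCLM_apply, ContinuousLinearMap.flip_apply, Matrix.one_mul] at h2
  exact h2.eqOn hs (memLp_mulCLM n hA) integrableOn_zero h1 hr

theorem isSolution_flow_mulVec {s : ℝ} (hs : s ∈ Icc a b)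
    (hA : MemLp A ∞ (volume.restrict (Icc a b))) (z : Fin n → ℝ) :
    IsSolution (fun q => mulVecCLM n n (A q)) (fun _ => 0) s z (Icc a b)
      (fun r => flow A r s *ᵥ z) := by
  have h := (isSolution_flow hs hA).map hs (memLp_mulCLM n hA) integrableOn_zero
    ((mulVecCLM n n).flip z) (A' := fun q => mulVecCLM n n (A q)) (f' := fun _ => 0) (by
      filter_upwards with q
      simp)
  simpa using h

theorem flow_shift {h T : ℝ} (hA : MemLp A ∞ (volume.restrict (Icc h (h + T)))) {s t : ℝ}
    (hs : s ∈ Icc 0 T) (ht : t ∈ Icc 0 T)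
    (hA' : MemLp (fun q => A (h + q)) ∞ (volume.restrict (Icc 0 T))) :
    flow (fun q => A (h + q)) t s = flow A (h + t) (h + s) := by
  have hmem : ∀ {r}, r ∈ Icc 0 T → h + r ∈ Icc h (h + T) := fun hr =>
    ⟨by linarith [hr.1], by linarith [hr.2]⟩
  have hf := isSolution_flow (hmem hs) hA
  refine flow_eq_of_isSolution hs hA' (X := fun r => flow A (h + r) (h + s)) ⟨?_, fun r hr => ?_⟩ ht
  · exact hf.1.comp (by fun_prop) fun r hr => hmem hr
  · rw [hf.2 _ (hmem hr)]
    congr 1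
    exact (intervalIntegral.integral_comp_add_left
      (fun q => mulCLM n n n (A q) (flow A q (h + s)) + 0) h).symm

theorem flow_const (A : Matrix (Fin n) (Fin n) ℝ) (t s : ℝ) :
    flow (fun _ => A) t s = NormedSpace.exp ((t - s) • A) := by
  have hA : MemLp (fun _ : ℝ => A) ∞ (volume.restrict (uIcc s t)) := memLp_top_const A
  have hd : ∀ r : ℝ, HasDerivAt (fun r : ℝ => NormedSpace.exp ((r - s) • A))
      (A * NormedSpace.exp ((r - s) • A)) r := by
    intro r
    have h := (hasDerivAt_exp_smul_const' (𝕂 := ℝ) A (r - s)).scomp r ((hasDerivAt_id r).sub_const s)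
    rw [one_smul] at h
    exact h
  have hc : Continuous fun r : ℝ => NormedSpace.exp ((r - s) • A) :=
    continuous_iff_continuousAt.2 fun r => (hd r).continuousAt
  refine flow_eq_of_isSolution (left_mem_uIcc (a := s) (b := t)) hA
    (X := fun r => NormedSpace.exp ((r - s) • A)) ⟨hc.continuousOn, fun r _ => ?_⟩ right_mem_uIcc
  have := intervalIntegral.integral_eq_sub_of_hasDerivAt (a := s) (b := r) (fun q _ => hd q)
    ((continuous_const.mul hc).intervalIntegrable _ _)
  simp [this]

/-- Integration of the adjoint equation along a solution. -/
theorem adjoint_dotProduct_eq {s : ℝ} (hs : s ∈ Icc a b)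
    (hA : MemLp A ∞ (volume.restrict (Icc a b))) {g : ℝ → Fin n → ℝ}
    (hg : IntegrableOn g (Icc a b)) {p x : ℝ → Fin n → ℝ} {p₀ x₀ : Fin n → ℝ}
    (hp : IsSolution (fun q => mulVecCLM n n (-(A q)ᵀ)) (fun _ => 0) s p₀ (Icc a b) p)
    (hx : IsSolution (fun q => mulVecCLM n n (A q)) g s x₀ (Icc a b) x) {r : ℝ}
    (hr : r ∈ Icc a b) : p r ⬝ᵥ x r = p₀ ⬝ᵥ x₀ + ∫ q in s..r, p q ⬝ᵥ g q := by
  have hpi := (integrableOn_clm_apply (memLp_mulVecCLM (memLp_neg_transpose hA)) hp.1).add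
    integrableOn_zero
  have hxi := (integrableOn_clm_apply (memLp_mulVecCLM hA) hx.1).add hg
  rw [dotProduct_eq_add_integral_of_primitive hs hp.1 hx.1 hpi hxi hp.2 hx.2 hr]
  -- The terms `-(Aᵀ p) ⬝ x` and `p ⬝ (A x)` of the product rule cancel, leaving `p ⬝ g`.
  congr 2
  ext q
  simp [Matrix.mulVec_transpose, Matrix.dotProduct_mulVec]

/-- The adjoint flow is the transposed inverse of the flow. -/
theorem flow_neg_transpose (hA : MemLp A ∞ (volume.restrict (Icc a b))) {s t : ℝ}
    (hs : s ∈ Icc a b) (ht : t ∈ Icc a b) :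
    flow (fun q => -(A q)ᵀ) t s = (flow A s t)ᵀ := by
  -- The pairing of an adjoint solution with a free solution is constant in time, which exhibits the
  -- transposed adjoint flow as a left inverse of the flow.
  have h1 : (flow (fun q => -(A q)ᵀ) t s)ᵀ * flow A t s = 1 := by
    apply Matrix.toLin'.injective
    apply LinearMap.ext
    intro z
    rw [← sub_eq_zero, ← dotProduct_self_eq_zero]
    have : ∀ ζ, ζ ⬝ᵥ (((flow (fun q => -(A q)ᵀ) t s)ᵀ * flow A t s) *ᵥ z) = ζ ⬝ᵥ z := by
      intro ζ
      have := adjoint_dotProduct_eq hs hA integrableOn_zero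
        (isSolution_flow_mulVec hs (memLp_neg_transpose hA) ζ) (isSolution_flow_mulVec hs hA z) ht
      simp only [dotProduct_zero, intervalIntegral.integral_zero, add_zero] at this
      rw [← this, ← Matrix.mulVec_mulVec, Matrix.dotProduct_mulVec, Matrix.vecMul_transpose]
    simp only [Matrix.toLin'_apply, Matrix.one_mulVec]
    rw [dotProduct_sub, this, sub_self]
  have h2 : flow A t s * flow A s t = 1 := by
    rw [flow_mul_flow hA ht ht hs, flow_self ht hA]
  rw [← Matrix.transpose_inj, Matrix.transpose_transpose]
  exact left_inv_eq_right_inv h1 h2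

/-! ### Gramians -/

/-- The common form of the two Gramians. -/
def gram {n k : ℕ} (a : ℝ → Matrix (Fin n) (Fin n) ℝ) (D : ℝ → Matrix (Fin k) (Fin n) ℝ) (t : ℝ) :
    Matrix (Fin n) (Fin n) ℝ :=
  ∫ s in (0 : ℝ)..t, (D s * flow a s 0)ᵀ * (D s * flow a s 0)

variable {n k : ℕ} {a : ℝ → Matrix (Fin n) (Fin n) ℝ} {D : ℝ → Matrix (Fin k) (Fin n) ℝ} {t : ℝ}

theorem memLp_mul {k l j : ℕ} {μ : Measure ℝ} {X : ℝ → Matrix (Fin k) (Fin l) ℝ}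
    {Y : ℝ → Matrix (Fin l) (Fin j) ℝ} (hX : MemLp X ∞ μ) (hY : MemLp Y ∞ μ) :
    MemLp (fun s => X s * Y s) ∞ μ :=
  ContinuousLinearMap.memLp_of_bilin ∞ (mulCLM k l j) hX hY

theorem memLp_mulVec {k l : ℕ} {μ : Measure ℝ} {X : ℝ → Matrix (Fin k) (Fin l) ℝ}
    {x : ℝ → Fin l → ℝ} (hX : MemLp X ∞ μ) (hx : MemLp x ∞ μ) :
    MemLp (fun s => X s *ᵥ x s) ∞ μ :=
  ContinuousLinearMap.memLp_of_bilin ∞ (mulVecCLM k l) hX hx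

theorem memLp_transpose {k l : ℕ} {μ : Measure ℝ} {X : ℝ → Matrix (Fin k) (Fin l) ℝ}
    (hX : MemLp X ∞ μ) : MemLp (fun s => (X s)ᵀ) ∞ μ :=
  (transposeCLM k l).comp_memLp' hX

theorem memLp_flow {a₀ b₀ s : ℝ} (hs : s ∈ Icc a₀ b₀)
    (ha : MemLp a ∞ (volume.restrict (Icc a₀ b₀))) :
    MemLp (fun r => flow a r s) ∞ (volume.restrict (Icc a₀ b₀)) :=
  (isSolution_flow hs ha).1.memLp_top_Icc

theorem memLp_mul_flow (ht : 0 ≤ t) (ha : MemLp a ∞ (volume.restrict (Icc 0 t)))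
    (hD : MemLp D ∞ (volume.restrict (Icc 0 t))) :
    MemLp (fun s => D s * flow a s 0) ∞ (volume.restrict (Icc 0 t)) :=
  memLp_mul hD (memLp_flow (left_mem_Icc.2 ht) ha)

theorem integrableOn_gram (ht : 0 ≤ t) (ha : MemLp a ∞ (volume.restrict (Icc 0 t)))
    (hD : MemLp D ∞ (volume.restrict (Icc 0 t))) :
    IntegrableOn (fun s => (D s * flow a s 0)ᵀ * (D s * flow a s 0)) (Icc 0 t) :=
  (memLp_mul (memLp_transpose (memLp_mul_flow ht ha hD)) (memLp_mul_flow ht ha hD)).integrable le_top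

theorem intervalIntegrable_gram (ht : 0 ≤ t) (ha : MemLp a ∞ (volume.restrict (Icc 0 t)))
    (hD : MemLp D ∞ (volume.restrict (Icc 0 t))) :
    IntervalIntegrable (fun s => (D s * flow a s 0)ᵀ * (D s * flow a s 0)) volume 0 t :=
  intervalIntegrable_of_integrableOn_Icc (integrableOn_gram ht ha hD) (left_mem_Icc.2 ht)
    (right_mem_Icc.2 ht)

/-- The bilinear form `y, z ↦ y ⬝ᵥ X *ᵥ z` as a continuous linear function of `X`. -/
def formCLM {n : ℕ} (y z : Fin n → ℝ) : Matrix (Fin n) (Fin n) ℝ →L[ℝ] ℝ :=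
  LinearMap.toContinuousLinearMap
    { toFun := fun X => y ⬝ᵥ X *ᵥ z
      map_add' := fun X Y => by rw [Matrix.add_mulVec, dotProduct_add]
      map_smul' := fun c X => by simp [Matrix.smul_mulVec] }

@[simp] theorem formCLM_apply {n : ℕ} (y z : Fin n → ℝ) (X : Matrix (Fin n) (Fin n) ℝ) :
    formCLM y z X = y ⬝ᵥ X *ᵥ z := rfl

theorem dotProduct_gram_mulVec (ht : 0 ≤ t) (ha : MemLp a ∞ (volume.restrict (Icc 0 t)))
    (hD : MemLp D ∞ (volume.restrict (Icc 0 t))) (y z : Fin n → ℝ) :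
    y ⬝ᵥ gram a D t *ᵥ z =
      ∫ s in (0 : ℝ)..t, (D s *ᵥ (flow a s 0 *ᵥ y)) ⬝ᵥ (D s *ᵥ (flow a s 0 *ᵥ z)) := by
  have h := (formCLM y z).intervalIntegral_comp_comm (intervalIntegrable_gram ht ha hD)
  rw [formCLM_apply] at h
  unfold gram
  rw [← h]
  congr 1
  ext s
  rw [formCLM_apply, ← Matrix.mulVec_mulVec, Matrix.dotProduct_mulVec, Matrix.vecMul_transpose,
    Matrix.mulVec_mulVec, Matrix.mulVec_mulVec]

theorem gram_posSemidef (ht : 0 ≤ t) (ha : MemLp a ∞ (volume.restrict (Icc 0 t)))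
    (hD : MemLp D ∞ (volume.restrict (Icc 0 t))) : (gram a D t).PosSemidef := by
  refine Matrix.PosSemidef.of_dotProduct_mulVec_nonneg ?_ fun z => ?_
  · unfold gram
    rw [Matrix.IsHermitian, Matrix.conjTranspose_eq_transpose_of_trivial]
    have h := (transposeCLM n n).intervalIntegral_comp_comm (intervalIntegrable_gram ht ha hD)
    rw [transposeCLM_apply] at h
    rw [← h]
    simp
  · rw [star_trivial, dotProduct_gram_mulVec ht ha hD]
    exact intervalIntegral.integral_nonneg ht fun s _ => Finset.sum_nonneg fun _ _ => mul_self_nonneg _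

/-- The quadratic form of the Gramian at `z` is the integral of the squared length of the output
started at `z`. -/
theorem gram_mulVec_eq_zero (ht : 0 ≤ t) (ha : MemLp a ∞ (volume.restrict (Icc 0 t)))
    (hD : MemLp D ∞ (volume.restrict (Icc 0 t))) {z : Fin n → ℝ} (hz : gram a D t *ᵥ z = 0) :
    ∀ᵐ s ∂(volume.restrict (Icc 0 t)), D s *ᵥ (flow a s 0 *ᵥ z) = 0 := by
  have h := dotProduct_gram_mulVec ht ha hD z z
  rw [hz, dotProduct_zero, intervalIntegral.integral_of_le ht, ← integral_Icc_eq_integral_Ioc] at h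
  have hint : Integrable (fun s => (D s *ᵥ (flow a s 0 *ᵥ z)) ⬝ᵥ (D s *ᵥ (flow a s 0 *ᵥ z)))
      (volume.restrict (Icc 0 t)) := by
    refine ((formCLM z z).integrable_comp (integrableOn_gram ht ha hD)).congr ?_
    filter_upwards with s
    rw [formCLM_apply, ← Matrix.mulVec_mulVec, Matrix.dotProduct_mulVec, Matrix.vecMul_transpose,
      Matrix.mulVec_mulVec]
  have h0 := (integral_eq_zero_iff_of_nonneg (fun s => Finset.sum_nonneg fun _ _ => mul_self_nonneg _) hint).1 h.symm
  filter_upwards [h0] with s hs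
  exact dotProduct_self_eq_zero.1 hs

theorem gram_mulVec_eq_zero_of_ae (ht : 0 ≤ t) (ha : MemLp a ∞ (volume.restrict (Icc 0 t)))
    (hD : MemLp D ∞ (volume.restrict (Icc 0 t))) {z : Fin n → ℝ}
    (h : ∀ᵐ s ∂(volume.restrict (Icc 0 t)), D s *ᵥ (flow a s 0 *ᵥ z) = 0) :
    gram a D t *ᵥ z = 0 := by
  rw [← (gram_posSemidef ht ha hD).dotProduct_mulVec_zero_iff, star_trivial,
    dotProduct_gram_mulVec ht ha hD]
  rw [intervalIntegral.integral_congr_ae_restrict (g := fun _ => 0), intervalIntegral.integral_zero]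
  filter_upwards [ae_uIoc_of_ae_Icc (left_mem_Icc.2 ht) (right_mem_Icc.2 ht) h] with s hs
  rw [hs, dotProduct_zero]

theorem flow_congr_Icc {a' : ℝ → Matrix (Fin n) (Fin n) ℝ} {a₀ b₀ r s : ℝ} (hs : s ∈ Icc a₀ b₀)
    (hr : r ∈ Icc a₀ b₀) (h : ∀ᵐ q ∂(volume.restrict (Icc a₀ b₀)), a q = a' q) :
    flow a r s = flow a' r s :=
  flow_congr (ae_restrict_of_ae_restrict_of_subset (uIcc_subset_Icc hs hr) h)

theorem gram_congr {a' : ℝ → Matrix (Fin n) (Fin n) ℝ} {D' : ℝ → Matrix (Fin k) (Fin n) ℝ}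
    (ht : 0 ≤ t) (ha : ∀ᵐ q ∂(volume.restrict (Icc 0 t)), a q = a' q)
    (hD : ∀ᵐ q ∂(volume.restrict (Icc 0 t)), D q = D' q) : gram a D t = gram a' D' t := by
  have h0 := left_mem_Icc.2 ht
  have h1 := right_mem_Icc.2 ht
  refine intervalIntegral.integral_congr_ae_restrict ?_
  filter_upwards [ae_uIoc_of_ae_Icc h0 h1 hD, ae_restrict_mem measurableSet_uIoc] with s hs hs'
  rw [hs, flow_congr_Icc h0 (uIcc_subset_Icc h0 h1 (uIoc_subset_uIcc hs')) ha]

/-- Gramians of intertwined systems. -/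
theorem gram_eq_transpose_mul_gram_mul {n' : ℕ} {a' : ℝ → Matrix (Fin n') (Fin n') ℝ}
    {D' : ℝ → Matrix (Fin k) (Fin n') ℝ} (ht : 0 ≤ t)
    (ha : MemLp a ∞ (volume.restrict (Icc 0 t))) (ha' : MemLp a' ∞ (volume.restrict (Icc 0 t)))
    (hD' : MemLp D' ∞ (volume.restrict (Icc 0 t))) {F : Matrix (Fin n') (Fin n) ℝ}
    (h : ∀ᵐ q ∂(volume.restrict (Icc 0 t)), F * a q = a' q * F)
    (hDF : ∀ᵐ q ∂(volume.restrict (Icc 0 t)), D q = D' q * F) :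
    gram a D t = Fᵀ * gram a' D' t * F := by
  have h0 := left_mem_Icc.2 ht
  have h1 := right_mem_Icc.2 ht
  have hi := intervalIntegrable_gram ht ha' hD'
  have e1 := (mulCLM n n' n' Fᵀ).intervalIntegral_comp_comm hi
  have hi2 : IntervalIntegrable (fun s => Fᵀ * ((D' s * flow a' s 0)ᵀ * (D' s * flow a' s 0)))
      volume 0 t := ⟨(mulCLM n n' n' Fᵀ).integrable_comp hi.1, (mulCLM n n' n' Fᵀ).integrable_comp hi.2⟩
  have e2 := ((mulCLM n n' n).flip F).intervalIntegral_comp_comm hi2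
  simp only [mulCLM_apply, ContinuousLinearMap.flip_apply] at e1 e2
  unfold gram
  rw [← e1, ← e2]
  refine intervalIntegral.integral_congr_ae_restrict ?_
  filter_upwards [ae_uIoc_of_ae_Icc h0 h1 hDF, ae_restrict_mem measurableSet_uIoc] with s hs hs'
  have hf := mul_flow_eq_flow_mul ha ha' h h0 (uIcc_subset_Icc h0 h1 (uIoc_subset_uIcc hs'))
  rw [hs, Matrix.mul_assoc, hf]
  simp only [Matrix.transpose_mul, Matrix.mul_assoc]

theorem obsGramian_eq_gram {m p : ℕ} (σ : ℝ → Triple n m p) (t : ℝ) :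
    obsGramian σ t = gram (fun s => (σ s).1) (fun s => (σ s).2.2) t := by
  simp only [obsGramian, gram, Matrix.transpose_mul, Matrix.mul_assoc]

/-- The adjoint flow is the transposed inverse flow, so every fact about `gram` serves both
Gramians. -/
theorem ctrlGramian_eq_gram {m p : ℕ} {σ : ℝ → Triple n m p} (ht : 0 ≤ t)
    (hσ : MemLp (fun s => (σ s).1) ∞ (volume.restrict (Icc 0 t))) :
    ctrlGramian σ t = gram (fun s => -((σ s).1)ᵀ) (fun s => ((σ s).2.1)ᵀ) t := by
  refine intervalIntegral.integral_congr fun s hs => ?_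
  rw [uIcc_of_le ht] at hs
  beta_reduce
  rw [flow_neg_transpose hσ (left_mem_Icc.2 ht) hs]
  simp only [Matrix.transpose_mul, Matrix.mul_assoc, Matrix.transpose_transpose]

theorem continuous_exp_smul (a₀ : Matrix (Fin n) (Fin n) ℝ) :
    Continuous fun r : ℝ => NormedSpace.exp (r • a₀) := by
  exact continuous_iff_continuousAt.2 fun r => (hasDerivAt_exp_smul_const' (𝕂 := ℝ) a₀ r).continuousAt

/-- For constant coefficients the output is continuous, so its almost everywhere vanishing extends
to the end time `h`. The end time is what the kernel argument uses, where `e^{ha}` gets cancelled.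
-/
theorem gram_const_mulVec_eq_zero {a₀ : Matrix (Fin n) (Fin n) ℝ} {D₀ : Matrix (Fin k) (Fin n) ℝ}
    {h : ℝ} (hh : 0 < h) {z : Fin n → ℝ} (hz : gram (fun _ => a₀) (fun _ => D₀) h *ᵥ z = 0) :
    D₀ *ᵥ (NormedSpace.exp (h • a₀) *ᵥ z) = 0 := by
  have h1 := gram_mulVec_eq_zero hh.le (memLp_top_const a₀) (memLp_top_const D₀) hz
  simp only [flow_const, sub_zero] at h1
  have hc : Continuous fun r : ℝ => D₀ *ᵥ (NormedSpace.exp (r • a₀) *ᵥ z) :=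
    continuous_const.matrix_mulVec ((continuous_exp_smul a₀).matrix_mulVec continuous_const)
  exact Measure.eqOn_Icc_of_ae_eq volume hh.ne h1 hc.continuousOn continuousOn_const
    (right_mem_Icc.2 hh.le)

theorem map_add_left_restrict_Icc (h t : ℝ) :
    MeasurePreserving (fun r => h + r) (volume.restrict (Icc 0 t))
      (volume.restrict (Icc h (h + t))) := by
  have := (measurePreserving_add_left volume h).restrict_preimage (s := Icc h (h + t))
    measurableSet_Icc
  simpa using this

/-- The Gramian of a concatenation. -/
theorem gram_concat {a' : ℝ → Matrix (Fin n) (Fin n) ℝ} {D' : ℝ → Matrix (Fin k) (Fin n) ℝ}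
    {a₀ : Matrix (Fin n) (Fin n) ℝ} {D₀ : Matrix (Fin k) (Fin n) ℝ} {h : ℝ} (hh : 0 ≤ h)
    (ht : 0 ≤ t) (ha : MemLp a ∞ (volume.restrict (Icc 0 (h + t))))
    (hD : MemLp D ∞ (volume.restrict (Icc 0 (h + t))))
    (ha' : MemLp a' ∞ (volume.restrict (Icc 0 t))) (hD' : MemLp D' ∞ (volume.restrict (Icc 0 t)))
    (e1 : ∀ᵐ r ∂(volume.restrict (Icc 0 h)), a r = a₀ ∧ D r = D₀)
    (e2 : ∀ᵐ r ∂(volume.restrict (Icc 0 t)), a (h + r) = a' r ∧ D (h + r) = D' r) :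
    gram a D (h + t) = gram (fun _ => a₀) (fun _ => D₀) h +
      (NormedSpace.exp (h • a₀))ᵀ * gram a' D' t * NormedSpace.exp (h • a₀) := by
  have i0 : (0 : ℝ) ∈ Icc 0 (h + t) := ⟨le_rfl, by linarith⟩
  have i1 : h ∈ Icc 0 (h + t) := ⟨hh, by linarith⟩
  have i2 : h + t ∈ Icc 0 (h + t) := ⟨by linarith, le_rfl⟩
  have hint := integrableOn_gram (i0.2) ha hD
  -- After time `h` the flow factors through the propagator of the constant piece; this produces the
  -- conjugation by the exponential.
  have hfl : ∀ s ∈ Icc 0 t, flow a (h + s) 0 = flow a' s 0 * NormedSpace.exp (h • a₀) := by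
    intro s hs
    have hmem : h + s ∈ Icc 0 (h + t) := ⟨by linarith [hs.1], by linarith [hs.2]⟩
    rw [← flow_mul_flow ha i0 hmem i1]
    congr 1
    · have hsub : Icc h (h + t) ⊆ Icc 0 (h + t) := Icc_subset_Icc_left hh
      have hah := ha.mono_measure (Measure.restrict_mono hsub le_rfl)
      have hs' := flow_shift hah (left_mem_Icc.2 ht) hs
        (hah.comp_measurePreserving (map_add_left_restrict_Icc h t))
      rw [add_zero] at hs'
      rw [← hs']
      exact flow_congr_Icc (left_mem_Icc.2 ht) hs (e2.mono fun _ h => h.1)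
    · rw [flow_congr_Icc (left_mem_Icc.2 hh) (right_mem_Icc.2 hh) (e1.mono fun _ h => h.1),
        flow_const, sub_zero]
  have split := intervalIntegral.integral_add_adjacent_intervals
    (intervalIntegrable_of_integrableOn_Icc hint i0 i1)
    (intervalIntegrable_of_integrableOn_Icc hint i1 i2)
  have first : gram a D h = gram (fun _ => a₀) (fun _ => D₀) h :=
    gram_congr hh (e1.mono fun _ h => h.1) (e1.mono fun _ h => h.2)
  unfold gram at first ⊢
  rw [← split, first]
  congr 1
  have shift := intervalIntegral.integral_comp_add_left (a := 0) (b := t)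
    (fun s => (D s * flow a s 0)ᵀ * (D s * flow a s 0)) h
  rw [add_zero] at shift
  rw [← shift]
  set X := NormedSpace.exp (h • a₀)
  have hi := intervalIntegrable_gram ht ha' hD'
  have c1 := (mulCLM n n n Xᵀ).intervalIntegral_comp_comm hi
  have hi2 : IntervalIntegrable (fun s => Xᵀ * ((D' s * flow a' s 0)ᵀ * (D' s * flow a' s 0)))
      volume 0 t := ⟨(mulCLM n n n Xᵀ).integrable_comp hi.1, (mulCLM n n n Xᵀ).integrable_comp hi.2⟩
  have c2 := ((mulCLM n n n).flip X).intervalIntegral_comp_comm hi2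
  simp only [mulCLM_apply, ContinuousLinearMap.flip_apply] at c1 c2
  rw [← c1, ← c2]
  refine intervalIntegral.integral_congr_ae_restrict ?_
  filter_upwards [ae_uIoc_of_ae_Icc (left_mem_Icc.2 ht) (right_mem_Icc.2 ht) e2,
    ae_restrict_mem measurableSet_uIoc] with s hs hs'
  rw [hs.2, hfl s (uIcc_subset_Icc (left_mem_Icc.2 ht) (right_mem_Icc.2 ht) (uIoc_subset_uIcc hs'))]
  simp only [Matrix.transpose_mul, Matrix.mul_assoc]

/-! ### Unobservable subspaces -/

/-- The largest subspace invariant under all `v.1` and annihilated by all `v.2`, `v ∈ S`. -/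
def unobsSubspace {n k : ℕ} (S : Set (Matrix (Fin n) (Fin n) ℝ × Matrix (Fin k) (Fin n) ℝ)) :
    Submodule ℝ (Fin n → ℝ) :=
  sSup {N | ∀ v ∈ S, ∀ z ∈ N, v.1 *ᵥ z ∈ N ∧ v.2 *ᵥ z = 0}

section

variable {n k : ℕ} {S : Set (Matrix (Fin n) (Fin n) ℝ × Matrix (Fin k) (Fin n) ℝ)}

theorem le_unobsSubspace {N : Submodule ℝ (Fin n → ℝ)}
    (h : ∀ v ∈ S, ∀ z ∈ N, v.1 *ᵥ z ∈ N ∧ v.2 *ᵥ z = 0) : N ≤ unobsSubspace S :=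
  le_sSup h

theorem mulVec_mem_unobsSubspace {v : Matrix (Fin n) (Fin n) ℝ × Matrix (Fin k) (Fin n) ℝ}
    (hv : v ∈ S) {z : Fin n → ℝ} (hz : z ∈ unobsSubspace S) :
    v.1 *ᵥ z ∈ unobsSubspace S ∧ v.2 *ᵥ z = 0 := by
  have h : unobsSubspace S ≤
      (unobsSubspace S).comap (Matrix.mulVecLin v.1) ⊓ LinearMap.ker (Matrix.mulVecLin v.2) :=
    sSup_le fun N hN z hz => ⟨le_unobsSubspace hN (hN v hv z hz).1, (hN v hv z hz).2⟩
  exact h hz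

theorem exp_smul_mul_exp_smul_neg (a₀ : Matrix (Fin n) (Fin n) ℝ) (h : ℝ) :
    NormedSpace.exp (h • a₀) * NormedSpace.exp (h • (-a₀)) = 1 := by
  have hA : MemLp (fun _ : ℝ => a₀) ∞ (volume.restrict (uIcc 0 h)) := memLp_top_const a₀
  have := flow_mul_flow hA right_mem_uIcc right_mem_uIcc left_mem_uIcc
  rw [flow_self right_mem_uIcc hA, flow_const, flow_const] at this
  simpa using this

/-- The vector `a₀ z` is the right derivative of `e^{t a₀} z` at `0`. The difference quotients lie
in `N`, which is closed. -/
theorem mulVec_mem_of_exp_mem {N : Submodule ℝ (Fin n → ℝ)} {a₀ : Matrix (Fin n) (Fin n) ℝ}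
    {z : Fin n → ℝ} (hz : z ∈ N)
    (h : ∀ t : ℝ, 0 < t → NormedSpace.exp (t • a₀) *ᵥ z ∈ N) : a₀ *ᵥ z ∈ N := by
  have hd := ((mulVecCLM n n).flip z).hasFDerivAt.comp_hasDerivAt (0 : ℝ)
    (hasDerivAt_exp_smul_const' (𝕂 := ℝ) a₀ 0)
  have hd' := hd.tendsto_slope_zero.mono_left (nhdsWithin_mono 0 (s := Ioi 0) fun x hx => ne_of_gt hx)
  simp only [zero_add, zero_smul, NormedSpace.exp_zero, Matrix.mul_one] at hd'
  refine N.closed_of_finiteDimensional.mem_of_tendsto hd' ?_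
  filter_upwards [self_mem_nhdsWithin] with t ht
  refine N.smul_mem _ (N.sub_mem (h t ht) ?_)
  simpa using hz

/-- In a family of positive semidefinite matrices closed under the recursion of Gramians, some
member has no larger kernel than necessary. -/
theorem exists_ker_le_unobsSubspace {W : Set (Matrix (Fin n) (Fin n) ℝ)} (hne : W.Nonempty)
    (hpsd : ∀ X ∈ W, X.PosSemidef)
    (step : ∀ X ∈ W, ∀ v ∈ S, ∀ h : ℝ, 0 < h → ∃ Γ : Matrix (Fin n) (Fin n) ℝ, Γ.PosSemidef ∧
      (∀ z, Γ *ᵥ z = 0 → v.2 *ᵥ (NormedSpace.exp (h • v.1) *ᵥ z) = 0) ∧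
      Γ + (NormedSpace.exp (h • v.1))ᵀ * X * NormedSpace.exp (h • v.1) ∈ W) :
    ∃ X ∈ W, ∀ z, X *ᵥ z = 0 → z ∈ unobsSubspace S := by
  let ker : Matrix (Fin n) (Fin n) ℝ → Submodule ℝ (Fin n → ℝ) := fun X =>
    LinearMap.ker (Matrix.mulVecLin X)
  let d : Matrix (Fin n) (Fin n) ℝ → ℕ := fun X => Module.finrank ℝ (ker X)
  -- The members whose kernel has least dimension. The argument moves between them, since one step
  -- of the recursion generally changes the kernel.
  let 𝓜 := {X | X ∈ W ∧ ∀ Y ∈ W, d X ≤ d Y}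
  have hne' : 𝓜.Nonempty := by
    obtain ⟨X, hX, hmin⟩ := WellFounded.has_min (measure d).wf W hne
    exact ⟨X, hX, fun Y hY => not_lt.1 (hmin Y hY)⟩
  have key : ∀ X ∈ 𝓜, ∀ v ∈ S, ∀ h : ℝ, 0 < h → ∀ z ∈ ker X, v.2 *ᵥ z = 0 ∧
      ∃ Y ∈ 𝓜, NormedSpace.exp (h • (-v.1)) *ᵥ z ∈ ker Y := by
    intro X hX v hv h hh z hz
    obtain ⟨Γ, hΓ, hΓ0, hY⟩ := step X hX.1 v hv h hh
    set e := NormedSpace.exp (h • v.1) with he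
    set Y := Γ + eᵀ * X * e
    have hinv : e * NormedSpace.exp (h • (-v.1)) = 1 := exp_smul_mul_exp_smul_neg v.1 h
    have hinv' := mul_eq_one_comm.1 hinv
    have hker : ∀ w, Y *ᵥ w = 0 → Γ *ᵥ w = 0 ∧ X *ᵥ (e *ᵥ w) = 0 := by
      intro w hw
      have h0 : w ⬝ᵥ Y *ᵥ w = 0 := by rw [hw, dotProduct_zero]
      have h1 : w ⬝ᵥ Y *ᵥ w = w ⬝ᵥ Γ *ᵥ w + (e *ᵥ w) ⬝ᵥ X *ᵥ (e *ᵥ w) := by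
        rw [Matrix.add_mulVec, dotProduct_add, ← Matrix.mulVec_mulVec, ← Matrix.mulVec_mulVec,
          Matrix.dotProduct_mulVec w eᵀ, Matrix.vecMul_transpose]
      have h2 := hΓ.dotProduct_mulVec_nonneg w
      have h3 := (hpsd X hX.1).dotProduct_mulVec_nonneg (e *ᵥ w)
      rw [star_trivial] at h2 h3
      rw [← hΓ.dotProduct_mulVec_zero_iff, ← (hpsd X hX.1).dotProduct_mulVec_zero_iff, star_trivial,
        star_trivial]
      constructor <;> linarith
    let eq : (Fin n → ℝ) ≃ₗ[ℝ] (Fin n → ℝ) := LinearEquiv.ofLinearMap (Matrix.mulVecLin e)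
      (Matrix.mulVecLin (NormedSpace.exp (h • (-v.1))))
      (by rw [← Matrix.mulVecLin_mul, hinv, Matrix.mulVecLin_one])
      (by rw [← Matrix.mulVecLin_mul, hinv', Matrix.mulVecLin_one])
    have hle : ker Y ≤ (ker X).comap eq.toLinearMap := fun w hw => (hker w hw).2
    have hfr : Module.finrank ℝ ((ker X).comap eq.toLinearMap) = d X := by
      have := (eq.symm.submoduleMap (ker X)).finrank_eq
      rw [Submodule.map_equiv_eq_comap_symm] at this
      exact this.symm
    -- The kernel of `Y` is contained in the preimage of `ker X` under the isomorphism `e`, which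
    -- has the dimension of `ker X`; minimality leaves only equality.
    have heq := Submodule.eq_of_le_of_finrank_le hle (by rw [hfr]; exact hX.2 Y hY)
    have hmem : NormedSpace.exp (h • (-v.1)) *ᵥ z ∈ ker Y := by
      rw [heq]
      change X *ᵥ (e *ᵥ (NormedSpace.exp (h • (-v.1)) *ᵥ z)) = 0
      rw [Matrix.mulVec_mulVec _ e, hinv, Matrix.one_mulVec]
      exact hz
    refine ⟨?_, Y, ⟨hY, fun Z hZ => ?_⟩, hmem⟩
    -- The vector `e⁻¹ z` lies in `ker Y`, so `Γ` kills it, and `v.2` kills `e (e⁻¹ z) = z`.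
    · have := hΓ0 _ (hker _ hmem).1
      rwa [Matrix.mulVec_mulVec _ e, hinv, Matrix.one_mulVec] at this
    · have : d Y = d X := by rw [← hfr, ← heq]
      rw [this]
      exact hX.2 Z hZ
  -- A single minimal kernel need not be invariant, but the backward exponentials carry minimal
  -- kernels into minimal kernels, so their sum is.
  let 𝒦 := sSup (ker '' 𝓜)
  have hexp : ∀ v ∈ S, ∀ h : ℝ, 0 < h → ∀ z ∈ 𝒦, NormedSpace.exp (h • (-v.1)) *ᵥ z ∈ 𝒦 := by
    intro v hv h hh
    have : 𝒦 ≤ 𝒦.comap (Matrix.mulVecLin (NormedSpace.exp (h • (-v.1)))) := by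
      refine sSup_le ?_
      rintro _ ⟨X, hX, rfl⟩ z hz
      obtain ⟨-, Y, hY, hmem⟩ := key X hX v hv h hh z hz
      exact le_sSup (mem_image_of_mem ker hY) hmem
    exact this
  have hK : 𝒦 ≤ unobsSubspace S := by
    refine le_unobsSubspace fun v hv z hz => ⟨?_, ?_⟩
    · have := mulVec_mem_of_exp_mem hz fun t ht => hexp v hv t ht z hz
      rw [Matrix.neg_mulVec] at this
      exact neg_mem_iff.1 this
    · have : 𝒦 ≤ LinearMap.ker (Matrix.mulVecLin v.2) := by
        refine sSup_le ?_
        rintro _ ⟨X, hX, rfl⟩ z hz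
        exact (key X hX v hv 1 one_pos z hz).1
      exact this hz
  obtain ⟨X, hX⟩ := hne'
  exact ⟨X, hX.1, fun z hz => hK (le_sSup (mem_image_of_mem ker hX) hz)⟩

end

/-! ### Piecewise constant signals -/

theorem ae_restrict_Icc_of_ae_Ioc {p : ℝ → Prop} {a b : ℝ}
    (h : ∀ᵐ s ∂(volume.restrict (Ioc a b)), p s) : ∀ᵐ s ∂(volume.restrict (Icc a b)), p s := by
  rwa [← Measure.restrict_congr_set Ioc_ae_eq_Icc]

theorem ae_restrict_Icc_of_pieces {p : ℝ → Prop} {N : ℕ} {τ : ℕ → ℝ} {t : ℝ} (hτ : Monotone τ)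
    (h0 : τ 0 = 0) (hN : τ N = t)
    (h : ∀ i < N, ∀ᵐ s ∂(volume.restrict (Ioc (τ i) (τ (i + 1)))), p s) :
    ∀ᵐ s ∂(volume.restrict (Icc 0 t)), p s := by
  have key : ∀ j ≤ N, ∀ᵐ s ∂(volume.restrict (Ioc 0 (τ j))), p s := by
    intro j
    induction j with
    | zero => simp [h0]
    | succ j ih =>
      intro hj
      have h0j : 0 ≤ τ j := h0 ▸ hτ (Nat.zero_le j)
      rw [← Ioc_union_Ioc_eq_Ioc h0j (hτ (Nat.le_succ j))]
      exact ae_restrict_union_iff .. |>.2 ⟨ih (by omega), h j (by omega)⟩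
  exact ae_restrict_Icc_of_ae_Ioc (hN ▸ key N le_rfl)

theorem pcFamily_subset_arbFamily {E : Type*} [TopologicalSpace E] (M : Set E) (t : ℝ) :
    pcFamily M t ⊆ arbFamily M t := by
  rintro f ⟨N, τ, v, hτ, h0, hN, hv⟩
  refine ae_restrict_Icc_of_pieces hτ h0 hN fun i hi => ?_
  filter_upwards [(hv i hi).2] with s hs
  rw [hs]
  exact (hv i hi).1

theorem memLp_of_mem_arbFamily {E : Type*} [NormedAddCommGroup E] {M : Set E}
    (hM : Bornology.IsBounded M) {t : ℝ} {σ : Signal (Icc 0 t) E} (hσ : σ ∈ arbFamily M t) :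
    MemLp σ ∞ (volume.restrict (Icc 0 t)) := by
  obtain ⟨C, hC⟩ := hM.exists_norm_le
  exact memLp_top_of_bound σ.aestronglyMeasurable C
    (by filter_upwards [show ∀ᵐ s ∂(volume.restrict (Icc 0 t)), σ s ∈ M from hσ] with s hs using hC _ hs)

theorem const_mem_pcFamily {E : Type*} [TopologicalSpace E] {M : Set E} {v : E} (hv : v ∈ M) {t : ℝ}
    (ht : 0 ≤ t) : AEEqFun.const ℝ v ∈ pcFamily M t := by
  refine ⟨1, fun i => if i = 0 then 0 else t, fun _ => v, ?_, by simp, by simp, fun i hi => ⟨hv, ?_⟩⟩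
  · intro i j hij
    beta_reduce
    split_ifs <;> first | omega | simp
  · obtain rfl : i = 0 := by omega
    simp only [zero_add, one_ne_zero, if_true, if_false]
    exact ae_restrict_of_ae_restrict_of_subset Ioc_subset_Icc_self (AEEqFun.coeFn_const ℝ v)

/-- Prepend a constant to a piecewise constant signal. -/
theorem exists_prepend {E : Type*} [TopologicalSpace E] {M : Set E} {v : E} (hv : v ∈ M) {h t : ℝ}
    (hh : 0 ≤ h) {σ : Signal (Icc 0 t) E} (hσ : σ ∈ pcFamily M t) :
    ∃ ρ ∈ pcFamily M (h + t), (∀ᵐ r ∂(volume.restrict (Icc 0 h)), ρ r = v) ∧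
      ∀ᵐ r ∂(volume.restrict (Icc 0 t)), ρ (h + r) = σ r := by
  obtain ⟨N, τ, w, hτ, h0, hN, hw⟩ := hσ
  have ht : 0 ≤ t := by rw [← hN, ← h0]; exact hτ (Nat.zero_le N)
  let f : ℝ → E := fun r => if r ≤ h then v else σ (r - h)
  have hf : StronglyMeasurable f := StronglyMeasurable.ite measurableSet_Iic stronglyMeasurable_const
    (σ.stronglyMeasurable.comp_measurable (measurable_sub_const h))
  let ρ : Signal (Icc 0 (h + t)) E := AEEqFun.mk f hf.aestronglyMeasurable
  have hρ : ∀ᵐ r ∂(volume.restrict (Icc 0 (h + t))), ρ r = f r := AEEqFun.coeFn_mk f _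
  have h1 : ∀ᵐ r ∂(volume.restrict (Icc 0 h)), ρ r = v := by
    filter_upwards [ae_restrict_of_ae_restrict_of_subset (Icc_subset_Icc_right (by linarith)) hρ,
      ae_restrict_mem measurableSet_Icc] with r hr hr'
    rw [hr]
    exact if_pos hr'.2
  -- At the junction time `h` the function `f` still has the value `v`; the single time `r = 0` has
  -- to be discarded.
  have hpos : ∀ᵐ r : ℝ ∂(volume.restrict (Icc 0 t)), 0 < r :=
    ae_restrict_Icc_of_ae_Ioc ((ae_restrict_mem measurableSet_Ioc).mono fun r hr => hr.1)
  have h2 : ∀ᵐ r ∂(volume.restrict (Icc 0 t)), ρ (h + r) = σ r := by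
    have := (map_add_left_restrict_Icc h t).quasiMeasurePreserving.ae
      (ae_restrict_of_ae_restrict_of_subset (Icc_subset_Icc_left hh) hρ)
    filter_upwards [this, hpos] with r hr hr'
    rw [hr]
    simp only [f]
    rw [if_neg (by linarith), add_sub_cancel_left]
  refine ⟨ρ, ⟨N + 1, fun i => i.casesOn 0 fun i => h + τ i, fun i => i.casesOn v w, ?_, rfl, ?_, ?_⟩,
    h1, h2⟩
  · refine monotone_nat_of_le_succ fun i => ?_
    cases i with
    | zero => simpa [h0] using hh
    | succ i => simpa using hτ (Nat.le_succ i)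
  · simp [hN]
  · intro i hi
    cases i with
    | zero =>
      refine ⟨hv, ?_⟩
      simp only [h0, add_zero]
      exact ae_restrict_of_ae_restrict_of_subset Ioc_subset_Icc_self h1
    | succ i =>
      refine ⟨(hw i (by omega)).1, ?_⟩
      change ∀ᵐ s ∂(volume.restrict (Ioc (h + τ i) (h + τ (i + 1)))), ρ s = w i
      have hsub : Ioc (τ i) (τ (i + 1)) ⊆ Icc 0 t := fun r hr =>
        ⟨(h0 ▸ hτ (Nat.zero_le i) : (0 : ℝ) ≤ τ i).trans hr.1.le,
          hr.2.trans (hN ▸ hτ (by omega))⟩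
      have h3 : ∀ᵐ r ∂(volume.restrict (Ioc (τ i) (τ (i + 1)))), ρ (h + r) = w i := by
        filter_upwards [ae_restrict_of_ae_restrict_of_subset hsub h2, (hw i (by omega)).2]
          with r hr hr'
        rw [hr, hr']
      have mp := (measurePreserving_add_left volume (-h)).restrict_preimage
        (s := Ioc (τ i) (τ (i + 1))) measurableSet_Ioc
      have hpre : (fun r => -h + r) ⁻¹' Ioc (τ i) (τ (i + 1)) = Ioc (h + τ i) (h + τ (i + 1)) := by
        ext r
        simp only [mem_preimage, mem_Ioc]
        constructor <;> rintro ⟨_, _⟩ <;> constructor <;> linarith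
      rw [hpre] at mp
      have := mp.quasiMeasurePreserving.ae h3
      simpa using this

/-- Some piecewise constant signal detects everything that is observable. -/
theorem exists_pc_gram_ker_le {E : Type*} [NormedAddCommGroup E] [NormedSpace ℝ E] {n k : ℕ}
    {M : Set E} (hM : Bornology.IsBounded M) (hne : M.Nonempty)
    (f : E →L[ℝ] Matrix (Fin n) (Fin n) ℝ × Matrix (Fin k) (Fin n) ℝ) :
    ∃ t : ℝ, 0 < t ∧ ∃ σ ∈ pcFamily M t, ∀ z,
      gram (fun s => (f (σ s)).1) (fun s => (f (σ s)).2) t *ᵥ z = 0 → z ∈ unobsSubspace (f '' M) := by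
  have hbd : ∀ {t : ℝ} {σ : Signal (Icc 0 t) E}, σ ∈ pcFamily M t →
      MemLp (fun s => f (σ s)) ∞ (volume.restrict (Icc 0 t)) := fun hσ =>
    f.comp_memLp' (memLp_of_mem_arbFamily hM (pcFamily_subset_arbFamily M _ hσ))
  have hbd1 : ∀ {t : ℝ} {σ : Signal (Icc 0 t) E}, σ ∈ pcFamily M t →
      MemLp (fun s => (f (σ s)).1) ∞ (volume.restrict (Icc 0 t)) := fun hσ =>
    (hbd hσ).fst
  have hbd2 : ∀ {t : ℝ} {σ : Signal (Icc 0 t) E}, σ ∈ pcFamily M t →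
      MemLp (fun s => (f (σ s)).2) ∞ (volume.restrict (Icc 0 t)) := fun hσ =>
    (hbd hσ).snd
  -- Piecewise constant laws are closed under prepending a constant, so by `gram_concat` their
  -- Gramians satisfy the recursion required by `exists_ker_le_unobsSubspace`.
  let W : Set (Matrix (Fin n) (Fin n) ℝ) := {X | ∃ t : ℝ, 0 < t ∧ ∃ σ ∈ pcFamily M t,
    X = gram (fun s => (f (σ s)).1) (fun s => (f (σ s)).2) t}
  obtain ⟨v₀, hv₀⟩ := hne
  obtain ⟨X, ⟨t, ht, σ, hσ, rfl⟩, hX⟩ := exists_ker_le_unobsSubspace (S := f '' M) (W := W)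
    ⟨_, 1, one_pos, _, const_mem_pcFamily hv₀ zero_le_one, rfl⟩
    (by rintro _ ⟨t, ht, σ, hσ, rfl⟩; exact gram_posSemidef ht.le (hbd1 hσ) (hbd2 hσ))
    (by
      rintro _ ⟨t, ht, σ, hσ, rfl⟩ _ ⟨v, hv, rfl⟩ h hh
      obtain ⟨ρ, hρ, h1, h2⟩ := exists_prepend hv hh.le hσ
      refine ⟨gram (fun _ => (f v).1) (fun _ => (f v).2) h,
        gram_posSemidef hh.le (memLp_top_const _) (memLp_top_const _),
        fun z hz => gram_const_mulVec_eq_zero hh hz, h + t, by positivity, ρ, hρ, ?_⟩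
      refine (gram_concat hh.le ht.le (hbd1 hρ) (hbd2 hρ) (hbd1 hσ) (hbd2 hσ) ?_ ?_).symm
      · filter_upwards [h1] with r hr
        simp [hr]
      · filter_upwards [h2] with r hr
        simp [hr])
  exact ⟨t, ht, σ, hσ, hX⟩

/-! ### Trajectories -/

section

variable {n m p : ℕ} {σ : ℝ → Triple n m p} {u : ℝ → EuclideanSpace ℝ (Fin m)} {t : ℝ}

theorem memLp_fst {μ : Measure ℝ} (hσ : MemLp σ ∞ μ) : MemLp (fun s => (σ s).1) ∞ μ := hσ.fst

theorem memLp_snd_fst {μ : Measure ℝ} (hσ : MemLp σ ∞ μ) : MemLp (fun s => (σ s).2.1) ∞ μ :=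
  hσ.snd.fst

theorem memLp_snd_snd {μ : Measure ℝ} (hσ : MemLp σ ∞ μ) : MemLp (fun s => (σ s).2.2) ∞ μ :=
  hσ.snd.snd

theorem integrableOn_input (hσ : MemLp σ ∞ (volume.restrict (Icc 0 t)))
    (hu : MemLp u 2 (volume.restrict (Icc 0 t))) :
    IntegrableOn (fun s => (σ s).2.1 *ᵥ (u s).ofLp) (Icc 0 t) := by
  have hu' : MemLp (fun s => (u s).ofLp) 2 (volume.restrict (Icc 0 t)) :=
    (EuclideanSpace.equiv (Fin m) ℝ).toContinuousLinearMap.comp_memLp' hu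
  exact (ContinuousLinearMap.memLp_of_bilin 2 (mulVecCLM n m) (memLp_snd_fst hσ) hu').integrable
    (by norm_num)

theorem isTrajectory_iff (ht : 0 ≤ t) (hσ : MemLp σ ∞ (volume.restrict (Icc 0 t)))
    (hu : MemLp u 2 (volume.restrict (Icc 0 t))) {x₀ : Fin n → ℝ} {x : ℝ → Fin n → ℝ} :
    IsTrajectory σ u x₀ (Icc 0 t) x ↔ IsSolution (fun s => mulVecCLM n n (σ s).1)
      (fun s => (σ s).2.1 *ᵥ (u s).ofLp) 0 x₀ (Icc 0 t) x := by
  refine and_congr_right fun hc => forall₂_congr fun r hr => ?_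
  refine and_iff_right ?_
  exact intervalIntegrable_of_integrableOn_Icc ((integrableOn_clm_apply
    (memLp_mulVecCLM (memLp_fst hσ)) hc).add (integrableOn_input hσ hu)) (left_mem_Icc.2 ht) hr

theorem exists_isTrajectory (ht : 0 ≤ t) (hσ : MemLp σ ∞ (volume.restrict (Icc 0 t)))
    (hu : MemLp u 2 (volume.restrict (Icc 0 t))) (x₀ : Fin n → ℝ) :
    ∃ x, IsTrajectory σ u x₀ (Icc 0 t) x := by
  obtain ⟨x, hx⟩ := exists_isSolution (left_mem_Icc.2 ht) (memLp_mulVecCLM (memLp_fst hσ))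
    (integrableOn_input hσ hu) x₀
  exact ⟨x, (isTrajectory_iff ht hσ hu).2 hx⟩

theorem IsTrajectory.eqOn (ht : 0 ≤ t) (hσ : MemLp σ ∞ (volume.restrict (Icc 0 t)))
    (hu : MemLp u 2 (volume.restrict (Icc 0 t))) {x₀ : Fin n → ℝ} {x y : ℝ → Fin n → ℝ}
    (hx : IsTrajectory σ u x₀ (Icc 0 t) x) (hy : IsTrajectory σ u x₀ (Icc 0 t) y) :
    EqOn x y (Icc 0 t) :=
  ((isTrajectory_iff ht hσ hu).1 hx).eqOn (left_mem_Icc.2 ht) (memLp_mulVecCLM (memLp_fst hσ))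
    (integrableOn_input hσ hu) ((isTrajectory_iff ht hσ hu).1 hy)

theorem isTrajectory_flow (ht : 0 ≤ t) (hσ : MemLp σ ∞ (volume.restrict (Icc 0 t)))
    (z : Fin n → ℝ) :
    IsTrajectory σ (fun _ => 0) z (Icc 0 t) (fun s => flow (fun r => (σ r).1) s 0 *ᵥ z) := by
  refine (isTrajectory_iff ht hσ MemLp.zero').2 ?_
  simpa using isSolution_flow_mulVec (left_mem_Icc.2 ht) (memLp_fst hσ) z

/-- Every state `z` with `Φ(0, t) z` in the range of the controllability Gramian is reachable. -/
theorem exists_isTrajectory_of_ctrlGramian (ht : 0 ≤ t)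
    (hσ : MemLp σ ∞ (volume.restrict (Icc 0 t))) {z η : Fin n → ℝ}
    (h : ctrlGramian σ t *ᵥ η = flow (fun r => (σ r).1) 0 t *ᵥ z) :
    ∃ (u : ℝ → EuclideanSpace ℝ (Fin m)) (x : ℝ → Fin n → ℝ),
      MemLp u 2 (volume.restrict (Ici 0)) ∧ IsTrajectory σ u 0 (Icc 0 t) x ∧ x t = z := by
  have h0 := left_mem_Icc.2 ht
  have h1 := right_mem_Icc.2 ht
  have hA := memLp_fst hσ
  have hA' := memLp_neg_transpose hA
  have hB := memLp_transpose (memLp_snd_fst hσ)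
  set a : ℝ → Matrix (Fin n) (Fin n) ℝ := fun s => -((σ s).1)ᵀ
  -- The minimum-energy control `B(s)ᵀ Φ(0, s)ᵀ η`; the transposed inverse flow appears as the flow
  -- of the adjoint coefficient `a`.
  let w : ℝ → Fin m → ℝ := fun s => ((σ s).2.1)ᵀ *ᵥ (flow a s 0 *ᵥ η)
  have hw : MemLp w ∞ (volume.restrict (Icc 0 t)) :=
    memLp_mulVec hB (isSolution_flow_mulVec h0 hA' η).1.memLp_top_Icc
  have hw' : MemLp (fun s => (WithLp.toLp 2 (w s) : EuclideanSpace ℝ (Fin m))) 2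
      (volume.restrict (Icc 0 t)) :=
    ((EuclideanSpace.equiv (Fin m) ℝ).symm.toContinuousLinearMap.comp_memLp' hw).mono_exponent le_top
  let u : ℝ → EuclideanSpace ℝ (Fin m) := (Icc 0 t).indicator fun s => WithLp.toLp 2 (w s)
  have hu : MemLp u 2 (volume.restrict (Ici 0)) := by
    rw [memLp_indicator_iff_restrict measurableSet_Icc, Measure.restrict_restrict measurableSet_Icc,
      inter_eq_left.2 Icc_subset_Ici_self]
    exact hw'
  have hut : MemLp u 2 (volume.restrict (Icc 0 t)) :=
    hu.mono_measure (Measure.restrict_mono Icc_subset_Ici_self le_rfl)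
  obtain ⟨x, hx⟩ := exists_isTrajectory ht hσ hut 0
  refine ⟨u, x, hu, hx, ?_⟩
  have hx' := (isTrajectory_iff ht hσ hut).1 hx
  -- Pairing the trajectory with each adjoint solution shows that the state, pulled back to time
  -- `0`, is the Gramian applied to `η`.
  have key : flow (fun r => (σ r).1) 0 t *ᵥ x t = flow (fun r => (σ r).1) 0 t *ᵥ z := by
    rw [← h]
    refine dotProduct_eq _ _ fun ζ => ?_
    rw [dotProduct_comm, dotProduct_comm _ ζ, ctrlGramian_eq_gram ht hA,
      dotProduct_gram_mulVec ht hA' hB]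
    have e := adjoint_dotProduct_eq h0 hA (integrableOn_input hσ hut)
      (isSolution_flow_mulVec h0 hA' ζ) hx' h1
    rw [dotProduct_zero, zero_add, flow_neg_transpose hA h0 h1] at e
    rw [Matrix.dotProduct_mulVec, ← Matrix.mulVec_transpose, e]
    refine intervalIntegral.integral_congr fun s hs => ?_
    rw [uIcc_of_le ht] at hs
    simp only [u, indicator_of_mem hs]
    rw [Matrix.dotProduct_mulVec, ← Matrix.mulVec_transpose]
  have hinv := flow_mul_flow hA h1 h1 h0
  rw [flow_self h1 hA] at hinv
  have := congrArg (fun y => flow (fun r => (σ r).1) t 0 *ᵥ y) key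
  simpa only [Matrix.mulVec_mulVec, hinv, Matrix.one_mulVec] using this

end

/-! ### Reachable and observable points with arbitrary switching -/

/-- The range of a symmetric operator in finite dimension is the orthogonal complement of its
kernel. -/
theorem _root_.Matrix.IsHermitian.exists_mulVec_eq {n : ℕ} {W : Matrix (Fin n) (Fin n) ℝ}
    (hW : W.IsHermitian) {z : Fin n → ℝ} (h : ∀ η, W *ᵥ η = 0 → η ⬝ᵥ z = 0) : ∃ η, W *ᵥ η = z := by
  have hsym : (Matrix.toEuclideanLin W).IsSymmetric := Matrix.isSymmetric_toEuclideanLin_iff.2 hW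
  have hz : (WithLp.toLp 2 z : EuclideanSpace ℝ (Fin n)) ∈ LinearMap.range (Matrix.toEuclideanLin W) := by
    rw [← Submodule.orthogonal_orthogonal (LinearMap.range (Matrix.toEuclideanLin W)),
      hsym.orthogonal_range, Submodule.mem_orthogonal]
    intro y hy
    rw [LinearMap.mem_ker] at hy
    have := h y.ofLp (by simpa using congrArg WithLp.ofLp hy)
    rw [EuclideanSpace.inner_eq_star_dotProduct, star_trivial, dotProduct_comm]
    exact this
  obtain ⟨η, hη⟩ := hz
  exact ⟨η.ofLp, by simpa using congrArg WithLp.ofLp hη⟩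

/-- The pair `(A, C)`, which determines the observability Gramian. -/
def obsPair (n m p : ℕ) : Triple n m p →L[ℝ] Matrix (Fin n) (Fin n) ℝ × Matrix (Fin p) (Fin n) ℝ :=
  (ContinuousLinearMap.fst ℝ _ _).prod
    ((ContinuousLinearMap.snd ℝ _ _).comp (ContinuousLinearMap.snd ℝ _ _))

/-- The pair `(-Aᵀ, Bᵀ)`, which determines the controllability Gramian. -/
def ctrlPair (n m p : ℕ) : Triple n m p →L[ℝ] Matrix (Fin n) (Fin n) ℝ × Matrix (Fin m) (Fin n) ℝ where
  toFun v := (-v.1ᵀ, v.2.1ᵀ)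
  map_add' v w := by simp [add_comm]
  map_smul' c v := by simp
  cont := by fun_prop

@[simp] theorem obsPair_apply {n m p : ℕ} (v : Triple n m p) : obsPair n m p v = (v.1, v.2.2) := rfl

@[simp] theorem ctrlPair_apply {n m p : ℕ} (v : Triple n m p) :
    ctrlPair n m p v = (-v.1ᵀ, v.2.1ᵀ) := rfl

variable {n m p : ℕ} {M : Set (Triple n m p)}

/-- The unobservable states. -/
def unobs (M : Set (Triple n m p)) : Submodule ℝ (Fin n → ℝ) :=
  unobsSubspace (obsPair n m p '' M)

/-- The linear forms vanishing on the reachable states. -/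
def unctrl (M : Set (Triple n m p)) : Submodule ℝ (Fin n → ℝ) :=
  unobsSubspace (ctrlPair n m p '' M)

theorem le_unobs {N : Submodule ℝ (Fin n → ℝ)}
    (h : ∀ v ∈ M, ∀ z ∈ N, v.1 *ᵥ z ∈ N ∧ v.2.2 *ᵥ z = 0) : N ≤ unobs M := by
  refine le_unobsSubspace ?_
  rintro _ ⟨v, hv, rfl⟩ z hz
  exact h v hv z hz

/-- The sign in `ctrlPair` is immaterial, since subspaces are closed under negation. -/
theorem le_unctrl {N : Submodule ℝ (Fin n → ℝ)}
    (h : ∀ v ∈ M, ∀ z ∈ N, v.1ᵀ *ᵥ z ∈ N ∧ v.2.1ᵀ *ᵥ z = 0) : N ≤ unctrl M := by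
  refine le_unobsSubspace ?_
  rintro _ ⟨v, hv, rfl⟩ z hz
  refine ⟨?_, (h v hv z hz).2⟩
  simpa [Matrix.neg_mulVec] using (h v hv z hz).1

theorem mulVec_mem_unobs {v : Triple n m p} (hv : v ∈ M) {z : Fin n → ℝ} (hz : z ∈ unobs M) :
    v.1 *ᵥ z ∈ unobs M ∧ v.2.2 *ᵥ z = 0 :=
  mulVec_mem_unobsSubspace (mem_image_of_mem _ hv) hz

theorem mulVec_mem_unctrl {v : Triple n m p} (hv : v ∈ M) {z : Fin n → ℝ} (hz : z ∈ unctrl M) :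
    v.1ᵀ *ᵥ z ∈ unctrl M ∧ v.2.1ᵀ *ᵥ z = 0 := by
  have h : (-v.1ᵀ) *ᵥ z ∈ unctrl M ∧ v.2.1ᵀ *ᵥ z = 0 :=
    mulVec_mem_unobsSubspace (mem_image_of_mem (ctrlPair n m p) hv) hz
  rw [Matrix.neg_mulVec, neg_mem_iff] at h
  exact h

/-- The reachable subspace, described by linear forms. -/
def reachSubspace (M : Set (Triple n m p)) : Submodule ℝ (Fin n → ℝ) where
  carrier := {z | ∀ η ∈ unctrl M, η ⬝ᵥ z = 0}
  add_mem' hx hy η hη := by rw [dotProduct_add, hx η hη, hy η hη, add_zero]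
  zero_mem' η _ := dotProduct_zero η
  smul_mem' c x hx η hη := by rw [dotProduct_smul, hx η hη, smul_zero]

/-- Invariance passes from a space of linear forms under transposes to its annihilator. -/
theorem mulVec_mem_reachSubspace {v : Triple n m p} (hv : v ∈ M) {z : Fin n → ℝ}
    (hz : z ∈ reachSubspace M) : v.1 *ᵥ z ∈ reachSubspace M := by
  intro η hη
  rw [Matrix.dotProduct_mulVec, ← Matrix.mulVec_transpose]
  exact hz _ (mulVec_mem_unctrl hv hη).1

theorem mulVec_input_mem_reachSubspace {v : Triple n m p} (hv : v ∈ M) (w : Fin m → ℝ) :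
    v.2.1 *ᵥ w ∈ reachSubspace M := by
  intro η hη
  rw [Matrix.dotProduct_mulVec, ← Matrix.mulVec_transpose, (mulVec_mem_unctrl hv hη).2,
    zero_dotProduct]

theorem exists_pc_ctrlGramian (hM : Bornology.IsBounded M) (hne : M.Nonempty) :
    ∃ t : ℝ, 0 < t ∧ ∃ σ ∈ pcFamily M t, ∀ z, ctrlGramian σ t *ᵥ z = 0 → z ∈ unctrl M := by
  obtain ⟨t, ht, σ, hσ, h⟩ := exists_pc_gram_ker_le hM hne (ctrlPair n m p)
  refine ⟨t, ht, σ, hσ, fun z hz => h z ?_⟩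
  rwa [ctrlGramian_eq_gram ht.le (memLp_fst (memLp_of_mem_arbFamily hM
    (pcFamily_subset_arbFamily M t hσ)))] at hz

theorem exists_pc_obsGramian (hM : Bornology.IsBounded M) (hne : M.Nonempty) :
    ∃ t : ℝ, 0 < t ∧ ∃ σ ∈ pcFamily M t, ∀ z, obsGramian σ t *ᵥ z = 0 → z ∈ unobs M := by
  obtain ⟨t, ht, σ, hσ, h⟩ := exists_pc_gram_ker_le hM hne (obsPair n m p)
  refine ⟨t, ht, σ, hσ, fun z hz => h z ?_⟩
  rwa [obsGramian_eq_gram] at hz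

/-- Trajectories from `0` cannot leave an invariant subspace containing all inputs. Conversely one
piecewise constant law, with the smallest possible Gramian kernel, reaches the whole subspace. -/
theorem reachableSet_arbFamily (hM : Bornology.IsBounded M) (hne : M.Nonempty) :
    reachableSet (arbFamily M) = reachSubspace M := by
  ext z
  constructor
  · rintro ⟨t, ht, σ, hσ, u, x, hu, hx, rfl⟩
    have hb := memLp_of_mem_arbFamily hM hσ
    have hσ' : ∀ᵐ s ∂(volume.restrict (Icc 0 t)), σ s ∈ M := hσ
    have hut : MemLp u 2 (volume.restrict (Icc 0 t)) :=
      hu.mono_measure (Measure.restrict_mono Icc_subset_Ici_self le_rfl)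
    refine ((isTrajectory_iff ht hb hut).1 hx).mem_submodule (left_mem_Icc.2 ht)
      (memLp_mulVecCLM (memLp_fst hb)) (integrableOn_input hb hut) (zero_mem _) ?_ ?_ t
      (right_mem_Icc.2 ht)
    · filter_upwards [hσ'] with s hs z hz using mulVec_mem_reachSubspace hs hz
    · filter_upwards [hσ'] with s hs using mulVec_input_mem_reachSubspace hs _
  · intro hz
    obtain ⟨t, ht, σ, hσ, hker⟩ := exists_pc_ctrlGramian hM hne
    have harb := pcFamily_subset_arbFamily M t hσ
    have hb := memLp_of_mem_arbFamily hM harb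
    have hσ' : ∀ᵐ s ∂(volume.restrict (Icc 0 t)), σ s ∈ M := harb
    -- Flowing backwards also preserves the subspace: the invariance lemma allows an initial time at
    -- the right end of the interval.
    have hmem : flow (fun r => (σ r).1) 0 t *ᵥ z ∈ reachSubspace M := by
      refine (isSolution_flow_mulVec (right_mem_Icc.2 ht.le) (memLp_fst hb) z).mem_submodule
        (right_mem_Icc.2 ht.le) (memLp_mulVecCLM (memLp_fst hb)) integrableOn_zero hz ?_
        (Eventually.of_forall fun _ => zero_mem _) 0 (left_mem_Icc.2 ht.le)
      filter_upwards [hσ'] with s hs z hz using mulVec_mem_reachSubspace hs hz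
    have hpsd : (ctrlGramian σ t).PosSemidef := by
      rw [ctrlGramian_eq_gram ht.le (memLp_fst hb)]
      exact gram_posSemidef ht.le (memLp_neg_transpose (memLp_fst hb))
        (memLp_transpose (memLp_snd_fst hb))
    -- Forms in the kernel of the Gramian lie in `unctrl M`, hence annihilate the pulled back state,
    -- which therefore lies in the range.
    obtain ⟨η, hη⟩ := hpsd.isHermitian.exists_mulVec_eq fun η hη => hmem η (hker η hη)
    obtain ⟨u, x, hu, hx, hxz⟩ := exists_isTrajectory_of_ctrlGramian ht.le hb hη
    exact ⟨t, ht.le, σ, harb, u, x, hu, hx, hxz⟩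

theorem mem_observableSet_of_obsGramian {G : SignalFamily (Triple n m p)} {t : ℝ} (ht : 0 ≤ t)
    {σ : Signal (Icc 0 t) (Triple n m p)} (hσ : σ ∈ G t)
    (hb : MemLp σ ∞ (volume.restrict (Icc 0 t))) {z : Fin n → ℝ} (hz : obsGramian σ t *ᵥ z ≠ 0) :
    z ∈ observableSet G := by
  refine ⟨t, ht, σ, hσ, _, isTrajectory_flow ht hb z, fun h => hz ?_⟩
  rw [obsGramian_eq_gram]
  exact gram_mulVec_eq_zero_of_ae ht (memLp_fst hb) (memLp_snd_snd hb) h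

/-- A free trajectory started in an invariant subspace killed by all outputs stays there; any other
state is detected by the law of `exists_pc_obsGramian`. -/
theorem compl_observableSet_arbFamily (hM : Bornology.IsBounded M) (hne : M.Nonempty) :
    (observableSet (arbFamily M))ᶜ = unobs M := by
  ext z
  constructor
  · intro hz
    by_contra hz'
    obtain ⟨t, ht, σ, hσ, hker⟩ := exists_pc_obsGramian hM hne
    have harb := pcFamily_subset_arbFamily M t hσ
    exact hz (mem_observableSet_of_obsGramian ht.le harb (memLp_of_mem_arbFamily hM harb)
      fun h => hz' (hker z h))
  · rintro hz ⟨t, ht, σ, hσ, x, hx, hne⟩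
    refine hne ?_
    have hb := memLp_of_mem_arbFamily hM hσ
    have hσ' : ∀ᵐ s ∂(volume.restrict (Icc 0 t)), σ s ∈ M := hσ
    have hxm := ((isTrajectory_iff ht hb MemLp.zero').1 hx).mem_submodule (left_mem_Icc.2 ht)
      (memLp_mulVecCLM (memLp_fst hb)) (integrableOn_input hb MemLp.zero') hz
      (by filter_upwards [hσ'] with s hs z hz using (mulVec_mem_unobs hs hz).1)
      (by filter_upwards with s; simp)
    filter_upwards [hσ', ae_restrict_mem measurableSet_Icc] with s hs hs'
    exact (mulVec_mem_unobs hs (hxm s hs')).2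

theorem isControllable_of_ctrlGramian {G : SignalFamily (Triple n m p)} {t : ℝ} (ht : 0 ≤ t)
    {σ : Signal (Icc 0 t) (Triple n m p)} (hσ : σ ∈ G t)
    (hb : MemLp σ ∞ (volume.restrict (Icc 0 t))) (hdet : (ctrlGramian σ t).det ≠ 0) :
    IsControllable G := by
  refine eq_univ_of_forall fun z => ?_
  obtain ⟨u, x, hu, hx, hxz⟩ := exists_isTrajectory_of_ctrlGramian ht hb (z := z)
    (η := (ctrlGramian σ t)⁻¹ *ᵥ (flow (fun r => (σ r).1) 0 t *ᵥ z)) (by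
      rw [Matrix.mulVec_mulVec _ (ctrlGramian σ t), Matrix.mul_nonsing_inv _ (isUnit_iff_ne_zero.2 hdet),
        Matrix.one_mulVec])
  exact ⟨t, ht, σ, hσ, u, x, hu, hx, hxz⟩

theorem isObservable_of_obsGramian {G : SignalFamily (Triple n m p)} {t : ℝ} (ht : 0 ≤ t)
    {σ : Signal (Icc 0 t) (Triple n m p)} (hσ : σ ∈ G t)
    (hb : MemLp σ ∞ (volume.restrict (Icc 0 t))) (hdet : (obsGramian σ t).det ≠ 0) :
    IsObservable G :=
  fun _ hz => mem_observableSet_of_obsGramian ht hσ hb fun h =>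
    hz (Matrix.eq_zero_of_mulVec_eq_zero hdet h)

/-! ### Images of signals under linear maps -/

section

variable {E F H : Type*} [TopologicalSpace E] [AddCommMonoid E] [Module ℝ E]
  [TopologicalSpace F] [AddCommMonoid F] [Module ℝ F]
  [TopologicalSpace H] [AddCommMonoid H] [Module ℝ H]

theorem signal_comp_comp {I : Set ℝ} (L : E →L[ℝ] F) (L' : F →L[ℝ] H) (f : Signal I E) :
    AEEqFun.comp L' L'.continuous (AEEqFun.comp L L.continuous f) =
      AEEqFun.comp (L'.comp L) (L'.comp L).continuous f := by
  induction f using AEEqFun.induction_on with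
  | _ f hf => rfl

theorem mapClass_comp (L : E →L[ℝ] F) (L' : F →L[ℝ] H) (S : SignalClass E) :
    mapClass L' (mapClass L S) = mapClass (L'.comp L) S := by
  simp only [mapClass, image_image, signal_comp_comp]

theorem mapFamily_comp (L : E →L[ℝ] F) (L' : F →L[ℝ] H) (G : SignalFamily E) :
    mapFamily L' (mapFamily L G) = mapFamily (L'.comp L) G := by
  funext t
  simp only [mapFamily, image_image, signal_comp_comp]

theorem ae_comp {I : Set ℝ} (L : E →L[ℝ] F) (f : Signal I E) :
    ∀ᵐ s ∂(volume.restrict I), AEEqFun.comp L L.continuous f s = L (f s) :=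
  AEEqFun.coeFn_comp L L.continuous f

theorem comp_mem_valuedIn {I : Set ℝ} (L : E →L[ℝ] F) {M : Set E} {f : Signal I E}
    (hf : f ∈ valuedIn I M) : AEEqFun.comp L L.continuous f ∈ valuedIn I (L '' M) := by
  have hf' : ∀ᵐ s ∂(volume.restrict I), f s ∈ M := hf
  change ∀ᵐ s ∂(volume.restrict I), AEEqFun.comp L L.continuous f s ∈ L '' M
  filter_upwards [hf', ae_comp L f] with s hs hs'
  rw [hs']
  exact mem_image_of_mem L hs

theorem A0.map {S : SignalClass E} (h : A0 S) (L : E →L[ℝ] F) : A0 (mapClass L S) := by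
  rintro _ ⟨f, hf, rfl⟩ t ht
  obtain ⟨g, hg, hgf⟩ := h f hf t ht
  refine ⟨_, ⟨g, hg, rfl⟩, ?_⟩
  have mp := (measurePreserving_add_left volume t).restrict_preimage (s := Ici t) measurableSet_Ici
  have hpre : (fun r => t + r) ⁻¹' Ici t = Ici 0 := by ext r; simp
  rw [hpre] at mp
  have := mp.quasiMeasurePreserving.ae
    (ae_restrict_of_ae_restrict_of_subset (Ici_subset_Ici.2 ht) (ae_comp L f))
  filter_upwards [hgf, ae_comp L g, this] with r h1 h2 h3
  rw [h2, h3, h1]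

theorem ae_restrict_Icc_shift {p : ℝ → Prop} {h t : ℝ} :
    (∀ᵐ r ∂(volume.restrict (Icc 0 t)), p (h + r)) ↔
      ∀ᵐ r ∂(volume.restrict (Icc h (h + t))), p r := by
  rw [← (map_add_left_restrict_Icc h t).map_eq,
    (measurableEmbedding_addLeft h).ae_map_iff]

theorem A1.map {G : SignalFamily E} (h : A1 G) (L : E →L[ℝ] F) : A1 (mapFamily L G) := by
  rintro s t hs ht _ ⟨f, hf, rfl⟩ _ ⟨g, hg, rfl⟩
  obtain ⟨k, hk, h1, h2⟩ := h s t hs ht f hf g hg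
  refine ⟨_, ⟨k, hk, rfl⟩, ?_, ?_⟩
  · filter_upwards [h1, ae_comp L f, ae_restrict_of_ae_restrict_of_subset
      (Icc_subset_Icc_right (by linarith)) (ae_comp L k)] with r h1 h2 h3
    rw [h2, h3, h1]
  · filter_upwards [h2, ae_comp L g, ae_restrict_Icc_shift.2 (ae_restrict_of_ae_restrict_of_subset
      (Icc_subset_Icc_left hs) (ae_comp L k))] with r h1 h2 h3
    rw [h2, h3, h1]

end

/-- Piecewise constant signals can be lifted along maps of the set of values. -/
theorem exists_pc_lift {E F : Type*} [TopologicalSpace E] [TopologicalSpace F]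
    [Nonempty E] (φ : E → F) {M : Set E} {t : ℝ}
    {f : Signal (Icc 0 t) F} (hf : f ∈ pcFamily (φ '' M) t) :
    ∃ g ∈ pcFamily M t, ∀ᵐ s ∂(volume.restrict (Icc 0 t)), f s = φ (g s) := by
  obtain ⟨N, τ, v, hτ, h0, hN, hv⟩ := hf
  have hw : ∀ i, ∃ w : E, i < N → w ∈ M ∧ φ w = v i := by
    intro i
    by_cases hi : i < N
    · obtain ⟨w, hw⟩ := (hv i hi).1
      exact ⟨w, fun _ => hw⟩
    · exact ⟨Classical.arbitrary E, fun h => absurd h hi⟩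
  choose w hw using hw
  -- Built by appending one piece at a time: `g (j + 1)` keeps `g j` up to `τ j` and equals `w j`
  -- afterwards. Empty pieces cause no difficulty.
  let g : ℕ → ℝ → E := fun j => Nat.rec (fun _ => w 0) (fun j gj s => if s ≤ τ j then gj s else w j) j
  have hg : ∀ j, StronglyMeasurable (g j) := by
    intro j
    induction j with
    | zero => exact stronglyMeasurable_const
    | succ j ih => exact StronglyMeasurable.ite measurableSet_Iic ih stronglyMeasurable_const
  have hgw : ∀ j, ∀ i < j, ∀ s ∈ Ioc (τ i) (τ (i + 1)), g j s = w i := by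
    intro j
    induction j with
    | zero => intro i hi; omega
    | succ j ih =>
      intro i hi s hs
      change (if s ≤ τ j then g j s else w j) = w i
      rcases Nat.lt_succ_iff_lt_or_eq.1 hi with h | rfl
      · rw [if_pos (hs.2.trans (hτ h)), ih i h s hs]
      · rw [if_neg (not_le.2 hs.1)]
  let k : Signal (Icc 0 t) E := AEEqFun.mk (g N) (hg N).aestronglyMeasurable
  have hk : ∀ᵐ s ∂(volume.restrict (Icc 0 t)), k s = g N s := AEEqFun.coeFn_mk _ _
  have hkw : ∀ i < N, ∀ᵐ s ∂(volume.restrict (Ioc (τ i) (τ (i + 1)))), k s = w i := by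
    intro i hi
    have hsub : Ioc (τ i) (τ (i + 1)) ⊆ Icc 0 t := fun r hr =>
      ⟨(h0 ▸ hτ (Nat.zero_le i) : (0 : ℝ) ≤ τ i).trans hr.1.le, hr.2.trans (hN ▸ hτ (by omega))⟩
    filter_upwards [ae_restrict_of_ae_restrict_of_subset hsub hk, ae_restrict_mem measurableSet_Ioc]
      with s hs hs'
    rw [hs, hgw N i hi s hs']
  refine ⟨k, ⟨N, τ, w, hτ, h0, hN, fun i hi => ⟨(hw i hi).1, hkw i hi⟩⟩, ?_⟩
  refine ae_restrict_Icc_of_pieces hτ h0 hN fun i hi => ?_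
  filter_upwards [hkw i hi, (hv i hi).2] with s h1 h2
  rw [h1, h2, (hw i hi).2]

/-- Infinite concatenations can be lifted along linear maps. -/
theorem concatClass_mapFamily_subset {E F : Type*} [NormedAddCommGroup E] [NormedSpace ℝ E]
    [NormedAddCommGroup F] [NormedSpace ℝ F] (L : E →L[ℝ] F) (G : SignalFamily E) :
    concatClass (mapFamily L G) ⊆ mapClass L (concatClass G) := by
  rintro h' ⟨τ, f, hτ0, hf, hlim, hh'⟩
  choose g hg hgf using hf
  set S : ℕ → ℝ := fun k => ∑ i ∈ Finset.range k, τ i with hS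
  have hS0 : S 0 = 0 := by simp [hS]
  have hSs : ∀ k, S (k + 1) = S k + τ k := fun k => Finset.sum_range_succ τ k
  have hSm : Monotone S := monotone_nat_of_le_succ fun k => by rw [hSs]; linarith [hτ0 k]
  have hex : ∀ r : ℝ, ∃ k, r < S (k + 1) := fun r => by
    obtain ⟨k, hk⟩ := (hlim.eventually_gt_atTop r).exists
    exact ⟨k, hk.trans_le (hSm (Nat.le_succ k))⟩
  classical
  -- The first `k` with `r < S (k + 1)`, so pieces of length zero are skipped and the half-open
  -- intervals cover `[0, ∞)` without overlap.
  let idx : ℝ → ℕ := fun r => Nat.find (hex r)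
  have hidx : ∀ k, ∀ r ∈ Ico (S k) (S (k + 1)), idx r = k := by
    intro k r hr
    refine (Nat.find_eq_iff (hex r)).2 ⟨hr.2, fun j hj => not_lt.2 ((hSm ?_).trans hr.1)⟩
    omega
  have hcover : Ici (0 : ℝ) = ⋃ k, Ico (S k) (S (k + 1)) := by
    ext r
    rw [mem_iUnion]
    constructor
    · intro hr
      refine ⟨idx r, ?_, Nat.find_spec (hex r)⟩
      rcases Nat.eq_zero_or_pos (idx r) with h | h
      · rw [h, hS0]; exact hr
      · have := Nat.find_min (hex r) (m := idx r - 1) (by change _ < idx r; omega)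
        rw [Nat.sub_add_cancel h] at this
        exact not_lt.1 this
    · rintro ⟨k, hk⟩
      exact (hS0 ▸ hSm (Nat.zero_le k) : (0 : ℝ) ≤ S k).trans hk.1
  -- The type of `g k` depends on `τ k`; passing to representatives allows the index to depend on
  -- time.
  let g' : ℕ → ℝ → E := fun k => g k
  let φ : ℝ → E := fun r => g' (idx r) (r - S (idx r))
  have hφ : AEStronglyMeasurable φ (volume.restrict (Ici 0)) := by
    rw [hcover, aestronglyMeasurable_iUnion_iff]
    intro k
    refine ((g k).stronglyMeasurable.comp_measurable
      (measurable_sub_const (S k))).aestronglyMeasurable.congr ?_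
    filter_upwards [ae_restrict_mem measurableSet_Ico] with r hr
    change g' k (r - S k) = g' (idx r) (r - S (idx r))
    rw [hidx k r hr]
  let h : Signal (Ici 0) E := AEEqFun.mk φ hφ
  have hhφ : ∀ᵐ r ∂(volume.restrict (Ici 0)), h r = φ r := AEEqFun.coeFn_mk _ _
  have hpos : ∀ k, 0 ≤ S k := fun k => hS0 ▸ hSm (Nat.zero_le k)
  have hhg : ∀ k, ∀ᵐ r ∂(volume.restrict (Icc 0 (τ k))), h (S k + r) = g k r := by
    intro k
    have h1 := ae_restrict_Icc_shift.2 (ae_restrict_of_ae_restrict_of_subset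
      (show Icc (S k) (S k + τ k) ⊆ Ici 0 from fun r hr => (hpos k).trans hr.1) hhφ)
    -- The right end of a piece belongs to a later piece, so it is removed as a null set.
    have h2 : ∀ᵐ r : ℝ ∂(volume.restrict (Icc 0 (τ k))), r ∈ Ico 0 (τ k) := by
      rw [← Measure.restrict_congr_set Ico_ae_eq_Icc]
      exact ae_restrict_mem measurableSet_Ico
    filter_upwards [h1, h2] with r hr hr'
    have : idx (S k + r) = k := hidx k _ ⟨by linarith [hr'.1], by rw [hSs]; linarith [hr'.2]⟩
    rw [hr]
    change g' (idx (S k + r)) (S k + r - S (idx (S k + r))) = g' k r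
    rw [this, add_sub_cancel_left]
  refine ⟨h, ⟨τ, g, hτ0, hg, hlim, hhg⟩, ?_⟩
  refine AEEqFun.ext ?_
  refine (ae_comp L h).mp ?_
  have hpieces : ∀ q : ℝ → Prop, (∀ k, ∀ᵐ r ∂(volume.restrict (Ico (S k) (S (k + 1)))), q r) →
      ∀ᵐ r ∂(volume.restrict (Ici 0)), q r := by
    intro q hq
    rw [hcover, ae_restrict_iUnion_iff]
    exact hq
  refine hpieces _ fun k => ?_
  have h3 : ∀ᵐ r ∂(volume.restrict (Icc 0 (τ k))), L (h (S k + r)) = h' (S k + r) := by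
    have hgk : ∀ᵐ r ∂(volume.restrict (Icc 0 (τ k))), f k r = L (g k r) := by
      rw [← hgf k]
      exact ae_comp L (g k)
    filter_upwards [hhg k, hh' k, hgk] with r h1 h2 h3
    rw [h1, h2, h3]
  have h4 := ae_restrict_Icc_shift (p := fun r => L (h r) = h' r).1 h3
  rw [← hSs] at h4
  filter_upwards [ae_restrict_of_ae_restrict_of_subset Ico_subset_Icc_self h4] with r hr hr'
  rw [hr', hr]

theorem IsSwitchedPair.map {n m p n' : ℕ} {M : Set (Triple n m p)} {T : SignalClass (Triple n m p)}
    {G : SignalFamily (Triple n m p)} (h : IsSwitchedPair M T G)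
    (L : Triple n m p →L[ℝ] Triple n' m p) :
    IsSwitchedPair (L '' M) (mapClass L T) (mapFamily L G) where
  bounded := L.lipschitz.isBounded_image h.bounded
  nonempty := h.nonempty.image L
  valued_class := by
    rintro _ ⟨f, hf, rfl⟩
    exact comp_mem_valuedIn L (h.valued_class hf)
  valued_family := by
    rintro t ht _ ⟨f, hf, rfl⟩
    exact comp_mem_valuedIn L (h.valued_family t ht hf)
  concat_subset := (concatClass_mapFamily_subset L G).trans (image_mono h.concat_subset)

/-! ### Reductions -/

/-- `L (A, B, C) = (J A K, J B, C K)` with `J K = 1`, where `K` embeds an invariant subspace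
containing the images of all `B`, or `J` projects along an invariant subspace contained in the
kernels of all `C`. -/
structure IsReduction {n m p n' : ℕ} (M : Set (Triple n m p)) (L : Triple n m p →L[ℝ] Triple n' m p)
    (J : Matrix (Fin n') (Fin n) ℝ) (K : Matrix (Fin n) (Fin n') ℝ) : Prop where
  apply_eq : ∀ v, L v = (J * v.1 * K, J * v.2.1, v.2.2 * K)
  mul_eq_one : J * K = 1
  compat : (∀ v ∈ M, v.1 * K = K * (J * v.1 * K) ∧ v.2.1 = K * (J * v.2.1)) ∨
    ∀ v ∈ M, J * v.1 = J * v.1 * K * J ∧ v.2.2 = v.2.2 * K * J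

/-- The linear map `X ↦ J X K`. -/
def sandwich {n n' : ℕ} (J : Matrix (Fin n') (Fin n) ℝ) (K : Matrix (Fin n) (Fin n') ℝ) :
    Matrix (Fin n) (Fin n) ℝ →L[ℝ] Matrix (Fin n') (Fin n') ℝ where
  toFun X := J * X * K
  map_add' X Y := by rw [Matrix.mul_add, Matrix.add_mul]
  map_smul' c X := by simp
  cont := by fun_prop

@[simp] theorem sandwich_apply {n n' : ℕ} (J : Matrix (Fin n') (Fin n) ℝ)
    (K : Matrix (Fin n) (Fin n') ℝ) (X : Matrix (Fin n) (Fin n) ℝ) :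
    sandwich J K X = J * X * K := rfl

/-- Solves for the reduced Gramian when the intertwining relation expresses the full Gramian through
it. -/
theorem sandwich_eq_of_eq {n n' : ℕ} {J : Matrix (Fin n') (Fin n) ℝ}
    {K : Matrix (Fin n) (Fin n') ℝ} (h : J * K = 1) {X : Matrix (Fin n) (Fin n) ℝ}
    {Y : Matrix (Fin n') (Fin n') ℝ} (hX : X = K * Y * Kᵀ) : J * X * Jᵀ = Y := by
  have h' : Kᵀ * Jᵀ = 1 := by rw [← Matrix.transpose_mul, h, Matrix.transpose_one]
  rw [hX, ← Matrix.mul_assoc, ← Matrix.mul_assoc, h, Matrix.one_mul, Matrix.mul_assoc, h',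
    Matrix.mul_one]

namespace IsReduction

variable {n m p n' : ℕ} {M : Set (Triple n m p)} {L : Triple n m p →L[ℝ] Triple n' m p}
  {J : Matrix (Fin n') (Fin n) ℝ} {K : Matrix (Fin n) (Fin n') ℝ}

theorem surjective (h : IsReduction M L J K) : Function.Surjective L := by
  intro v
  -- A right inverse of `L`, because `J * K = 1`.
  refine ⟨(K * v.1 * J, K * v.2.1, v.2.2 * J), ?_⟩
  rw [h.apply_eq]
  have e1 : J * (K * v.1 * J) * K = (J * K) * v.1 * (J * K) := by simp only [Matrix.mul_assoc]
  have e2 : J * (K * v.2.1) = (J * K) * v.2.1 := by simp only [Matrix.mul_assoc]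
  have e3 : v.2.2 * J * K = v.2.2 * (J * K) := by simp only [Matrix.mul_assoc]
  simp only [e1, e2, e3, h.mul_eq_one, Matrix.one_mul, Matrix.mul_one]

theorem projA_comp (h : IsReduction M L J K) :
    (projA n' m p).comp L = (sandwich J K).comp (projA n m p) := by
  refine ContinuousLinearMap.ext fun v => ?_
  change (L v).1 = J * v.1 * K
  rw [h.apply_eq]

theorem image_projA (h : IsReduction M L J K) :
    projA n' m p '' (L '' M) = sandwich J K '' (projA n m p '' M) := by
  have := h.projA_comp
  rw [← image_comp, ← image_comp]
  exact congrArg (fun f : Triple n m p →L[ℝ] Matrix (Fin n') (Fin n') ℝ => f '' M) this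

theorem mapFamily_projA (h : IsReduction M L J K) (G : SignalFamily (Triple n m p)) :
    mapFamily (projA n' m p) (mapFamily L G) =
      mapFamily (sandwich J K) (mapFamily (projA n m p) G) := by
  rw [mapFamily_comp, mapFamily_comp, h.projA_comp]

theorem mapClass_projA (h : IsReduction M L J K) (T : SignalClass (Triple n m p)) :
    mapClass (projA n' m p) (mapClass L T) =
      mapClass (sandwich J K) (mapClass (projA n m p) T) := by
  rw [mapClass_comp, mapClass_comp, h.projA_comp]

theorem T1_map (h : IsReduction M L J K) {T : SignalClass (Triple n m p)}
    {G : SignalFamily (Triple n m p)} (hT : T1 T G) : T1 (mapClass L T) (mapFamily L G) := by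
  unfold T1
  rw [h.mapClass_projA, h.mapFamily_projA]
  exact ⟨hT.1.map _, hT.2.map _⟩

/-- Either `K` intertwines the reduced flow with the full one or `J` intertwines the full flow with
the reduced one; `J * K = 1` gives the same formula in both cases. -/
theorem flow_eq (h : IsReduction M L J K) {t : ℝ} (ht : 0 ≤ t)
    {A : ℝ → Matrix (Fin n) (Fin n) ℝ} (hA : MemLp A ∞ (volume.restrict (Icc 0 t)))
    (hAM : ∀ᵐ s ∂(volume.restrict (Icc 0 t)), A s ∈ projA n m p '' M)
    {A' : ℝ → Matrix (Fin n') (Fin n') ℝ}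
    (hA' : ∀ᵐ s ∂(volume.restrict (Icc 0 t)), A' s = J * A s * K) :
    flow A' t 0 = J * flow A t 0 * K := by
  have hb : MemLp A' ∞ (volume.restrict (Icc 0 t)) :=
    (memLp_congr_ae hA').2 ((sandwich J K).comp_memLp' hA)
  have h0 := left_mem_Icc.2 ht
  have h1 := right_mem_Icc.2 ht
  rcases h.compat with hc | hc
  · have := mul_flow_eq_flow_mul hb hA (F := K) (by
      filter_upwards [hAM, hA'] with s hs hs'
      obtain ⟨v, hv, hvs⟩ := hs
      rw [hs', ← hvs]
      exact (hc v hv).1.symm) h0 h1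
    rw [Matrix.mul_assoc, ← this, ← Matrix.mul_assoc, h.mul_eq_one, Matrix.one_mul]
  · have := mul_flow_eq_flow_mul hA hb (F := J) (by
      filter_upwards [hAM, hA'] with s hs hs'
      obtain ⟨v, hv, hvs⟩ := hs
      rw [hs', ← hvs]
      exact (hc v hv).1) h0 h1
    rw [this, Matrix.mul_assoc, h.mul_eq_one, Matrix.mul_one]

section Signals

variable {t : ℝ} {σ : ℝ → Triple n m p} {ρ : ℝ → Triple n' m p}

theorem memLp_image {μ : Measure ℝ} (hσ : MemLp σ ∞ μ) (hρ : ∀ᵐ s ∂μ, ρ s = L (σ s)) :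
    MemLp ρ ∞ μ :=
  (memLp_congr_ae hρ).2 (L.comp_memLp' hσ)

/-- For an invariant subspace, intertwining gives the full Gramian as `K W' Kᵀ`, and `J` recovers
`W'`. For a quotient it gives `W' = J W Jᵀ` directly. -/
theorem ctrlGramian_eq (h : IsReduction M L J K) (ht : 0 ≤ t)
    (hσ : MemLp σ ∞ (volume.restrict (Icc 0 t)))
    (hσM : ∀ᵐ s ∂(volume.restrict (Icc 0 t)), σ s ∈ M)
    (hρ : ∀ᵐ s ∂(volume.restrict (Icc 0 t)), ρ s = L (σ s)) :
    ctrlGramian ρ t = J * ctrlGramian σ t * Jᵀ := by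
  have hb := memLp_image hσ hρ
  rw [ctrlGramian_eq_gram ht (memLp_fst hσ), ctrlGramian_eq_gram ht (memLp_fst hb)]
  have a1 := memLp_neg_transpose (memLp_fst hσ)
  have a2 := memLp_neg_transpose (memLp_fst hb)
  rcases h.compat with hc | hc
  · refine (sandwich_eq_of_eq h.mul_eq_one ?_).symm
    have := gram_eq_transpose_mul_gram_mul ht a1 a2 (memLp_transpose (memLp_snd_fst hb))
      (F := Kᵀ) (D := fun s => ((σ s).2.1)ᵀ)
      (by
        filter_upwards [hσM, hρ] with s hs hs'
        rw [hs', h.apply_eq, Matrix.mul_neg, Matrix.neg_mul, ← Matrix.transpose_mul,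
          ← Matrix.transpose_mul, (hc _ hs).1])
      (by
        filter_upwards [hσM, hρ] with s hs hs'
        rw [hs', h.apply_eq, ← Matrix.transpose_mul, ← (hc _ hs).2])
    rwa [Matrix.transpose_transpose] at this
  · have := gram_eq_transpose_mul_gram_mul ht a2 a1 (memLp_transpose (memLp_snd_fst hσ))
      (F := Jᵀ) (D := fun s => ((ρ s).2.1)ᵀ)
      (by
        filter_upwards [hσM, hρ] with s hs hs'
        rw [hs', h.apply_eq, Matrix.mul_neg, Matrix.neg_mul, ← Matrix.transpose_mul,
          ← Matrix.transpose_mul]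
        exact congrArg (fun X => -Xᵀ) (hc _ hs).1.symm)
      (by
        filter_upwards [hσM, hρ] with s hs hs'
        rw [hs', h.apply_eq, ← Matrix.transpose_mul])
    rwa [Matrix.transpose_transpose] at this

/-- Dual to `ctrlGramian_eq`: the subspace case is now the direct one, and in the quotient case the
full Gramian is `Jᵀ W' J`. -/
theorem obsGramian_eq (h : IsReduction M L J K) (ht : 0 ≤ t)
    (hσ : MemLp σ ∞ (volume.restrict (Icc 0 t)))
    (hσM : ∀ᵐ s ∂(volume.restrict (Icc 0 t)), σ s ∈ M)
    (hρ : ∀ᵐ s ∂(volume.restrict (Icc 0 t)), ρ s = L (σ s)) :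
    obsGramian ρ t = Kᵀ * obsGramian σ t * K := by
  have hb := memLp_image hσ hρ
  rw [obsGramian_eq_gram, obsGramian_eq_gram]
  rcases h.compat with hc | hc
  · refine gram_eq_transpose_mul_gram_mul ht (memLp_fst hb) (memLp_fst hσ) (memLp_snd_snd hσ) ?_ ?_
    · filter_upwards [hσM, hρ] with s hs hs'
      rw [hs', h.apply_eq, ← (hc _ hs).1]
    · filter_upwards [hρ] with s hs'
      rw [hs', h.apply_eq]
  · have := gram_eq_transpose_mul_gram_mul ht (memLp_fst hσ) (memLp_fst hb) (memLp_snd_snd hb)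
      (F := J) (D := fun s => (σ s).2.2)
      (by
        filter_upwards [hσM, hρ] with s hs hs'
        rw [hs', h.apply_eq, ← (hc _ hs).1])
      (by
        filter_upwards [hσM, hρ] with s hs hs'
        rw [hs', h.apply_eq, ← (hc _ hs).2])
    have hKJ : Kᵀ * Jᵀ = 1 := by rw [← Matrix.transpose_mul, h.mul_eq_one, Matrix.transpose_one]
    have e := sandwich_eq_of_eq hKJ (X := gram (fun s => (σ s).1) (fun s => (σ s).2.2) t)
      (by rw [Matrix.transpose_transpose]; exact this)
    rw [Matrix.transpose_transpose] at e
    exact e.symm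

end Signals

/-- A piecewise constant signal lifts to `M`, the path is taken there and its image is used. Flows
transform by the fixed linear map `sandwich J K`, which preserves analyticity. -/
theorem A4_map (h : IsReduction M L J K) (hM : Bornology.IsBounded M)
    {F : SignalFamily (Matrix (Fin n) (Fin n) ℝ)} (hA : A4 (projA n m p '' M) F) :
    A4 (sandwich J K '' (projA n m p '' M)) (mapFamily (sandwich J K) F) := by
  have hMA : Bornology.IsBounded (projA n m p '' M) := (projA n m p).lipschitz.isBounded_image hM
  obtain ⟨C, hC, hbound⟩ := (sandwich J K).bound
  intro t ε ht hε A' hA'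
  obtain ⟨A, hApc, hAA'⟩ := exists_pc_lift (sandwich J K) hA'
  -- The linear map magnifies errors by at most `C`.
  obtain ⟨τ, a, h1, h2, h3, h4⟩ := hA t (ε / C) ht (by positivity) A hApc
  have hflow : ∀ l ∈ Ioc (0 : ℝ) 1, flow (AEEqFun.comp (sandwich J K) (sandwich J K).continuous (a l))
      (τ l) 0 = sandwich J K (flow (a l) (τ l) 0) := fun l hl =>
    h.flow_eq (h1 l hl).1.le (memLp_of_mem_arbFamily hMA (h1 l hl).2) (h1 l hl).2
      (ae_comp (sandwich J K) (a l))
  have harb := pcFamily_subset_arbFamily _ t hApc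
  have hflow' : flow A' t 0 = sandwich J K (flow A t 0) :=
    h.flow_eq ht.le (memLp_of_mem_arbFamily hMA harb) harb hAA'
  refine ⟨τ, fun l => AEEqFun.comp (sandwich J K) (sandwich J K).continuous (a l),
    fun l hl => ⟨(h1 l hl).1, comp_mem_valuedIn _ (h1 l hl).2⟩, ?_, ?_, ?_⟩
  · exact ((sandwich J K).comp_analyticOn h2).congr hflow
  · rw [hflow 1 ⟨one_pos, le_rfl⟩, hflow', ← map_sub]
    refine (hbound _).trans ?_
    rw [← le_div_iff₀' hC]
    exact h3
  · exact h4.mono (interior_mono fun l hl => ⟨hl.1, mem_image_of_mem _ hl.2⟩)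

/-- Lift, deform and project as in `A4_map`. The two Gramians transform by different linear maps, so
the tolerance is the smaller of two quotients. -/
theorem T2_map (h : IsReduction M L J K) (hM : Bornology.IsBounded M)
    {G : SignalFamily (Triple n m p)} (hG : T2 M G) : T2 (L '' M) (mapFamily L G) := by
  refine ⟨?_, ?_⟩
  · rw [h.image_projA, h.mapFamily_projA]
    exact h.A4_map hM hG.1
  obtain ⟨C, hC, hbound⟩ := (sandwich J Jᵀ).bound
  obtain ⟨C', hC', hbound'⟩ := (sandwich Kᵀ K).bound
  intro t ε ht hε σ' hσ'
  obtain ⟨σ, hσ, hσσ'⟩ := exists_pc_lift L hσ'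
  obtain ⟨τ, a, h1, h2, h3, h4, h5⟩ := hG.2 t (min (ε / C) (ε / C')) ht (by positivity) σ hσ
  have hb : ∀ l ∈ Icc (0 : ℝ) 1, MemLp (a l) ∞ (volume.restrict (Icc 0 (τ l))) := fun l hl =>
    memLp_of_mem_arbFamily hM (h1 l hl).2
  have hc : ∀ l ∈ Icc (0 : ℝ) 1, ctrlGramian (AEEqFun.comp L L.continuous (a l)) (τ l) =
      sandwich J Jᵀ (ctrlGramian (a l) (τ l)) := fun l hl =>
    h.ctrlGramian_eq (h1 l hl).1.le (hb l hl) (h1 l hl).2 (ae_comp L (a l))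
  have ho : ∀ l ∈ Icc (0 : ℝ) 1, obsGramian (AEEqFun.comp L L.continuous (a l)) (τ l) =
      sandwich Kᵀ K (obsGramian (a l) (τ l)) := fun l hl =>
    h.obsGramian_eq (h1 l hl).1.le (hb l hl) (h1 l hl).2 (ae_comp L (a l))
  have harb := pcFamily_subset_arbFamily _ t hσ
  have hbσ := memLp_of_mem_arbFamily hM harb
  have hcσ : ctrlGramian σ' t = sandwich J Jᵀ (ctrlGramian σ t) :=
    h.ctrlGramian_eq ht.le hbσ harb hσσ'
  have hoσ : obsGramian σ' t = sandwich Kᵀ K (obsGramian σ t) :=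
    h.obsGramian_eq ht.le hbσ harb hσσ'
  have one_mem : (1 : ℝ) ∈ Icc (0 : ℝ) 1 := ⟨zero_le_one, le_rfl⟩
  refine ⟨τ, fun l => AEEqFun.comp L L.continuous (a l),
    fun l hl => ⟨(h1 l hl).1, comp_mem_valuedIn _ (h1 l hl).2⟩, ?_, ?_, ?_, ?_⟩
  · refine (((sandwich J Jᵀ).prodMap (sandwich Kᵀ K)).comp_analyticOn h2).congr fun l hl => ?_
    exact Prod.ext (hc l hl) (ho l hl)
  · rw [hc 1 one_mem, hcσ, ← map_sub]
    refine (hbound _).trans ?_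
    rw [← le_div_iff₀' hC]
    exact h3.trans (min_le_left _ _)
  · rw [ho 1 one_mem, hoσ, ← map_sub]
    refine (hbound' _).trans ?_
    rw [← le_div_iff₀' hC']
    exact h4.trans (min_le_right _ _)
  · exact h5.mono (interior_mono fun l hl => ⟨hl.1, mem_image_of_mem _ hl.2⟩)

end IsReduction

/-! ### The gain of a reduced system -/

section

variable {n m p : ℕ} {σ : ℝ → Triple n m p} {u : ℝ → EuclideanSpace ℝ (Fin m)} {x₀ : Fin n → ℝ}
  {x : ℝ → Fin n → ℝ}

theorem IsTrajectory.mono {I I' : Set ℝ} (hx : IsTrajectory σ u x₀ I x) (h : I' ⊆ I) :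
    IsTrajectory σ u x₀ I' x :=
  ⟨hx.1.mono h, fun r hr => hx.2 r (h hr)⟩

theorem IsTrajectory.congr_curve {t : ℝ} (ht : 0 ≤ t) (hx : IsTrajectory σ u x₀ (Icc 0 t) x)
    {y : ℝ → Fin n → ℝ} (hy : EqOn y x (Icc 0 t)) : IsTrajectory σ u x₀ (Icc 0 t) y := by
  refine ⟨hx.1.congr hy, fun r hr => ?_⟩
  have key : EqOn (fun s => (σ s).1 *ᵥ y s + (σ s).2.1 *ᵥ (u s).ofLp)
      (fun s => (σ s).1 *ᵥ x s + (σ s).2.1 *ᵥ (u s).ofLp) (uIcc 0 r) := fun s hs => by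
    beta_reduce
    rw [hy (uIcc_subset_Icc (left_mem_Icc.2 ht) hr hs)]
  rw [hy hr, intervalIntegral.integral_congr key]
  exact ⟨(hx.2 r hr).1.congr (key.symm.mono uIoc_subset_uIcc), (hx.2 r hr).2⟩

theorem isTrajectory_Ici_iff :
    IsTrajectory σ u x₀ (Ici 0) x ↔ ∀ N : ℕ, IsTrajectory σ u x₀ (Icc 0 (N : ℝ)) x := by
  refine ⟨fun h N => h.mono Icc_subset_Ici_self, fun h => ⟨fun t ht => ?_, fun t ht => ?_⟩⟩
  · obtain ⟨N, hN⟩ := exists_nat_gt t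
    refine ((h N).1 t ⟨ht, hN.le⟩).mono_of_mem_nhdsWithin ?_
    rw [← Ici_inter_Iic]
    exact inter_mem_nhdsWithin _ (Iic_mem_nhds hN)
  · obtain ⟨N, hN⟩ := exists_nat_gt t
    exact (h N).2 t ⟨ht, hN.le⟩

theorem memLp_Icc_of_Ici {E : Type*} [NormedAddCommGroup E] {f : ℝ → E} {q : ℝ≥0∞} (t : ℝ)
    (hf : MemLp f q (volume.restrict (Ici 0))) : MemLp f q (volume.restrict (Icc 0 t)) :=
  hf.mono_measure (Measure.restrict_mono Icc_subset_Ici_self le_rfl)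

theorem exists_isTrajectory_Ici (hσ : MemLp σ ∞ (volume.restrict (Ici 0)))
    (hu : MemLp u 2 (volume.restrict (Ici 0))) (x₀ : Fin n → ℝ) :
    ∃ x, IsTrajectory σ u x₀ (Ici 0) x := by
  have hex : ∀ N : ℕ, ∃ x, IsTrajectory σ u x₀ (Icc 0 (N : ℝ)) x := fun N =>
    exists_isTrajectory N.cast_nonneg (memLp_Icc_of_Ici _ hσ) (memLp_Icc_of_Ici _ hu) x₀
  choose X hX using hex
  -- Solutions on `[0, N]` are glued by using at time `t` the one up to the least integer above `t`;
  -- uniqueness makes them agree on common intervals.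
  refine ⟨fun t => X ⌈t⌉₊ t, isTrajectory_Ici_iff.2 fun N =>
    (hX N).congr_curve N.cast_nonneg fun t ht => ?_⟩
  have hle : ⌈t⌉₊ ≤ N := Nat.ceil_le.2 ht.2
  exact (hX ⌈t⌉₊).eqOn (Nat.cast_nonneg _) (memLp_Icc_of_Ici _ hσ) (memLp_Icc_of_Ici _ hu)
    ((hX N).mono (Icc_subset_Icc_right (by exact_mod_cast hle))) ⟨ht.1, Nat.le_ceil t⟩

theorem IsTrajectory.eqOn_Ici (hσ : MemLp σ ∞ (volume.restrict (Ici 0)))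
    (hu : MemLp u 2 (volume.restrict (Ici 0))) {y : ℝ → Fin n → ℝ}
    (hx : IsTrajectory σ u x₀ (Ici 0) x) (hy : IsTrajectory σ u x₀ (Ici 0) y) :
    EqOn x y (Ici 0) := fun t ht =>
  (hx.mono Icc_subset_Ici_self).eqOn ht (memLp_Icc_of_Ici t hσ) (memLp_Icc_of_Ici t hu)
    (hy.mono Icc_subset_Ici_self) (right_mem_Icc.2 ht)

/-- Images of trajectories under intertwining maps are trajectories. -/
theorem IsTrajectory.map_Ici {n' : ℕ} {ρ : ℝ → Triple n' m p}
    (hσ : MemLp σ ∞ (volume.restrict (Ici 0))) (hρ : MemLp ρ ∞ (volume.restrict (Ici 0)))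
    (hu : MemLp u 2 (volume.restrict (Ici 0))) (hx : IsTrajectory σ u x₀ (Ici 0) x)
    {F : Matrix (Fin n') (Fin n) ℝ} (h : ∀ᵐ s ∂(volume.restrict (Ici 0)),
      F * (σ s).1 = (ρ s).1 * F ∧ F * (σ s).2.1 = (ρ s).2.1) :
    IsTrajectory ρ u (F *ᵥ x₀) (Ici 0) (fun t => F *ᵥ x t) := by
  refine isTrajectory_Ici_iff.2 fun N => ?_
  have hN : (0 : ℝ) ≤ N := N.cast_nonneg
  have hσN := memLp_Icc_of_Ici N hσ
  have huN := memLp_Icc_of_Ici N hu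
  rw [isTrajectory_iff hN (memLp_Icc_of_Ici N hρ) huN]
  refine ((isTrajectory_iff hN hσN huN).1 (hx.mono Icc_subset_Ici_self)).map (left_mem_Icc.2 hN)
    (memLp_mulVecCLM (memLp_fst hσN)) (integrableOn_input hσN huN) (mulVecCLM n' n F) ?_
  filter_upwards [ae_restrict_of_ae_restrict_of_subset Icc_subset_Ici_self h] with s hs
  simp only [mulVecCLM_apply, Matrix.mulVec_add, Matrix.mulVec_mulVec, hs.1, hs.2]

end

namespace IsReduction

variable {n m p n' : ℕ} {M : Set (Triple n m p)} {L : Triple n m p →L[ℝ] Triple n' m p}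
  {J : Matrix (Fin n') (Fin n) ℝ} {K : Matrix (Fin n) (Fin n') ℝ}

/-- A system and its reduction have the same output. -/
theorem output_eq (h : IsReduction M L J K) {σ : ℝ → Triple n m p} {ρ : ℝ → Triple n' m p}
    (hσ : MemLp σ ∞ (volume.restrict (Ici 0)))
    (hσM : ∀ᵐ s ∂(volume.restrict (Ici 0)), σ s ∈ M)
    (hρ : ∀ᵐ s ∂(volume.restrict (Ici 0)), ρ s = L (σ s)) {u : ℝ → EuclideanSpace ℝ (Fin m)}
    (hu : MemLp u 2 (volume.restrict (Ici 0))) {x : ℝ → Fin n → ℝ} {y : ℝ → Fin n' → ℝ}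
    (hx : IsTrajectory σ u 0 (Ici 0) x) (hy : IsTrajectory ρ u 0 (Ici 0) y) :
    ∀ᵐ s ∂(volume.restrict (Ici 0)), (σ s).2.2 *ᵥ x s = (ρ s).2.2 *ᵥ y s := by
  have hb := memLp_image hσ hρ
  rcases h.compat with hc | hc
  · have hKy := hy.map_Ici hb hσ hu (F := K) (by
      filter_upwards [hσM, hρ] with s hs hs'
      rw [hs', h.apply_eq]
      exact ⟨(hc _ hs).1.symm, (hc _ hs).2.symm⟩)
    rw [Matrix.mulVec_zero] at hKy
    have heq := hx.eqOn_Ici hσ hu hKy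
    filter_upwards [hρ, ae_restrict_mem measurableSet_Ici] with s hs hs'
    rw [heq hs', hs, h.apply_eq, Matrix.mulVec_mulVec]
  · have hJx := hx.map_Ici hσ hb hu (F := J) (by
      filter_upwards [hσM, hρ] with s hs hs'
      rw [hs', h.apply_eq]
      exact ⟨(hc _ hs).1, rfl⟩)
    rw [Matrix.mulVec_zero] at hJx
    have heq := hy.eqOn_Ici hb hu hJx
    filter_upwards [hσM, hρ, ae_restrict_mem measurableSet_Ici] with s hs hs' hs0
    rw [heq hs0, hs', h.apply_eq, Matrix.mulVec_mulVec, ← (hc _ hs).2]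

/-- The two sets of ratios coincide: for a law and its image, trajectories exist on both sides for
every input, and their outputs agree almost everywhere. -/
theorem gain_eq (h : IsReduction M L J K) (hM : Bornology.IsBounded M)
    {T : SignalClass (Triple n m p)} (hT : T ⊆ valuedIn (Ici 0) M) :
    gain T = gain (mapClass L T) := by
  obtain ⟨C, hC⟩ := hM.exists_norm_le
  have hbd : ∀ σ ∈ T, MemLp σ ∞ (volume.restrict (Ici 0)) := fun σ hσ => by
    have hσM : ∀ᵐ s ∂(volume.restrict (Ici 0)), σ s ∈ M := hT hσ
    exact memLp_top_of_bound σ.aestronglyMeasurable C (hσM.mono fun s hs => hC _ hs)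
  have hout : ∀ σ ∈ T, ∀ {u : ℝ → EuclideanSpace ℝ (Fin m)},
      MemLp u 2 (volume.restrict (Ici 0)) → ∀ {x : ℝ → Fin n → ℝ} {y : ℝ → Fin n' → ℝ},
      IsTrajectory σ u 0 (Ici 0) x →
      IsTrajectory (AEEqFun.comp L L.continuous σ) u 0 (Ici 0) y →
      eLpNorm (fun t => (WithLp.toLp 2 ((σ t).2.2 *ᵥ x t) : EuclideanSpace ℝ (Fin p))) 2
        (volume.restrict (Ici 0)) =
      eLpNorm (fun t => (WithLp.toLp 2 ((AEEqFun.comp L L.continuous σ t).2.2 *ᵥ y t) :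
        EuclideanSpace ℝ (Fin p))) 2 (volume.restrict (Ici 0)) := by
    intro σ hσ u hu x y hx hy
    refine eLpNorm_congr_ae ?_
    filter_upwards [h.output_eq (hbd σ hσ) (hT hσ) (ae_comp L σ) hu hx hy] with s hs
    rw [hs]
  refine congrArg sSup (Set.ext fun g => ⟨?_, ?_⟩)
  · rintro ⟨σ, hσ, u, x, hu, hu0, hx, rfl⟩
    obtain ⟨y, hy⟩ := exists_isTrajectory_Ici
      (memLp_image (hbd σ hσ) (ae_comp L σ)) hu 0
    exact ⟨_, mem_image_of_mem _ hσ, u, y, hu, hu0, hy, by rw [hout σ hσ hu hx hy]⟩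
  · rintro ⟨_, ⟨σ, hσ, rfl⟩, u, y, hu, hu0, hy, rfl⟩
    obtain ⟨x, hx⟩ := exists_isTrajectory_Ici (hbd σ hσ) hu 0
    exact ⟨σ, hσ, u, x, hu, hu0, hx, by rw [hout σ hσ hu hx hy]⟩

end IsReduction

/-! ### Controllability and observability from analytic propagation -/

theorem analyticOn_det {n : ℕ} {g : ℝ → Matrix (Fin n) (Fin n) ℝ} {s : Set ℝ}
    (hg : AnalyticOn ℝ g s) : AnalyticOn ℝ (fun l => (g l).det) s := by
  have hentry : ∀ i j, AnalyticOn ℝ (fun l => g l i j) s := fun i j =>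
    (LinearMap.toContinuousLinearMap (Matrix.entryLinearMap ℝ ℝ i j)).comp_analyticOn hg
  simp only [Matrix.det_apply']
  exact Finset.analyticOn_fun_sum _ fun τ _ =>
    analyticOn_const.mul (Finset.analyticOn_fun_prod _ fun i _ => hentry _ _)

/-- Vanishing on an open set of parameters would spread over `(0, 1)` by the identity theorem. -/
theorem exists_ne_zero_of_analyticOn {f : ℝ → ℝ} (hf : AnalyticOn ℝ f (Icc 0 1)) (h1 : f 1 ≠ 0)
    {U : Set ℝ} (hU : U ⊆ Icc 0 1) (hne : (interior U).Nonempty) : ∃ l ∈ U, f l ≠ 0 := by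
  by_contra! hcon
  obtain ⟨z, hz⟩ := hne
  have hsub : interior U ⊆ Ioo 0 1 := by
    rw [← interior_Icc]
    exact interior_mono hU
  have hf' : AnalyticOnNhd ℝ f (Ioo 0 1) :=
    isOpen_Ioo.analyticOn_iff_analyticOnNhd.1 (hf.mono Ioo_subset_Icc_self)
  have h0 : EqOn f 0 (Ioo 0 1) := hf'.eqOn_zero_of_preconnected_of_eventuallyEq_zero
    isPreconnected_Ioo (hsub hz) (by
      filter_upwards [mem_interior_iff_mem_nhds.1 (mem_interior.2
        ⟨interior U, subset_rfl, isOpen_interior, hz⟩)] with l hl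
      exact hcon l (interior_subset hl))
  -- At the endpoint analyticity holds only relative to the interval, so the value at `1` is reached
  -- by continuity.
  have hcl : EqOn f 0 (Icc 0 1) := by
    refine h0.of_subset_closure hf.continuousOn continuousOn_const Ioo_subset_Icc_self ?_
    rw [closure_Ioo zero_ne_one]
  exact h1 (hcl ⟨zero_le_one, le_rfl⟩)

theorem exists_pos_forall_det_ne_zero {n : ℕ} {X : Matrix (Fin n) (Fin n) ℝ} (hX : X.det ≠ 0) :
    ∃ ε > 0, ∀ Y : Matrix (Fin n) (Fin n) ℝ, ‖Y - X‖ ≤ ε → Y.det ≠ 0 := by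
  have hc : Continuous fun Y : Matrix (Fin n) (Fin n) ℝ => Y.det := continuous_id.matrix_det
  obtain ⟨ε, hε, h⟩ := Metric.nhds_basis_closedBall.mem_iff.1
    (hc.continuousAt.eventually_ne hX)
  exact ⟨ε, hε, fun Y hY => h (mem_closedBall_iff_norm.2 hY)⟩

variable {n m p : ℕ} {M : Set (Triple n m p)} {G : SignalFamily (Triple n m p)}

/-- Some piecewise constant law has nonsingular Gramian. A small tolerance in T2 keeps the
determinant nonzero at `λ = 1`, so by analyticity it is nonzero for some law of the path lying in
`G`. -/
theorem isControllable_of_T2 (hM : Bornology.IsBounded M) (hne : M.Nonempty) (hG : T2 M G)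
    (h0 : unctrl M = ⊥) : IsControllable G := by
  obtain ⟨t, ht, σ, hσ, hker⟩ := exists_pc_ctrlGramian hM hne
  have hdet : (ctrlGramian σ t).det ≠ 0 := fun hd => by
    obtain ⟨v, hv, hv0⟩ := Matrix.exists_mulVec_eq_zero_iff.2 hd
    have := hker v hv0
    rw [h0] at this
    exact hv this
  obtain ⟨ε, hε, hdet'⟩ := exists_pos_forall_det_ne_zero hdet
  obtain ⟨τ, a, h1, h2, h3, -, h5⟩ := hG.2 t ε ht hε σ hσ
  have h6 : AnalyticOn ℝ (fun l => ctrlGramian (a l) (τ l)) (Icc 0 1) :=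
    (ContinuousLinearMap.fst ℝ (Matrix (Fin n) (Fin n) ℝ) (Matrix (Fin n) (Fin n) ℝ)).comp_analyticOn h2
  obtain ⟨l, hl, hld⟩ := exists_ne_zero_of_analyticOn (analyticOn_det h6) (hdet' _ h3)
    (fun l hl => hl.1) h5
  exact isControllable_of_ctrlGramian (h1 l hl.1).1.le hl.2
    (memLp_of_mem_arbFamily hM (h1 l hl.1).2) hld

/-- The same argument on the other component of the analytic path. -/
theorem isObservable_of_T2 (hM : Bornology.IsBounded M) (hne : M.Nonempty) (hG : T2 M G)
    (h0 : unobs M = ⊥) : IsObservable G := by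
  obtain ⟨t, ht, σ, hσ, hker⟩ := exists_pc_obsGramian hM hne
  have hdet : (obsGramian σ t).det ≠ 0 := fun hd => by
    obtain ⟨v, hv, hv0⟩ := Matrix.exists_mulVec_eq_zero_iff.2 hd
    have := hker v hv0
    rw [h0] at this
    exact hv this
  obtain ⟨ε, hε, hdet'⟩ := exists_pos_forall_det_ne_zero hdet
  obtain ⟨τ, a, h1, h2, -, h4, h5⟩ := hG.2 t ε ht hε σ hσ
  have h6 : AnalyticOn ℝ (fun l => obsGramian (a l) (τ l)) (Icc 0 1) :=
    (ContinuousLinearMap.snd ℝ (Matrix (Fin n) (Fin n) ℝ) (Matrix (Fin n) (Fin n) ℝ)).comp_analyticOn h2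
  obtain ⟨l, hl, hld⟩ := exists_ne_zero_of_analyticOn (analyticOn_det h6) (hdet' _ h4)
    (fun l hl => hl.1) h5
  exact isObservable_of_obsGramian (h1 l hl.1).1.le hl.2
    (memLp_of_mem_arbFamily hM (h1 l hl.1).2) hld

/-! ### Adapted bases -/

theorem truncation_mulVec {r n : ℕ} (hr : r ≤ n) (z : Fin n → ℝ) (i : Fin r) :
    (truncation r n *ᵥ z) i = z (Fin.castLE hr i) := by
  rw [Matrix.mulVec, dotProduct, Finset.sum_eq_single (Fin.castLE hr i)]
  · simp [truncation]
  · intro j _ hj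
    have : (i : ℕ) ≠ (j : ℕ) := fun h => hj (Fin.ext h.symm)
    simp [truncation, this]
  · simp

theorem truncation_mul_transpose {r n : ℕ} (hr : r ≤ n) :
    truncation r n * (truncation r n)ᵀ = 1 := by
  ext i j
  have h := truncation_mulVec hr (fun k => (truncation r n)ᵀ k j) i
  change (truncation r n *ᵥ fun k => (truncation r n)ᵀ k j) i = _
  rw [h, Matrix.one_apply]
  simp [truncation, Fin.ext_iff, eq_comm]

theorem truncation_mulVec_eq_zero {r n : ℕ} (hr : r ≤ n) (z : Fin n → ℝ) :
    truncation r n *ᵥ z = 0 ↔ ∀ i : Fin n, (i : ℕ) < r → z i = 0 := by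
  refine ⟨fun h i hi => ?_, fun h => funext fun i => ?_⟩
  · have := congrFun h ⟨i, hi⟩
    rwa [truncation_mulVec hr] at this
  · rw [truncation_mulVec hr]
    exact h _ i.2

theorem truncation_transpose_mulVec_eq_zero {r n : ℕ} (w : Fin r → ℝ) {i : Fin n}
    (hi : r ≤ (i : ℕ)) : ((truncation r n)ᵀ *ᵥ w) i = 0 := by
  rw [Matrix.mulVec, dotProduct]
  refine Finset.sum_eq_zero fun j _ => ?_
  have : (j : ℕ) ≠ (i : ℕ) := by omega
  simp [truncation, this]

theorem truncation_transpose_mulVec_mulVec {r n : ℕ} (hr : r ≤ n) {z : Fin n → ℝ}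
    (hz : ∀ i : Fin n, r ≤ (i : ℕ) → z i = 0) :
    (truncation r n)ᵀ *ᵥ (truncation r n *ᵥ z) = z := by
  refine sub_eq_zero.1 (funext fun i => ?_)
  by_cases hi : (i : ℕ) < r
  · refine (truncation_mulVec_eq_zero hr _).1 ?_ i hi
    rw [Matrix.mulVec_sub, Matrix.mulVec_mulVec _ (truncation r n) (truncation r n)ᵀ,
      truncation_mul_transpose hr, Matrix.one_mulVec, sub_self]
  · have hi' : r ≤ (i : ℕ) := not_lt.1 hi
    rw [Pi.sub_apply, truncation_transpose_mulVec_eq_zero _ hi', hz i hi', sub_zero, Pi.zero_apply]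

theorem exists_matrix_of_basis {n : ℕ} (b : Module.Basis (Fin n) ℝ (Fin n → ℝ)) :
    ∃ P : Matrix (Fin n) (Fin n) ℝ, IsUnit P ∧ ∀ z, P⁻¹ *ᵥ z = b.repr z := by
  have h := Module.Basis.toMatrix_mul_toMatrix_flip b (Pi.basisFun ℝ (Fin n))
  have h' := Module.Basis.toMatrix_mul_toMatrix_flip (Pi.basisFun ℝ (Fin n)) b
  refine ⟨(Pi.basisFun ℝ (Fin n)).toMatrix b, IsUnit.of_mul_eq_one _ h', fun z => ?_⟩
  rw [Matrix.inv_eq_left_inv h]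
  exact Module.Basis.toMatrix_mulVec_repr (Pi.basisFun ℝ (Fin n)) b z

/-- The columns of `P` are a basis of `V` followed by one of `W`, with `r` the dimension of `V`. The
first description serves reachable bases, the second observable ones. -/
theorem exists_adapted_matrix {n : ℕ} {V W : Submodule ℝ (Fin n → ℝ)} (h : IsCompl V W) :
    ∃ r ≤ n, ∃ P : Matrix (Fin n) (Fin n) ℝ, IsUnit P ∧
      (V : Set (Fin n → ℝ)) = {z | ∀ i : Fin n, r ≤ (i : ℕ) → (P⁻¹ *ᵥ z) i = 0} ∧
      (W : Set (Fin n → ℝ)) = {z | ∀ i : Fin n, (i : ℕ) < r → (P⁻¹ *ᵥ z) i = 0} := by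
  have hn : Module.finrank ℝ V + Module.finrank ℝ W = n := by
    rw [Submodule.finrank_add_eq_of_isCompl h, Module.finrank_fin_fun]
  let b₀ := ((Module.finBasis ℝ V).prod (Module.finBasis ℝ W)).map
    (Submodule.prodEquivOfIsCompl V W h)
  let e := finSumFinEquiv.trans (finCongr hn)
  obtain ⟨P, hP, hPb⟩ := exists_matrix_of_basis (b₀.reindex e)
  have hrepr : ∀ z j, (P⁻¹ *ᵥ z) (e j) = b₀.repr z j := fun z j => by
    rw [hPb, Module.Basis.repr_reindex_apply, Equiv.symm_apply_apply]
  refine ⟨Module.finrank ℝ V, by omega, P, hP, ?_, ?_⟩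
  · ext z
    rw [SetLike.mem_coe, ← Submodule.prodEquivOfIsCompl_symm_apply_snd_eq_zero V W h,
      ← (Module.finBasis ℝ W).forall_coord_eq_zero_iff]
    refine ⟨fun hz i hi => ?_, fun hz j => ?_⟩
    · obtain ⟨j, rfl⟩ := e.surjective i
      rcases j with j | j
      · simp [e] at hi
        omega
      · rw [hrepr]
        exact hz j
    · have := hz (e (Sum.inr j)) (by simp [e])
      rwa [hrepr] at this
  · ext z
    rw [SetLike.mem_coe, ← Submodule.prodEquivOfIsCompl_symm_apply_fst_eq_zero V W h,
      ← (Module.finBasis ℝ V).forall_coord_eq_zero_iff]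
    refine ⟨fun hz i hi => ?_, fun hz j => ?_⟩
    · obtain ⟨j, rfl⟩ := e.surjective i
      rcases j with j | j
      · rw [hrepr]
        exact hz j
      · simp [e] at hi
    · have := hz (e (Sum.inl j)) (by simp [e])
      rwa [hrepr] at this

/-! ### The two steps of a minimal realization -/

section

variable {n m p r : ℕ} {M : Set (Triple n m p)} {P : Matrix (Fin n) (Fin n) ℝ}

theorem truncation_mul_inv_mul_eq_one (hr : r ≤ n) (hP : IsUnit P) :
    truncation r n * P⁻¹ * (P * (truncation r n)ᵀ) = 1 := by
  rw [Matrix.mul_assoc, ← Matrix.mul_assoc P⁻¹,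
    Matrix.nonsing_inv_mul P ((Matrix.isUnit_iff_isUnit_det P).1 hP), Matrix.one_mul,
    truncation_mul_transpose hr]

theorem reduction_apply (v : Triple n m p) :
    reduction m p r P v = (truncation r n * P⁻¹ * v.1 * (P * (truncation r n)ᵀ),
      truncation r n * P⁻¹ * v.2.1, v.2.2 * (P * (truncation r n)ᵀ)) := by
  change (_, _, _) = _
  simp only [Matrix.mul_assoc]

theorem mem_reachSubspace_iff (hM : Bornology.IsBounded M) (hne : M.Nonempty)
    (h : IsReachableBasis M r P) (z : Fin n → ℝ) :
    z ∈ reachSubspace M ↔ ∀ i : Fin n, r ≤ (i : ℕ) → (P⁻¹ *ᵥ z) i = 0 := by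
  have := h.2.2
  rw [reachableSet_arbFamily hM hne] at this
  exact Set.ext_iff.1 this z

theorem mem_unobs_iff (hM : Bornology.IsBounded M) (hne : M.Nonempty)
    (h : IsObservableBasis M r P) (z : Fin n → ℝ) :
    z ∈ unobs M ↔ (truncation r n * P⁻¹) *ᵥ z = 0 := by
  have := h.2.2
  rw [compl_observableSet_arbFamily hM hne] at this
  rw [← Matrix.mulVec_mulVec, truncation_mulVec_eq_zero h.1]
  exact Set.ext_iff.1 this z

theorem mulVec_mem_reachSubspace_of_basis (hM : Bornology.IsBounded M) (hne : M.Nonempty)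
    (h : IsReachableBasis M r P) (w : Fin r → ℝ) :
    (P * (truncation r n)ᵀ) *ᵥ w ∈ reachSubspace M := by
  rw [mem_reachSubspace_iff hM hne h]
  intro i hi
  rw [Matrix.mulVec_mulVec, ← Matrix.mul_assoc,
    Matrix.nonsing_inv_mul P ((Matrix.isUnit_iff_isUnit_det P).1 h.2.1), Matrix.one_mul]
  exact truncation_transpose_mulVec_eq_zero w hi

theorem mulVec_mulVec_of_mem_reachSubspace (hM : Bornology.IsBounded M) (hne : M.Nonempty)
    (h : IsReachableBasis M r P) {z : Fin n → ℝ} (hz : z ∈ reachSubspace M) :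
    (P * (truncation r n)ᵀ) *ᵥ ((truncation r n * P⁻¹) *ᵥ z) = z := by
  rw [← Matrix.mulVec_mulVec, ← Matrix.mulVec_mulVec,
    truncation_transpose_mulVec_mulVec h.1 ((mem_reachSubspace_iff hM hne h z).1 hz),
    Matrix.mulVec_mulVec, Matrix.mul_nonsing_inv P ((Matrix.isUnit_iff_isUnit_det P).1 h.2.1),
    Matrix.one_mulVec]

/-- `K * J` is the identity on the reachable subspace, which contains the images of `v.1 * K` and of
`v.2.1`. -/
theorem compat_of_mem_reachSubspace {J : Matrix (Fin r) (Fin n) ℝ} {K : Matrix (Fin n) (Fin r) ℝ}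
    (hK : ∀ w, K *ᵥ w ∈ reachSubspace M) (hfix : ∀ z ∈ reachSubspace M, K *ᵥ (J *ᵥ z) = z)
    {v : Triple n m p} (hv : v ∈ M) :
    v.1 * K = K * (J * v.1 * K) ∧ v.2.1 = K * (J * v.2.1) := by
  refine ⟨?_, ?_⟩ <;> refine Matrix.ext_of_mulVec_single fun j => ?_
  · rw [Matrix.mul_assoc J]
    simp only [← Matrix.mulVec_mulVec]
    exact (hfix _ (mulVec_mem_reachSubspace hv (hK _))).symm
  · simp only [← Matrix.mulVec_mulVec]
    exact (hfix _ (mulVec_input_mem_reachSubspace hv _)).symm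

/-- As `J * K = 1`, every `w - K (J w)` lies in `ker J`, the unobservable subspace. There `v.2.2`
vanishes, and `J * v.1` vanishes by invariance. -/
theorem compat_of_mem_unobs {J : Matrix (Fin r) (Fin n) ℝ} {K : Matrix (Fin n) (Fin r) ℝ}
    (hJK : J * K = 1) (hJ : ∀ z, z ∈ unobs M ↔ J *ᵥ z = 0) {v : Triple n m p} (hv : v ∈ M) :
    J * v.1 = J * v.1 * K * J ∧ v.2.2 = v.2.2 * K * J := by
  have hmem : ∀ w, w - K *ᵥ (J *ᵥ w) ∈ unobs M := fun w => by
    rw [hJ, Matrix.mulVec_sub, Matrix.mulVec_mulVec _ _ K, hJK, Matrix.one_mulVec, sub_self]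
  refine ⟨?_, ?_⟩ <;> refine Matrix.ext_of_mulVec_single fun j => ?_
  · have := (hJ _).1 (mulVec_mem_unobs hv (hmem (Pi.single j 1))).1
    rw [Matrix.mulVec_sub, Matrix.mulVec_sub, sub_eq_zero] at this
    simpa only [← Matrix.mulVec_mulVec] using this
  · have := (mulVec_mem_unobs hv (hmem (Pi.single j 1))).2
    rw [Matrix.mulVec_sub, sub_eq_zero] at this
    simpa only [← Matrix.mulVec_mulVec] using this

theorem IsReachableBasis.isReduction (h : IsReachableBasis M r P) (hM : Bornology.IsBounded M)
    (hne : M.Nonempty) : IsReduction M (reduction m p r P) (truncation r n * P⁻¹)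
      (P * (truncation r n)ᵀ) where
  apply_eq := reduction_apply
  mul_eq_one := truncation_mul_inv_mul_eq_one h.1 h.2.1
  compat := Or.inl fun _ hv => compat_of_mem_reachSubspace
    (mulVec_mem_reachSubspace_of_basis hM hne h)
    (fun _ hz => mulVec_mulVec_of_mem_reachSubspace hM hne h hz) hv

theorem IsObservableBasis.isReduction (h : IsObservableBasis M r P) (hM : Bornology.IsBounded M)
    (hne : M.Nonempty) : IsReduction M (reduction m p r P) (truncation r n * P⁻¹)
      (P * (truncation r n)ᵀ) where
  apply_eq := reduction_apply
  mul_eq_one := truncation_mul_inv_mul_eq_one h.1 h.2.1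
  compat := Or.inr fun _ hv => compat_of_mem_unobs (truncation_mul_inv_mul_eq_one h.1 h.2.1)
    (mem_unobs_iff hM hne h) hv

variable {L : Triple n m p →L[ℝ] Triple r m p} {J : Matrix (Fin r) (Fin n) ℝ}
  {K : Matrix (Fin n) (Fin r) ℝ}

/-- A form whose restriction along `K` is uncontrollable for the reduced system is uncontrollable
for `M`, hence kills the reachable range of `K`. Every reduced form `ζ` is such a restriction,
namely of `Jᵀ ζ`. -/
theorem unctrl_image_eq_bot_of_reachSubspace (hL : IsReduction M L J K)
    (hK : ∀ w, K *ᵥ w ∈ reachSubspace M) (hfix : ∀ z ∈ reachSubspace M, K *ᵥ (J *ᵥ z) = z) :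
    unctrl (L '' M) = ⊥ := by
  have hle : (unctrl (L '' M)).comap (Matrix.mulVecLin Kᵀ) ≤ unctrl M := by
    refine le_unctrl fun v hv ξ hξ => ?_
    have hinv := compat_of_mem_reachSubspace hK hfix hv
    have key := mulVec_mem_unctrl (mem_image_of_mem _ hv) hξ
    rw [hL.apply_eq, Matrix.mulVecLin_apply] at key
    rw [Submodule.mem_comap, Matrix.mulVecLin_apply]
    refine ⟨?_, ?_⟩
    · rw [Matrix.mulVec_mulVec, ← Matrix.transpose_mul, hinv.1, Matrix.transpose_mul,
        ← Matrix.mulVec_mulVec]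
      exact key.1
    · rw [hinv.2, Matrix.transpose_mul, ← Matrix.mulVec_mulVec]
      exact key.2
  rw [eq_bot_iff]
  intro ζ hζ
  have hζ' : Kᵀ *ᵥ (Jᵀ *ᵥ ζ) = ζ := by
    rw [Matrix.mulVec_mulVec, ← Matrix.transpose_mul, hL.mul_eq_one, Matrix.transpose_one,
      Matrix.one_mulVec]
  have hmem : Jᵀ *ᵥ ζ ∈ unctrl M := hle (by
    rw [Submodule.mem_comap, Matrix.mulVecLin_apply, hζ']
    exact hζ)
  have h0 : Kᵀ *ᵥ (Jᵀ *ᵥ ζ) = 0 := by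
    refine dotProduct_eq_zero _ fun w => ?_
    rw [Matrix.mulVec_transpose, ← Matrix.dotProduct_mulVec]
    exact hK w _ hmem
  rw [Submodule.mem_bot, ← hζ', h0]

/-- The second reduction must not spoil controllability: `Jᵀ` embeds the uncontrollable forms of the
quotient into those of `M`. -/
theorem unctrl_image_eq_bot_of_unobs (hL : IsReduction M L J K)
    (hJ : ∀ z, z ∈ unobs M ↔ J *ᵥ z = 0) (h0 : unctrl M = ⊥) : unctrl (L '' M) = ⊥ := by
  have hle : (unctrl (L '' M)).map (Matrix.mulVecLin Jᵀ) ≤ unctrl M := by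
    refine le_unctrl ?_
    rintro v hv _ ⟨ξ, hξ, rfl⟩
    have key := mulVec_mem_unctrl (mem_image_of_mem _ hv) hξ
    rw [hL.apply_eq] at key
    rw [Matrix.mulVecLin_apply]
    refine ⟨⟨_, key.1, ?_⟩, ?_⟩
    · rw [Matrix.mulVecLin_apply, Matrix.mulVec_mulVec, Matrix.mulVec_mulVec,
        ← Matrix.transpose_mul, ← Matrix.transpose_mul,
        ← (compat_of_mem_unobs hL.mul_eq_one hJ hv).1]
    · rw [Matrix.mulVec_mulVec, ← Matrix.transpose_mul]
      exact key.2
  rw [eq_bot_iff]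
  intro ζ hζ
  have hζ' : Jᵀ *ᵥ ζ = 0 := by
    have : Jᵀ *ᵥ ζ ∈ unctrl M := hle ⟨ζ, hζ, rfl⟩
    rwa [h0] at this
  have : Kᵀ *ᵥ (Jᵀ *ᵥ ζ) = ζ := by
    rw [Matrix.mulVec_mulVec, ← Matrix.transpose_mul, hL.mul_eq_one, Matrix.transpose_one,
      Matrix.one_mulVec]
  rw [Submodule.mem_bot, ← this, hζ', Matrix.mulVec_zero]

/-- The preimage under `J` of the unobservable states of the quotient is invariant and invisible, so
it lies in `unobs M`, the kernel of `J`. Since `J` is onto, nothing remains. -/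
theorem unobs_image_eq_bot_of_unobs (hL : IsReduction M L J K)
    (hJ : ∀ z, z ∈ unobs M ↔ J *ᵥ z = 0) : unobs (L '' M) = ⊥ := by
  have hle : (unobs (L '' M)).comap (Matrix.mulVecLin J) ≤ unobs M := by
    refine le_unobs fun v hv ξ hξ => ?_
    have hinv := compat_of_mem_unobs hL.mul_eq_one hJ hv
    have key := mulVec_mem_unobs (mem_image_of_mem _ hv) hξ
    rw [hL.apply_eq, Matrix.mulVecLin_apply] at key
    rw [Submodule.mem_comap, Matrix.mulVecLin_apply]
    refine ⟨?_, ?_⟩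
    · rw [Matrix.mulVec_mulVec, hinv.1, ← Matrix.mulVec_mulVec]
      exact key.1
    · rw [hinv.2, ← Matrix.mulVec_mulVec]
      exact key.2
  rw [eq_bot_iff]
  intro ζ hζ
  have hζ' : J *ᵥ (K *ᵥ ζ) = ζ := by
    rw [Matrix.mulVec_mulVec, hL.mul_eq_one, Matrix.one_mulVec]
  have hmem : K *ᵥ ζ ∈ unobs M := hle (by
    rw [Submodule.mem_comap, Matrix.mulVecLin_apply, hζ']
    exact hζ)
  rw [Submodule.mem_bot, ← hζ', (hJ _).1 hmem]

theorem exists_isReachableBasis (hM : Bornology.IsBounded M) (hne : M.Nonempty) :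
    ∃ (r : ℕ) (P : Matrix (Fin n) (Fin n) ℝ), IsReachableBasis M r P := by
  obtain ⟨W, hW⟩ := (reachSubspace M).exists_isCompl
  obtain ⟨r, hr, P, hP, h, -⟩ := exists_adapted_matrix hW
  exact ⟨r, P, hr, hP, (reachableSet_arbFamily hM hne).trans h⟩

theorem exists_isObservableBasis (hM : Bornology.IsBounded M) (hne : M.Nonempty) :
    ∃ (s : ℕ) (Q : Matrix (Fin n) (Fin n) ℝ), IsObservableBasis M s Q := by
  obtain ⟨W, hW⟩ := (unobs M).exists_isCompl
  obtain ⟨s, hs, Q, hQ, -, h⟩ := exists_adapted_matrix hW.symm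
  exact ⟨s, Q, hs, hQ, (compl_observableSet_arbFamily hM hne).trans h⟩

end

end SwitchedGain

end

/-! ### The proposition: composing the two reductions -/

theorem mainTheorem9 {n m p : ℕ}
    (M : Set (SwitchedGain.Triple n m p))
    (T : SwitchedGain.SignalClass (SwitchedGain.Triple n m p))
    (G : SwitchedGain.SignalFamily (SwitchedGain.Triple n m p))
    (hpair : SwitchedGain.IsSwitchedPair M T G)
    (hT2 : SwitchedGain.T2 M G) :
    (∃ (n' : ℕ) (L : SwitchedGain.Triple n m p →L[ℝ] SwitchedGain.Triple n' m p),
      SwitchedGain.IsMinimalRealization M n' L) ∧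
    ∀ (n' : ℕ) (L : SwitchedGain.Triple n m p →L[ℝ] SwitchedGain.Triple n' m p),
      SwitchedGain.IsMinimalRealization M n' L →
      Function.Surjective L ∧
      SwitchedGain.IsSwitchedPair (L '' M) (SwitchedGain.mapClass L T)
        (SwitchedGain.mapFamily L G) ∧
      SwitchedGain.IsControllable (SwitchedGain.mapFamily L G) ∧
      SwitchedGain.IsObservable (SwitchedGain.mapFamily L G) ∧
      SwitchedGain.T2 (L '' M) (SwitchedGain.mapFamily L G) ∧
      SwitchedGain.gain T = SwitchedGain.gain (SwitchedGain.mapClass L T) ∧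
      (SwitchedGain.T1 T G →
        SwitchedGain.T1 (SwitchedGain.mapClass L T) (SwitchedGain.mapFamily L G)) := by
  have hM := hpair.bounded
  have hne := hpair.nonempty
  refine ⟨?_, ?_⟩
  · obtain ⟨r, P, hP⟩ := SwitchedGain.exists_isReachableBasis hM hne
    have h₁ := hpair.map (SwitchedGain.reduction m p r P)
    obtain ⟨s, Q, hQ⟩ := SwitchedGain.exists_isObservableBasis h₁.bounded h₁.nonempty
    exact ⟨s, _, r, P, Q, hP, hQ, rfl⟩
  rintro n' _ ⟨r, P, Q, hP, hQ, rfl⟩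
  have h₁ := hpair.map (SwitchedGain.reduction m p r P)
  have h₂ := h₁.map (SwitchedGain.reduction m p n' Q)
  have hL₁ := hP.isReduction hM hne
  have hL₂ := hQ.isReduction h₁.bounded h₁.nonempty
  have hker := SwitchedGain.mem_unobs_iff h₁.bounded h₁.nonempty hQ
  have hT2' := hL₂.T2_map h₁.bounded (hL₁.T2_map hM hT2)
  -- The first reduction removes all uncontrollable forms and the second creates none.
  have hctrl := SwitchedGain.unctrl_image_eq_bot_of_unobs hL₂ hker
    (SwitchedGain.unctrl_image_eq_bot_of_reachSubspace hL₁
      (SwitchedGain.mulVec_mem_reachSubspace_of_basis hM hne hP)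
      fun _ hz => SwitchedGain.mulVec_mulVec_of_mem_reachSubspace hM hne hP hz)
  have hobs := SwitchedGain.unobs_image_eq_bot_of_unobs hL₂ hker
  -- Images under the composite are rewritten as successive images, so that each assertion follows
  -- one reduction at a time.
  rw [← SwitchedGain.mapClass_comp, ← SwitchedGain.mapFamily_comp, ContinuousLinearMap.coe_comp,
    Set.image_comp]
  exact ⟨hL₂.surjective.comp hL₁.surjective, h₂,
    SwitchedGain.isControllable_of_T2 h₂.bounded h₂.nonempty hT2' hctrl,
    SwitchedGain.isObservable_of_T2 h₂.bounded h₂.nonempty hT2' hobs, hT2',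
    (hL₁.gain_eq hM hpair.valued_class).trans (hL₂.gain_eq h₁.bounded h₁.valued_class),
    fun hT1 => hL₂.T1_map (hL₁.T1_map hT1)⟩
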